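/- Let $\mathbb T=\mathbb R/2\pi\mathbb Z$, $\langle r\rangle=1+|r|$ and $\phi^{\beta,\gamma}(k)=\beta k^3-\gamma k$. For a distribution $w$ on $\mathbb T\times\mathbb R$ with space-time Fourier transform $\widetilde w(k,\tau)$ (a measurable function of $\tau\in\mathbb R$ for each $k\in\mathbb Z$) put $$\|w\|_{X^{\beta,\gamma}_{s,b}}=\big\|\langle k\rangle^s\langle\tau-\phi^{\beta,\gamma}(k)\rangle^b\,\widetilde w(k,\tau)\big\|_{\ell^2_kL^2_\tau},\qquad \|w\|_{Y^{\beta,\gamma}_{s,b}}=\big\|\langle k\rangle^s\langle\tau-\phi^{\beta,\gamma}(k)\rangle^b\,\widetilde w(k,\tau)\big\|_{\ell^2_kL^1_\tau},$$ and $\|w\|_{Z^{\beta,\gamma}_{s,b}}=\|w\|_{X^{\beta,\gamma}_{s,b}}+\|w\|_{Y^{\beta,\gamma}_{s,b-1/2}}$. For $T>0$, let $X^{\beta,\gamma,T}_{s,b}$ and $Z^{\beta,\gamma,T}_{s,b}$ be the spaces of restrictions to $\mathbb T\times(0,T)$ of the distributions with finite $X^{\beta,\gamma}_{s,b}$-norm,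 respectively $Z^{\beta,\gamma}_{s,b}$-norm, with the quotient norm (the infimum of the norms of all extensions). **Lemma.** There is a constant $\theta>0$ such that the following holds. Let $\beta_1,\beta_2\in\mathbb R\setminus\{0\}$ with $\beta_1\neq\beta_2$ and $\beta_1/\beta_2<\tfrac14$. Then there are constants $\epsilon=\epsilon(\beta_1,\beta_2)>0$ and $C=C(\beta_1,\beta_2)>0$ such that for all real $\gamma_1,\gamma_2$ with $|\gamma_1|+|\gamma_2|<\epsilon$, all $s\ge0$, all $T\in(0,1)$, and all $u,v\in L^2(\mathbb T\times(0,T))$ whose means over $x\in\mathbb T$ vanish for almost every $t\in(0,T)$: a) if $u\in X^{\beta_1,\gamma_1,T}_{s,1/2}$ and $v\in X^{\beta_2,\gamma_2,T}_{s,1/2}$, then $$\|\partial_x(uv)\|_{Z^{\beta_2,\gamma_2,T}_{s,-1/2}}\le C\,T^{\theta}\,\|u\|_{X^{\beta_1,\gamma_1,T}_{s,1/2}}\,\|v\|_{X^{\beta_2,\gamma_2,T}_{s,1/2}};$$ b) if $u,v\in X^{\beta_2,\gamma_2,T}_{s,1/2}$, then $$\|\partial_x(uv)\|_{Z^{\beta_1,\gamma_1,T}_{s,-1/2}}\le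 C\,T^{\theta}\,\|u\|_{X^{\beta_2,\gamma_2,T}_{s,1/2}}\,\|v\|_{X^{\beta_2,\gamma_2,T}_{s,1/2}}.$$ In particular $\partial_x(uv)$, taken in the sense of distributions on $\mathbb T\times(0,T)$, belongs to the indicated space. -/

import Mathlib

open MeasureTheory Set
open scoped ENNReal ContDiff

noncomputable section

namespace Bourgain

instance twoPiPos : Fact (0 < 2 * Real.pi) := ⟨Real.two_pi_pos⟩

/-- The torus `ℝ / 2πℤ`; its `volume` is Lebesgue measure, of total mass `2π`, and
`fourier k x = exp (i k x)` on it. -/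
abbrev Torus : Type := AddCircle (2 * Real.pi)

/-- The bracket `⟨r⟩ = 1 + |r|`. -/
def bracket (r : ℝ) : ℝ := 1 + |r|

/-- The dispersion relation `φ^{β,γ}(k) = β k³ - γ k`
of the equation `∂ₜ v + β ∂ₓ³ v + γ ∂ₓ v = 0`. -/
def phase (β γ : ℝ) (k : ℤ) : ℝ := β * (k : ℝ) ^ 3 - γ * (k : ℝ)

/-- The `X_{s,b}^{β,γ}` norm of the distribution on `𝕋 × ℝ` with space-time Fourier transform
`F k τ`, namely `‖⟨k⟩^s ⟨τ - φ(k)⟩^b F(k, τ)‖` in `ℓ²(ℤ) L²(ℝ)`, with values in `[0, ∞]`. -/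
def normX (β γ s b : ℝ) (F : ℤ → ℝ → ℂ) : ℝ≥0∞ :=
  (∑' k : ℤ, ∫⁻ τ : ℝ,
    (ENNReal.ofReal (bracket k ^ s * bracket (τ - phase β γ k) ^ b) * ‖F k τ‖ₑ) ^ 2)
      ^ (1 / 2 : ℝ)

/-- The `Y_{s,b}^{β,γ}` norm: `‖⟨k⟩^s ⟨τ - φ(k)⟩^b F(k, τ)‖` in `ℓ²(ℤ) L¹(ℝ)`. -/
def normY (β γ s b : ℝ) (F : ℤ → ℝ → ℂ) : ℝ≥0∞ :=
  (∑' k : ℤ, (∫⁻ τ : ℝ,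
    ENNReal.ofReal (bracket k ^ s * bracket (τ - phase β γ k) ^ b) * ‖F k τ‖ₑ) ^ 2)
      ^ (1 / 2 : ℝ)

/-- The norm of `Z_{s,b} = X_{s,b} ∩ Y_{s,b-1/2}`. -/
def normZ (β γ s b : ℝ) (F : ℤ → ℝ → ℂ) : ℝ≥0∞ :=
  normX β γ s b F + normY β γ s (b - 1 / 2) F

/-- Test functions on `𝕋 × (0, T)`: smooth, with compact support. -/
def IsTestFunction (T : ℝ) (φ : Torus × ℝ → ℂ) : Prop :=
  ContDiff ℝ ∞ (fun p : ℝ × ℝ => φ ((p.1 : Torus), p.2)) ∧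
    ∃ a b : ℝ, 0 < a ∧ b < T ∧ ∀ (x : Torus) (t : ℝ), t ∉ Icc a b → φ (x, t) = 0

/-- The derivative in the space variable of a function on `𝕋 × ℝ`. -/
def derivX (φ : Torus × ℝ → ℂ) (p : Torus × ℝ) : ℂ :=
  deriv (fun y : ℝ => φ (p.1 + (y : Torus), p.2)) 0

/-- The functional `φ ↦ ⟨U, φ⟩`, where `U` is the distribution with space-time Fourier transform
`F`, that is, `U(x, t) = ∑ₖ (2π)⁻¹ ∫ F(k, τ) exp(i k x + i τ t) dτ`. -/
def ofFourier (F : ℤ → ℝ → ℂ) (φ : Torus × ℝ → ℂ) : ℂ :=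
  ∑' k : ℤ, (2 * Real.pi : ℂ)⁻¹ * ∫ τ : ℝ, F k τ *
    ∫ p : Torus × ℝ, φ p * fourier k p.1 * Complex.exp (Complex.I * (τ : ℂ) * (p.2 : ℂ))

/-- Lebesgue measure on the slab `𝕋 × (0, T)`. -/
def slab (T : ℝ) : Measure (Torus × ℝ) :=
  (volume : Measure (Torus × ℝ)).restrict (univ ×ˢ Ioo 0 T)

/-- The distribution `φ ↦ ∫∫ f φ dx dt` on `𝕋 × (0, T)` given by the function `f`. -/
def ofFunction (T : ℝ) (f : Torus × ℝ → ℂ) (φ : Torus × ℝ → ℂ) : ℂ :=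
  ∫ p, f p * φ p ∂(slab T)

/-- The distributional derivative in `x`: `⟨∂ₓ w, φ⟩ = - ⟨w, ∂ₓ φ⟩`. -/
def distribDerivX (w : (Torus × ℝ → ℂ) → ℂ) (φ : Torus × ℝ → ℂ) : ℂ :=
  - w (derivX φ)

/-- `F` is the space-time Fourier transform of an extension to `𝕋 × ℝ` of the distribution `w`
on `𝕋 × (0, T)`. -/
def IsExtension (T : ℝ) (w : (Torus × ℝ → ℂ) → ℂ) (F : ℤ → ℝ → ℂ) : Prop :=
  (∀ k, AEStronglyMeasurable (F k) volume) ∧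
    ∀ φ, IsTestFunction T φ → w φ = ofFourier F φ

/-- The quotient norm of the restriction space `X_{s,b}^{β,γ,T}`: the infimum of the
`X_{s,b}^{β,γ}` norms of the extensions of `w`. It is `∞` when `w` is not in the space. -/
def restrictedNormX (β γ s b T : ℝ) (w : (Torus × ℝ → ℂ) → ℂ) : ℝ≥0∞ :=
  ⨅ (F : ℤ → ℝ → ℂ) (_ : IsExtension T w F), normX β γ s b F

/-- The quotient norm of the restriction space `Z_{s,b}^{β,γ,T}`; it is `∞` when `w` is not in
the space. -/
def restrictedNormZ (β γ s b T : ℝ) (w : (Torus × ℝ → ℂ) → ℂ) : ℝ≥0∞ :=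
  ⨅ (F : ℤ → ℝ → ℂ) (_ : IsExtension T w F), normZ β γ s b F

/-- `[u] = 0`: the mean in `x` vanishes at almost every time in `(0, T)`. -/
def MeanZero (T : ℝ) (u : Torus × ℝ → ℂ) : Prop :=
  ∀ᵐ t : ℝ, t ∈ Ioo 0 T → ∫ x : Torus, u (x, t) = 0

end Bourgain

end

/-! ### Cauchy–Schwarz, duality and convolution on frequency space -/

noncomputable section

namespace Bourgain

/-! On the Fourier side the product is a convolution, and `∂ₓ` costs a factor `|k|` at the output
frequency `k = k₁ + k₂`. It is paid for by the resonance function `H = φ₀(k) - φ₁(k₁) - φ₂(k₂)`, a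
signed sum of the three modulations `τ - φ(k)`, so that the largest modulation controls `|H|`. For
these cubic phases `H` factors: in case a) it is `k₁` times a quadratic form in `(k, k₂)` plus `γ₁ -
γ₂`, in case b) `-k` times such an expression in `(k₁, k₂)`. Both forms have square coefficients `β₂
- β₁` and mixed coefficient `±(β₂ + 2β₁)`; they are definite because `4(β₂ - β₁)² - (β₂ + 2β₁)² =
3β₂²(1 - 4β₁/β₂) > 0`. Small `γ` do no harm, since the arguments are integers that are not both
zero. Hence `k² ≲ |H|` and `|k| k₁² ≲ |H|`, uniformly in `γ` (`exists_nonresonant_mixed`,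
`exists_nonresonant_diagonal`).

By the first bound, `|k|` is at most a sum of square roots of modulations. The square root either
cancels the exponent `-1/2` of the output or is absorbed by the weight `1/2` of one input. What
remains is an `L²` convolution estimate in which the other two weights enter only with exponent
`7/16`. Cauchy–Schwarz reduces it to summing `⟨p(l)⟩^(-5/8)` over integers `l`, for a quadratic or
cubic polynomial `p`, uniformly in the lower coefficients (`exists_tsum_bracket_eval_le`). For the
`Y` norm, Cauchy–Schwarz in `τ` leads back to the same estimates, except when the output modulation
dominates. There the two bounds together give `|k| |k₁| ≲ |H|^(3/4)`, and the factor `1/⟨k₁⟩` is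
square summable.

The power of `T` comes from the gap between `7/16` and `1/2`. Given an extension, its modulations
below `1/T` are localized in time to scale `T`, the others are left alone, and the zero mode is
dropped, which the vanishing means permit. The new transform still represents the function on the
slab, and its `X_{s,c}` norm is at most a multiple of `T^(1/2-c-1/64)` times the old `X_{s,1/2}`
norm. Each term of the bilinear bound has one factor with `c = 1/2` and one with `c = 7/16`, in all
`T^(-1/64) T^(3/64) = T^(1/32)`.

It must also be shown that the convolution of the modified transforms is an extension of `∂ₓ(uv)` in
the sense of distributions (`isExtension_derivProductTransform`). This is Parseval's identity in `x`
and `t`, applied once to each factor, with the rapid decay of the transforms of test functions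
justifying Fubini. The weight `⟨k⟩^s` is submultiplicative with constant one, so `C` does not depend
on `s`. -/

/-- Counting measure times Lebesgue measure on the frequency space `ℤ × ℝ`. -/
def freqMeasure : Measure (ℤ × ℝ) := (Measure.count : Measure ℤ).prod volume

instance : SigmaFinite freqMeasure := by unfold freqMeasure; infer_instance

instance countInt_isAddLeftInvariant : (Measure.count : Measure ℤ).IsAddLeftInvariant := by
  refine ⟨fun g => ?_⟩
  ext s hs
  rw [Measure.map_apply (measurable_const_add g) hs, Measure.count_apply hs,
    Measure.count_apply (measurable_const_add g hs)]
  congr 1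
  exact Set.encard_preimage_of_bijective (AddGroup.addLeft_bijective g) s

instance countInt_isNegInvariant : (Measure.count : Measure ℤ).IsNegInvariant := by
  refine ⟨?_⟩
  ext s hs
  rw [Measure.neg, Measure.map_apply measurable_neg hs, Measure.count_apply hs,
    Measure.count_apply (measurable_neg hs)]
  congr 1
  exact Set.encard_preimage_of_bijective (neg_involutive.bijective) s

instance : freqMeasure.IsAddLeftInvariant := by unfold freqMeasure; infer_instance

instance : freqMeasure.IsNegInvariant := by
  refine ⟨?_⟩
  have := Measure.map_prod_map (Measure.count : Measure ℤ) (volume : Measure ℝ)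
    measurable_neg measurable_neg
  rw [← Measure.neg, ← Measure.neg, Measure.neg_eq_self, Measure.neg_eq_self] at this
  rw [Measure.neg, freqMeasure]
  exact this.symm

theorem lintegral_freqMeasure {f : ℤ × ℝ → ℝ≥0∞} (hf : Measurable f) :
    ∫⁻ x, f x ∂freqMeasure = ∑' k : ℤ, ∫⁻ τ : ℝ, f (k, τ) := by
  rw [freqMeasure, lintegral_prod _ hf.aemeasurable, lintegral_count]

theorem lintegral_mul_sq_le {α : Type*} [MeasurableSpace α] (μ : Measure α) {f g : α → ℝ≥0∞}
    (hf : AEMeasurable f μ) (hg : AEMeasurable g μ) :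
    (∫⁻ x, f x * g x ∂μ) ^ 2 ≤ (∫⁻ x, f x ^ 2 ∂μ) * ∫⁻ x, g x ^ 2 ∂μ := by
  have h := ENNReal.lintegral_mul_le_Lp_mul_Lq μ Real.HolderConjugate.two_two hf hg
  calc (∫⁻ x, f x * g x ∂μ) ^ 2
      ≤ ((∫⁻ x, f x ^ (2:ℝ) ∂μ) ^ (1 / (2:ℝ)) * (∫⁻ x, g x ^ (2:ℝ) ∂μ) ^ (1 / (2:ℝ))) ^ 2 := by
        gcongr; exact h
    _ = _ := by
        rw [mul_pow, ← ENNReal.rpow_natCast, ← ENNReal.rpow_natCast, ← ENNReal.rpow_mul,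
          ← ENNReal.rpow_mul]
        norm_num

/-- An `L²` bound follows from a bound on all pairings. -/
theorem lintegral_sq_le_of_dual {α : Type*} [MeasurableSpace α] (μ : Measure α) [SigmaFinite μ]
    {A : α → ℝ≥0∞} (hA : Measurable A) {D : ℝ≥0∞}
    (h : ∀ g : α → ℝ≥0∞, Measurable g → (∫⁻ x, g x * A x ∂μ) ^ 2 ≤ D * ∫⁻ x, g x ^ 2 ∂μ) :
    ∫⁻ x, A x ^ 2 ∂μ ≤ D := by
  -- The norm of `A` is not known to be finite, so `A` is truncated in height and to sets of finite
  -- measure. For a truncation the square norm is finite and can be cancelled from both sides;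
  -- monotone convergence then gives `A`.
  set g : ℕ → α → ℝ≥0∞ := fun n => (spanningSets μ n).indicator (fun x => min (A x) n) with hg
  have hgm : ∀ n, Measurable (g n) := fun n =>
    (hA.min measurable_const).indicator (measurableSet_spanningSets μ n)
  have hgmono : Monotone g := by
    intro m n hmn x
    simp only [hg]
    by_cases hx : x ∈ spanningSets μ m
    · have hx' : x ∈ spanningSets μ n := monotone_spanningSets μ hmn hx
      rw [indicator_of_mem hx, indicator_of_mem hx']
      exact min_le_min le_rfl (by exact_mod_cast hmn)
    · rw [indicator_of_notMem hx]; exact zero_le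
  have hgA : ∀ n x, g n x ≤ A x := fun n x =>
    (indicator_le_self' (fun _ _ => zero_le) x).trans (min_le_left _ _)
  have hsup : ∀ x, ⨆ n, g n x ^ 2 = A x ^ 2 := by
    intro x
    apply le_antisymm (iSup_le fun n => by gcongr; exact hgA n x)
    refine le_of_tendsto' (x := Filter.atTop) (f := fun n : ℕ => min (A x) n ^ 2) ?_ ?_
    · have : Filter.Tendsto (fun n : ℕ => min (A x) (n : ℝ≥0∞)) Filter.atTop (nhds (min (A x) ⊤)) :=
        tendsto_const_nhds.min ENNReal.tendsto_nat_nhds_top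
      simp only [le_top, inf_of_le_left] at this
      exact (ENNReal.continuous_pow 2).continuousAt.tendsto.comp this
    · intro n
      set m := max n (spanningSetsIndex μ x)
      refine le_trans ?_ (le_iSup _ m)
      have : x ∈ spanningSets μ m :=
        monotone_spanningSets μ (le_max_right _ _) (mem_spanningSetsIndex μ x)
      simp only [hg]
      rw [indicator_of_mem this]
      gcongr
      exact le_max_left _ _
  have hfin : ∀ n, ∫⁻ x, g n x ^ 2 ∂μ ≠ ⊤ := by
    intro n
    refine ne_top_of_le_ne_top (b := ∫⁻ x, (spanningSets μ n).indicator (fun _ => (n:ℝ≥0∞)^2) x ∂μ) ?_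
      (lintegral_mono fun x => ?_)
    · rw [lintegral_indicator (measurableSet_spanningSets μ n), setLIntegral_const]
      exact ENNReal.mul_ne_top (by simp) (measure_spanningSets_lt_top μ n).ne
    · simp only [hg]
      by_cases hx : x ∈ spanningSets μ n
      · rw [indicator_of_mem hx, indicator_of_mem hx]; gcongr; exact min_le_right _ _
      · rw [indicator_of_notMem hx, indicator_of_notMem hx]; simp
  have hle : ∀ n, ∫⁻ x, g n x ^ 2 ∂μ ≤ D := by
    intro n
    by_cases h0 : ∫⁻ x, g n x ^ 2 ∂μ = 0
    · rw [h0]; exact zero_le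
    have h1 : (∫⁻ x, g n x ^ 2 ∂μ) ≤ ∫⁻ x, g n x * A x ∂μ := lintegral_mono fun x => by
      rw [sq]; gcongr; exact hgA n x
    have h2 : (∫⁻ x, g n x ^ 2 ∂μ) * (∫⁻ x, g n x ^ 2 ∂μ) ≤ D * ∫⁻ x, g n x ^ 2 ∂μ := by
      rw [← sq]
      exact le_trans (by gcongr) (h (g n) (hgm n))
    exact (ENNReal.mul_le_mul_iff_left h0 (hfin n)).1 h2
  calc ∫⁻ x, A x ^ 2 ∂μ = ∫⁻ x, ⨆ n, g n x ^ 2 ∂μ := by simp_rw [hsup]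
    _ = ⨆ n, ∫⁻ x, g n x ^ 2 ∂μ := by
        refine lintegral_iSup (fun n => (hgm n).pow_const 2) ?_
        intro m n hmn x
        exact pow_le_pow_left' (hgmono hmn x) 2
    _ ≤ D := iSup_le hle

/-- Convolution of nonnegative functions on `ℤ × ℝ`. -/
def conv (f g : ℤ × ℝ → ℝ≥0∞) (x : ℤ × ℝ) : ℝ≥0∞ := ∫⁻ y, f y * g (x - y) ∂freqMeasure

theorem measurable_conv {f g : ℤ × ℝ → ℝ≥0∞} (hf : Measurable f) (hg : Measurable g) :
    Measurable (conv f g) := by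
  unfold conv
  refine Measurable.lintegral_prod_right ?_
  fun_prop

theorem conv_comm (f g : ℤ × ℝ → ℝ≥0∞) : conv f g = conv g f := by
  ext x
  unfold conv
  rw [← lintegral_sub_left_eq_self (fun y => f y * g (x - y)) x]
  simp [mul_comm]

theorem lintegral_lintegral_mul_sub {f g : ℤ × ℝ → ℝ≥0∞} (hf : Measurable f) (hg : Measurable g) :
    ∫⁻ x, ∫⁻ y, f y * g (x - y) ∂freqMeasure ∂freqMeasure
      = (∫⁻ y, f y ∂freqMeasure) * ∫⁻ z, g z ∂freqMeasure := by
  rw [lintegral_lintegral_swap (by fun_prop)]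
  have : ∀ y, ∫⁻ x, f y * g (x - y) ∂freqMeasure = f y * ∫⁻ z, g z ∂freqMeasure := by
    intro y
    rw [lintegral_const_mul _ (by fun_prop), lintegral_sub_right_eq_self]
  simp_rw [this]
  rw [lintegral_mul_const _ hf]

/-- Cauchy–Schwarz at each fixed output `x` separates the weights from the functions, and the
integral of the convolution of `f²` and `g²` factors. This serves the case where the output carries
the large modulation. -/
theorem lintegral_conv_sq_le {f g m₁ m₂ : ℤ × ℝ → ℝ≥0∞} (hf : Measurable f) (hg : Measurable g)
    (hm₁ : Measurable m₁) (hm₂ : Measurable m₂) {S : Set (ℤ × ℝ)} (hS : MeasurableSet S)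
    {K : ℝ≥0∞} (h : ∀ x ∈ S, conv (fun y => m₁ y ^ 2) (fun y => m₂ y ^ 2) x ≤ K) :
    ∫⁻ x in S, conv (fun y => m₁ y * f y) (fun y => m₂ y * g y) x ^ 2 ∂freqMeasure
      ≤ K * (∫⁻ y, f y ^ 2 ∂freqMeasure) * ∫⁻ y, g y ^ 2 ∂freqMeasure := by
  have h1 : ∀ x ∈ S, conv (fun y => m₁ y * f y) (fun y => m₂ y * g y) x ^ 2
      ≤ K * ∫⁻ y, f y ^ 2 * g (x - y) ^ 2 ∂freqMeasure := by
    intro x hx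
    have := lintegral_mul_sq_le freqMeasure (f := fun y => m₁ y * m₂ (x - y))
      (g := fun y => f y * g (x - y)) (by fun_prop) (by fun_prop)
    calc _ = (∫⁻ y, m₁ y * m₂ (x - y) * (f y * g (x - y)) ∂freqMeasure) ^ 2 := by
          unfold conv
          congr 2 with y
          ring
      _ ≤ _ := this
      _ ≤ _ := by
          simp_rw [mul_pow]
          gcongr
          exact h x hx
  calc _ ≤ ∫⁻ x in S, K * ∫⁻ y, f y ^ 2 * g (x - y) ^ 2 ∂freqMeasure ∂freqMeasure :=
        setLIntegral_mono' hS h1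
    _ ≤ ∫⁻ x, K * ∫⁻ y, f y ^ 2 * g (x - y) ^ 2 ∂freqMeasure ∂freqMeasure :=
        setLIntegral_le_lintegral _ _
    _ = _ := by
        rw [lintegral_const_mul, lintegral_lintegral_mul_sub (hf.pow_const 2) (hg.pow_const 2),
          mul_assoc]
        exact measurable_conv (hf.pow_const 2) (hg.pow_const 2)

/-- By duality the roles of the output and of the input `f` are exchanged: pairing with `q` and
applying Cauchy–Schwarz in `(x, y)` puts both weights on `f`. Their overlap then matters only for
fixed `y` with `f y ≠ 0`, which is how the zero mode gets excluded. -/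
theorem lintegral_weight_mul_conv_sq_le {f g m₀ m₂ : ℤ × ℝ → ℝ≥0∞} (hf : Measurable f)
    (hg : Measurable g) (hm₀ : Measurable m₀) (hm₂ : Measurable m₂) {K : ℝ≥0∞}
    (h : ∀ y, f y ≠ 0 → ∫⁻ x, m₀ x ^ 2 * m₂ (x - y) ^ 2 ∂freqMeasure ≤ K) :
    ∫⁻ x, (m₀ x * conv f (fun y => m₂ y * g y) x) ^ 2 ∂freqMeasure
      ≤ K * (∫⁻ y, f y ^ 2 ∂freqMeasure) * ∫⁻ y, g y ^ 2 ∂freqMeasure := by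
  refine lintegral_sq_le_of_dual (A := fun x => m₀ x * conv f (fun y => m₂ y * g y) x) _ (hm₀.mul (measurable_conv hf (hm₂.mul hg))) fun q hq => ?_
  have e1 : ∫⁻ x, q x * (m₀ x * conv f (fun y => m₂ y * g y) x) ∂freqMeasure
      = ∫⁻ p, (f p.2 * (m₀ p.1 * m₂ (p.1 - p.2))) * (q p.1 * g (p.1 - p.2))
        ∂(freqMeasure.prod freqMeasure) := by
    rw [lintegral_prod _ (by fun_prop)]
    refine lintegral_congr fun x => ?_
    unfold conv
    rw [← mul_assoc, ← lintegral_const_mul _ (by fun_prop)]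
    refine lintegral_congr fun y => ?_
    ring
  change (∫⁻ x, q x * (m₀ x * conv f (fun y => m₂ y * g y) x) ∂freqMeasure) ^ 2 ≤ _
  rw [e1]
  refine (lintegral_mul_sq_le _ (by fun_prop) (by fun_prop)).trans ?_
  have e2 : ∫⁻ p, (f p.2 * (m₀ p.1 * m₂ (p.1 - p.2))) ^ 2 ∂(freqMeasure.prod freqMeasure)
      ≤ K * ∫⁻ y, f y ^ 2 ∂freqMeasure := by
    rw [lintegral_prod_symm _ (by fun_prop), ← lintegral_const_mul _ (by fun_prop)]
    refine lintegral_mono fun y => ?_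
    simp_rw [mul_pow]
    rw [lintegral_const_mul _ (by fun_prop), mul_comm]
    by_cases hy : f y = 0
    · simp [hy]
    · gcongr; exact h y hy
  have e3 : ∫⁻ p, (q p.1 * g (p.1 - p.2)) ^ 2 ∂(freqMeasure.prod freqMeasure)
      = (∫⁻ x, q x ^ 2 ∂freqMeasure) * ∫⁻ y, g y ^ 2 ∂freqMeasure := by
    rw [lintegral_prod _ (by fun_prop)]
    simp_rw [mul_pow]
    have : ∀ x, ∫⁻ y, q x ^ 2 * g (x - y) ^ 2 ∂freqMeasure
        = q x ^ 2 * ∫⁻ y, g y ^ 2 ∂freqMeasure := by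
      intro x
      rw [lintegral_const_mul _ (by fun_prop),
        lintegral_sub_left_eq_self (fun y => g y ^ 2) x]
    simp_rw [this]
    rw [lintegral_mul_const _ (by fun_prop)]
  rw [e3]
  calc _ ≤ (K * ∫⁻ y, f y ^ 2 ∂freqMeasure) * ((∫⁻ x, q x ^ 2 ∂freqMeasure)
        * ∫⁻ y, g y ^ 2 ∂freqMeasure) := by gcongr
    _ = _ := by ring

end Bourgain
end

/-! ### Brackets and the sparsity of integers where a polynomial is small -/

noncomputable section

namespace Bourgain

theorem one_le_bracket (r : ℝ) : 1 ≤ bracket r := by unfold bracket; linarith [abs_nonneg r]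

theorem bracket_pos (r : ℝ) : 0 < bracket r := zero_lt_one.trans_le (one_le_bracket r)

theorem bracket_neg (r : ℝ) : bracket (-r) = bracket r := by simp [bracket]

theorem bracket_add_le (a b : ℝ) : bracket (a + b) ≤ bracket a + bracket b := by
  unfold bracket; linarith [abs_add_le a b]

theorem bracket_add_le_mul (a b : ℝ) : bracket (a + b) ≤ bracket a * bracket b := by
  unfold bracket; nlinarith [abs_add_le a b, mul_nonneg (abs_nonneg a) (abs_nonneg b)]

@[fun_prop]
theorem continuous_bracket : Continuous bracket := by unfold bracket; fun_prop

@[fun_prop]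
theorem measurable_bracket : Measurable bracket := continuous_bracket.measurable

theorem lintegral_bracket_rpow_lt_top {p : ℝ} (hp : 1 < p) :
    ∫⁻ x : ℝ, ENNReal.ofReal (bracket x ^ (-p)) < ⊤ := by
  have := integrable_one_add_norm (E := ℝ) (μ := volume) (r := p) (by simpa using hp)
  simpa [bracket, Real.norm_eq_abs] using this.lintegral_lt_top

theorem tsum_bracket_rpow_lt_top {p : ℝ} (hp : 1 < p) :
    ∑' k : ℤ, ENNReal.ofReal (bracket k ^ (-p)) < ⊤ := by
  have h0 : Summable fun n : ℕ => ((n + 1 : ℕ) : ℝ) ^ (-p) :=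
    (summable_nat_add_iff 1 (f := fun n : ℕ => (n : ℝ) ^ (-p))).2
      (Real.summable_nat_rpow.2 (by linarith))
  have h : Summable fun k : ℤ => bracket k ^ (-p) := by
    apply Summable.of_nat_of_neg
    · refine h0.congr fun n => ?_
      simp [bracket, add_comm]
    · refine h0.congr fun n => ?_
      simp [bracket, add_comm]
  rw [← ENNReal.ofReal_tsum_of_nonneg (fun k => Real.rpow_nonneg (bracket_pos _).le _) h]
  exact ENNReal.ofReal_lt_top

/-- Replacing `r` by its integer part changes each bracket by at most a factor `2`, and integer
shifts permute the sum. -/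
theorem tsum_bracket_sub_rpow_le {p : ℝ} (hp : 0 ≤ p) (r : ℝ) :
    ∑' k : ℤ, ENNReal.ofReal (bracket (k - r) ^ (-p))
      ≤ ENNReal.ofReal (2 ^ p) * ∑' k : ℤ, ENNReal.ofReal (bracket k ^ (-p)) := by
  have h1 : ∀ k : ℤ, ENNReal.ofReal (bracket (k - r) ^ (-p))
      ≤ ENNReal.ofReal (2 ^ p) * ENNReal.ofReal (bracket ((k - ⌊r⌋ : ℤ) : ℝ) ^ (-p)) := by
    intro k
    rw [← ENNReal.ofReal_mul (by positivity)]
    apply ENNReal.ofReal_le_ofReal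
    have hb : bracket ((k - ⌊r⌋ : ℤ) : ℝ) ≤ 2 * bracket (k - r) := by
      have e : ((k - ⌊r⌋ : ℤ) : ℝ) = (k - r) + Int.fract r := by
        push_cast; rw [Int.fract]; ring
      have h3 := abs_add_le ((k : ℝ) - r) (Int.fract r)
      rw [abs_of_nonneg (Int.fract_nonneg r)] at h3
      rw [e]
      unfold bracket
      linarith [Int.fract_lt_one r, abs_nonneg ((k : ℝ) - r)]
    calc bracket (k - r) ^ (-p) = 2 ^ p * (2 * bracket (k - r)) ^ (-p) := by
          rw [Real.mul_rpow (by norm_num) (bracket_pos _).le, ← mul_assoc,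
            ← Real.rpow_add (by norm_num)]
          simp
      _ ≤ _ := by
          gcongr 2 ^ p * ?_
          exact Real.rpow_le_rpow_of_nonpos (bracket_pos _) hb (by linarith)
  calc _ ≤ ∑' k : ℤ, ENNReal.ofReal (2 ^ p) * ENNReal.ofReal (bracket ((k - ⌊r⌋ : ℤ) : ℝ) ^ (-p)) :=
        ENNReal.tsum_le_tsum h1
    _ = _ := by
        rw [ENNReal.tsum_mul_left]
        congr 1
        exact (Equiv.subRight ⌊r⌋).tsum_eq (fun k : ℤ => ENNReal.ofReal (bracket k ^ (-p)))

/-- The larger of the two is at least `c / 2` and gives up `5/8` of its `7/8`. Its remaining `-1/4`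
passes to the smaller one, whose exponent becomes `-9/8`, integrable on the line. -/
theorem rpow_mul_rpow_le_of_le_add {a b c : ℝ} (ha : 1 ≤ a) (hb : 1 ≤ b) (hc : 0 < c)
    (h : c ≤ a + b) :
    a ^ (-(7 / 8) : ℝ) * b ^ (-(7 / 8) : ℝ)
      ≤ 2 * c ^ (-(5 / 8) : ℝ) * (a ^ (-(9 / 8) : ℝ) + b ^ (-(9 / 8) : ℝ)) := by
  wlog hab : b ≤ a generalizing a b
  · have := this hb ha (by linarith) (by linarith)
    linarith
  have ha0 : 0 < a := by linarith
  have hb0 : 0 < b := by linarith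
  have h1 : c ^ (5 / 8 : ℝ) ≤ 2 * a ^ (5 / 8 : ℝ) := by
    calc c ^ (5 / 8 : ℝ) ≤ (2 * a) ^ (5 / 8 : ℝ) := by gcongr; linarith
      _ = 2 ^ (5 / 8 : ℝ) * a ^ (5 / 8 : ℝ) := Real.mul_rpow (by norm_num) ha0.le
      _ ≤ 2 ^ (1 : ℝ) * a ^ (5 / 8 : ℝ) := by
          gcongr <;> norm_num
      _ = _ := by simp
  have h2 : a ^ (-(1 / 4) : ℝ) ≤ b ^ (-(1 / 4) : ℝ) :=
    Real.rpow_le_rpow_of_nonpos hb0 hab (by norm_num)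
  have hcp : 0 < c ^ (5 / 8 : ℝ) := by positivity
  have e1 : c ^ (-(5 / 8) : ℝ) * c ^ (5 / 8 : ℝ) = 1 := by
    rw [← Real.rpow_add hc]; norm_num
  have e2 : a ^ (5 / 8 : ℝ) * a ^ (-(7 / 8) : ℝ) = a ^ (-(1 / 4) : ℝ) := by
    rw [← Real.rpow_add ha0]; norm_num
  have e3 : b ^ (-(1 / 4) : ℝ) * b ^ (-(7 / 8) : ℝ) = b ^ (-(9 / 8) : ℝ) := by
    rw [← Real.rpow_add hb0]; norm_num
  have hbp : 0 < b ^ (-(7 / 8) : ℝ) := by positivity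
  have hap : 0 < a ^ (-(7 / 8) : ℝ) := by positivity
  have hcn : 0 < c ^ (-(5 / 8) : ℝ) := by positivity
  calc a ^ (-(7 / 8) : ℝ) * b ^ (-(7 / 8) : ℝ)
      = c ^ (-(5 / 8) : ℝ) * (c ^ (5 / 8 : ℝ) * (a ^ (-(7 / 8) : ℝ) * b ^ (-(7 / 8) : ℝ))) := by
        rw [← mul_assoc, e1, one_mul]
    _ ≤ c ^ (-(5 / 8) : ℝ) * (2 * a ^ (5 / 8 : ℝ) * (a ^ (-(7 / 8) : ℝ) * b ^ (-(7 / 8) : ℝ))) := by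
        gcongr
    _ = 2 * c ^ (-(5 / 8) : ℝ) * (a ^ (-(1 / 4) : ℝ) * b ^ (-(7 / 8) : ℝ)) := by rw [← e2]; ring
    _ ≤ 2 * c ^ (-(5 / 8) : ℝ) * (b ^ (-(1 / 4) : ℝ) * b ^ (-(7 / 8) : ℝ)) := by gcongr
    _ ≤ _ := by
        rw [e3]; gcongr
        have : 0 < a ^ (-(9 / 8) : ℝ) := by positivity
        linarith

/-- The constant in `lintegral_bracket_mul_bracket_le`. -/
def overlapConst : ℝ≥0∞ := 4 * ∫⁻ x : ℝ, ENNReal.ofReal (bracket x ^ (-(9 / 8) : ℝ))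

theorem overlapConst_lt_top : overlapConst < ⊤ :=
  ENNReal.mul_lt_top (by simp) (lintegral_bracket_rpow_lt_top (by norm_num))

theorem lintegral_bracket_mul_bracket_le (A B : ℝ) :
    ∫⁻ x : ℝ, ENNReal.ofReal (bracket (x - A) ^ (-(7 / 8) : ℝ)) *
        ENNReal.ofReal (bracket (x - B) ^ (-(7 / 8) : ℝ))
      ≤ overlapConst * ENNReal.ofReal (bracket (A - B) ^ (-(5 / 8) : ℝ)) := by
  have hm : ∀ A : ℝ, Measurable fun x : ℝ => ENNReal.ofReal (bracket (x - A) ^ (-(9 / 8) : ℝ)) := by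
    intro A; fun_prop
  have hi : ∀ A : ℝ, ∫⁻ x : ℝ, ENNReal.ofReal (bracket (x - A) ^ (-(9 / 8) : ℝ))
      = ∫⁻ x : ℝ, ENNReal.ofReal (bracket x ^ (-(9 / 8) : ℝ)) := fun A =>
    lintegral_sub_right_eq_self (fun x => ENNReal.ofReal (bracket x ^ (-(9 / 8) : ℝ))) A
  have h0 : ∀ r p : ℝ, 0 ≤ bracket r ^ p := fun r p => Real.rpow_nonneg (bracket_pos r).le p
  calc _ ≤ ∫⁻ x : ℝ, (2 * ENNReal.ofReal (bracket (A - B) ^ (-(5 / 8) : ℝ))) *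
        (ENNReal.ofReal (bracket (x - A) ^ (-(9 / 8) : ℝ)) +
          ENNReal.ofReal (bracket (x - B) ^ (-(9 / 8) : ℝ))) := by
        refine lintegral_mono fun x => ?_
        have e2 : (2 : ℝ≥0∞) = ENNReal.ofReal 2 := by simp
        rw [← ENNReal.ofReal_add (h0 _ _) (h0 _ _), ← ENNReal.ofReal_mul (h0 _ _), e2,
          ← ENNReal.ofReal_mul (by norm_num), ← ENNReal.ofReal_mul
          (mul_nonneg (by norm_num) (h0 _ _))]
        apply ENNReal.ofReal_le_ofReal
        apply rpow_mul_rpow_le_of_le_add (one_le_bracket _) (one_le_bracket _) (bracket_pos _)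
        have := bracket_add_le (-(x - A)) (x - B)
        rw [bracket_neg] at this
        convert this using 2
        ring
    _ = _ := by
        rw [lintegral_const_mul _ (by fun_prop), lintegral_add_left (hm A), hi, hi, overlapConst]
        ring

theorem tsum_multiset_sum {α : Type*} (s : Multiset α) (f : ℤ → α → ℝ≥0∞) :
    ∑' k, (s.map (f k)).sum = (s.map fun r => ∑' k, f k r).sum := by
  induction s using Multiset.induction with
  | empty => simp
  | cons a s ih => simp [ENNReal.tsum_add, ih]

theorem exists_mem_pow_le_prod (s : Multiset ℝ) (hs : s ≠ 0) (h0 : ∀ a ∈ s, 0 ≤ a) :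
    ∃ a ∈ s, a ^ Multiset.card s ≤ s.prod := by
  obtain ⟨a, ha, hmin⟩ : ∃ a ∈ s, ∀ b ∈ s, a ≤ b := by
    have hne : s.toFinset.Nonempty := by simpa [Multiset.toFinset_nonempty] using hs
    obtain ⟨a, ha, h⟩ := s.toFinset.exists_min_image id hne
    exact ⟨a, by simpa using ha, fun b hb => h b (by simpa using hb)⟩
  refine ⟨a, ha, ?_⟩
  have := Multiset.prod_map_le_prod_map₀ (s := s) (fun _ => a) id (fun b hb => h0 a ha)
    (fun b hb => hmin b hb)
  simpa using this

/-- Integer points are sparse on the sublevel sets of a polynomial, uniformly in all coefficients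
but the leading one. -/
theorem exists_tsum_bracket_eval_le {d : ℕ} (hd : 2 ≤ d) {c : ℝ} (hc : 0 < c) :
    ∃ K : ℝ≥0∞, K < ⊤ ∧ ∀ p : Polynomial ℝ, p.natDegree = d → c ≤ |p.leadingCoeff| →
      ∑' k : ℤ, ENNReal.ofReal (bracket (p.eval (k : ℝ)) ^ (-(5 / 8) : ℝ)) ≤ K := by
  -- Already for `d = 2` this exceeds `1`, which makes the sum over integers converge.
  set r : ℝ := d * (5 / 8) with hr
  have hr1 : 1 < r := by
    have : (2 : ℝ) ≤ d := by exact_mod_cast hd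
    rw [hr]; linarith
  -- Chosen so that `(1 + t)^d ≤ 2^d (1 + t^d)` yields `c₁ (1 + t)^d ≤ 1 + c t^d`.
  set c₁ : ℝ := min 1 c / 2 ^ d with hc₁
  have hc₁0 : 0 < c₁ := by positivity
  set S : ℝ≥0∞ := ENNReal.ofReal (2 ^ r) * ∑' k : ℤ, ENNReal.ofReal (bracket k ^ (-r)) with hS
  refine ⟨ENNReal.ofReal (c₁ ^ (-(5 / 8) : ℝ)) * (d * S), ?_, ?_⟩
  · exact ENNReal.mul_lt_top ENNReal.ofReal_lt_top (ENNReal.mul_lt_top (by simp)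
      (ENNReal.mul_lt_top ENNReal.ofReal_lt_top (tsum_bracket_rpow_lt_top hr1)))
  intro p hpd hpc
  set q : Polynomial ℂ := p.map (algebraMap ℝ ℂ) with hq
  have hqs : q.Splits := IsAlgClosed.splits q
  have hcard : Multiset.card q.roots = d := by
    rw [← hqs.natDegree_eq_card_roots, hq, Polynomial.natDegree_map, hpd]
  have heval : ∀ x : ℝ, |p.eval x| = |p.leadingCoeff| * (q.roots.map fun z => ‖(x : ℂ) - z‖).prod := by
    intro x
    have h1 : q.eval (x : ℂ) = ((p.eval x : ℝ) : ℂ) := by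
      rw [hq, Polynomial.eval_map_algebraMap]
      exact Polynomial.aeval_algebraMap_apply ℂ x p
    have h2 : q.eval (x : ℂ) = q.leadingCoeff * (q.roots.map fun z => (x : ℂ) - z).prod := by
      rw [hqs.eval_eq_prod_roots]
    rw [h1] at h2
    have h3 := congrArg norm h2
    rw [norm_mul, Complex.norm_real, Real.norm_eq_abs] at h3
    rw [h3, hq, Polynomial.leadingCoeff_map]
    congr 1
    · simp
    · have := map_multiset_prod (normHom : ℂ →*₀ ℝ) (q.roots.map fun z => (x : ℂ) - z)
      rw [Multiset.map_map] at this
      exact this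
  have hpt : ∀ k : ℤ, ENNReal.ofReal (bracket (p.eval (k : ℝ)) ^ (-(5 / 8) : ℝ))
      ≤ ENNReal.ofReal (c₁ ^ (-(5 / 8) : ℝ)) *
        (q.roots.map fun z => ENNReal.ofReal (bracket (k - z.re) ^ (-r))).sum := by
    intro k
    -- Each integer is charged to its nearest complex root `z`, and `|k - z|` is bounded below by
    -- `|k - Re z|`. The sum is thus dominated by `d` translates of one convergent series, wherever
    -- the roots lie.
    obtain ⟨a, ha, hle⟩ := exists_mem_pow_le_prod (q.roots.map fun z => ‖((k : ℝ) : ℂ) - z‖)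
      (by intro h; have := congrArg Multiset.card h; simp [hcard] at this; omega)
      (by intro a ha; obtain ⟨z, -, rfl⟩ := Multiset.mem_map.1 ha; positivity)
    obtain ⟨z, hz, rfl⟩ := Multiset.mem_map.1 ha
    rw [Multiset.card_map, hcard] at hle
    have ht : |(k : ℝ) - z.re| ≤ ‖((k : ℝ) : ℂ) - z‖ := by
      have := Complex.abs_re_le_norm (((k : ℝ) : ℂ) - z)
      simpa using this
    set t := |(k : ℝ) - z.re| with htdef
    have ht0 : 0 ≤ t := abs_nonneg _
    have hb : c₁ * bracket (k - z.re) ^ d ≤ bracket (p.eval (k : ℝ)) := by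
      have h1 : c * t ^ d ≤ |p.eval (k : ℝ)| := by
        rw [heval]
        have : t ^ d ≤ ‖((k : ℝ) : ℂ) - z‖ ^ d := by gcongr
        exact mul_le_mul hpc (this.trans hle) (by positivity) (abs_nonneg _)
      have h2 : (1 + t) ^ d ≤ 2 ^ d * (1 + t ^ d) := by
        rcases le_total t 1 with h | h
        · calc (1 + t) ^ d ≤ 2 ^ d := by gcongr; linarith
            _ ≤ _ := le_mul_of_one_le_right (by positivity) (by linarith [pow_nonneg ht0 d])
        · calc (1 + t) ^ d ≤ (2 * t) ^ d := by gcongr; linarith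
            _ = 2 ^ d * t ^ d := mul_pow _ _ _
            _ ≤ _ := by gcongr; linarith
      have h3 : min 1 c * (1 + t ^ d) ≤ 1 + c * t ^ d := by
        have := min_le_left 1 c
        have := min_le_right 1 c
        have := pow_nonneg ht0 d
        nlinarith
      calc c₁ * bracket (k - z.re) ^ d = min 1 c / 2 ^ d * (1 + t) ^ d := rfl
        _ ≤ min 1 c / 2 ^ d * (2 ^ d * (1 + t ^ d)) := by gcongr
        _ = min 1 c * (1 + t ^ d) := by field_simp
        _ ≤ 1 + |p.eval (k : ℝ)| := by linarith
    calc ENNReal.ofReal (bracket (p.eval (k : ℝ)) ^ (-(5 / 8) : ℝ))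
        ≤ ENNReal.ofReal (c₁ ^ (-(5 / 8) : ℝ) * bracket (k - z.re) ^ (-r)) := by
          apply ENNReal.ofReal_le_ofReal
          refine (Real.rpow_le_rpow_of_nonpos (by have := bracket_pos (k - z.re); positivity) hb
            (by norm_num)).trans_eq ?_
          have := bracket_pos (k - z.re)
          rw [Real.mul_rpow hc₁0.le (by positivity), ← Real.rpow_natCast, ← Real.rpow_mul this.le, hr]
          ring_nf
      _ = ENNReal.ofReal (c₁ ^ (-(5 / 8) : ℝ)) * ENNReal.ofReal (bracket (k - z.re) ^ (-r)) :=
          ENNReal.ofReal_mul (by positivity)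
      _ ≤ _ := by
          gcongr
          exact Multiset.single_le_sum (fun _ _ => zero_le) _
            (Multiset.mem_map_of_mem (fun z : ℂ => ENNReal.ofReal (bracket (k - z.re) ^ (-r))) hz)
  calc _ ≤ ∑' k : ℤ, ENNReal.ofReal (c₁ ^ (-(5 / 8) : ℝ)) *
        (q.roots.map fun z => ENNReal.ofReal (bracket (k - z.re) ^ (-r))).sum :=
        ENNReal.tsum_le_tsum hpt
    _ = ENNReal.ofReal (c₁ ^ (-(5 / 8) : ℝ)) *
        (q.roots.map fun z => ∑' k : ℤ, ENNReal.ofReal (bracket (k - z.re) ^ (-r))).sum := by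
        rw [ENNReal.tsum_mul_left, tsum_multiset_sum q.roots
          (fun k z => ENNReal.ofReal (bracket (k - z.re) ^ (-r)))]
    _ ≤ _ := by
        gcongr
        have := Multiset.sum_le_card_nsmul
          (q.roots.map fun z => ∑' k : ℤ, ENNReal.ofReal (bracket (k - z.re) ^ (-r))) S
          (by intro x hx; obtain ⟨z, -, rfl⟩ := Multiset.mem_map.1 hx
              exact tsum_bracket_sub_rpow_le (by linarith) _)
        simpa [hcard] using this

end Bourgain
end

/-! ### Modulation weights, nonresonance and the pointwise weight inequalities -/

noncomputable section

namespace Bourgain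

/-- The modulation weight `⟨τ - P(k)⟩^b`. -/
def modWeight (P : ℤ → ℝ) (b : ℝ) (x : ℤ × ℝ) : ℝ≥0∞ :=
  ENNReal.ofReal (bracket (x.2 - P x.1) ^ b)

@[fun_prop]
theorem measurable_modWeight (P : ℤ → ℝ) (b : ℝ) : Measurable (modWeight P b) := by
  have : Measurable fun x : ℤ × ℝ => P x.1 :=
    (measurable_from_top (f := P)).comp measurable_fst
  unfold modWeight
  fun_prop

theorem modWeight_mul (P : ℤ → ℝ) (a b : ℝ) (x : ℤ × ℝ) :
    modWeight P a x * modWeight P b x = modWeight P (a + b) x := by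
  unfold modWeight
  rw [← ENNReal.ofReal_mul (Real.rpow_nonneg (bracket_pos _).le _), ← Real.rpow_add (bracket_pos _)]

theorem modWeight_zero (P : ℤ → ℝ) (x : ℤ × ℝ) : modWeight P 0 x = 1 := by simp [modWeight]

theorem modWeight_sq (P : ℤ → ℝ) (b : ℝ) (x : ℤ × ℝ) :
    modWeight P b x ^ 2 = modWeight P (2 * b) x := by
  rw [sq, modWeight_mul, two_mul]

theorem modWeight_mono (P : ℤ → ℝ) {a b : ℝ} (h : a ≤ b) (x : ℤ × ℝ) :
    modWeight P a x ≤ modWeight P b x :=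
  ENNReal.ofReal_le_ofReal (Real.rpow_le_rpow_of_exponent_le (one_le_bracket _) h)

/-- The square of the `L²` norm with modulation weight `⟨τ - P(k)⟩^b`. -/
def modNormSq (P : ℤ → ℝ) (b : ℝ) (f : ℤ × ℝ → ℝ≥0∞) : ℝ≥0∞ :=
  ∫⁻ x, (modWeight P b x * f x) ^ 2 ∂freqMeasure

/-- Absence of resonances between waves with dispersion relations `P₁`, `P₂` and output `P₀`,
together with the sparsity of near-resonant frequencies. -/
structure Nonresonant (P₀ P₁ P₂ : ℤ → ℝ) (c : ℝ) (K : ℝ≥0∞) : Prop where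
  one_le : 1 ≤ c
  lt_top : K < ⊤
  sq_le : ∀ k₁ k₂ : ℤ, k₁ ≠ 0 → k₂ ≠ 0 →
    ((k₁ + k₂ : ℤ) : ℝ) ^ 2 ≤ c * |P₀ (k₁ + k₂) - P₁ k₁ - P₂ k₂|
  mul_le : ∀ k₁ k₂ : ℤ, k₁ ≠ 0 → k₂ ≠ 0 →
    |((k₁ + k₂ : ℤ) : ℝ)| * (k₁ : ℝ) ^ 2 ≤ c * |P₀ (k₁ + k₂) - P₁ k₁ - P₂ k₂|
  count_zero : ∀ k : ℤ, k ≠ 0 → ∀ τ : ℝ,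
    ∑' l : ℤ, ENNReal.ofReal (bracket (P₁ l + P₂ (k - l) - τ) ^ (-(5 / 8) : ℝ)) ≤ K
  count_one : ∀ k : ℤ, k ≠ 0 → ∀ τ : ℝ,
    ∑' l : ℤ, ENNReal.ofReal (bracket (P₀ l - P₂ (l - k) - τ) ^ (-(5 / 8) : ℝ)) ≤ K
  count_two : ∀ k : ℤ, k ≠ 0 → ∀ τ : ℝ,
    ∑' l : ℤ, ENNReal.ofReal (bracket (P₀ l - P₁ (l - k) - τ) ^ (-(5 / 8) : ℝ)) ≤ K

/-- The `τ`-integral at each `l` compares two bumps centred at `P l` and `Q (l - k) + τ`; it decays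
like the power `-5/8` of their distance, which is what the hypothesis sums. -/
theorem lintegral_modWeight_overlap_le (P Q : ℤ → ℝ) (k : ℤ) (τ : ℝ) {K : ℝ≥0∞}
    (h : ∑' l : ℤ, ENNReal.ofReal (bracket (P l - Q (l - k) - τ) ^ (-(5 / 8) : ℝ)) ≤ K) :
    ∫⁻ x, modWeight P (-(7 / 16)) x ^ 2 * modWeight Q (-(7 / 16)) (x - (k, τ)) ^ 2 ∂freqMeasure
      ≤ overlapConst * K := by
  simp_rw [modWeight_sq]
  rw [lintegral_freqMeasure (by fun_prop)]
  calc _ ≤ ∑' l : ℤ, overlapConst *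
        ENNReal.ofReal (bracket (P l - Q (l - k) - τ) ^ (-(5 / 8) : ℝ)) := by
        refine ENNReal.tsum_le_tsum fun l => ?_
        have := lintegral_bracket_mul_bracket_le (P l) (Q (l - k) + τ)
        convert this using 3 with x
        · unfold modWeight
          norm_num
          congr 4
          ring
        · ring_nf
    _ ≤ _ := by rw [ENNReal.tsum_mul_left]; gcongr

/-- The reflected phase `l ↦ -Q (-l)` turns the overlap with a sum of frequencies into one with a
difference. -/
theorem conv_modWeight_overlap_le (P Q : ℤ → ℝ) (x : ℤ × ℝ) {K : ℝ≥0∞}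
    (h : ∑' l : ℤ, ENNReal.ofReal (bracket (P l + Q (x.1 - l) - x.2) ^ (-(5 / 8) : ℝ)) ≤ K) :
    conv (fun y => modWeight P (-(7 / 16)) y ^ 2) (fun y => modWeight Q (-(7 / 16)) y ^ 2) x
      ≤ overlapConst * K := by
  have h' : ∑' l : ℤ, ENNReal.ofReal
      (bracket (P l - (fun l => -Q (-l)) (l - x.1) - x.2) ^ (-(5 / 8) : ℝ)) ≤ K := by
    simpa only [sub_neg_eq_add, neg_sub] using h
  refine le_trans (le_of_eq ?_) (lintegral_modWeight_overlap_le P (fun l => - Q (-l)) x.1 x.2 h')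
  unfold conv
  refine lintegral_congr fun y => ?_
  have : modWeight Q (-(7 / 16)) (x - y)
      = modWeight (fun l => -Q (-l)) (-(7 / 16)) (y - (x.1, x.2)) := by
    unfold modWeight
    simp only [Prod.fst_sub, Prod.snd_sub, neg_sub, sub_neg_eq_add]
    rw [← bracket_neg]
    congr 3
    ring
  simp only [this]

theorem ennreal_add_sq_le (a b c : ℝ≥0∞) : (a + b + c) ^ 2 ≤ 3 * (a ^ 2 + b ^ 2 + c ^ 2) := by
  rcases eq_or_ne a ⊤ with rfl | ha
  · simp
  rcases eq_or_ne b ⊤ with rfl | hb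
  · simp
  rcases eq_or_ne c ⊤ with rfl | hc
  · simp
  lift a to NNReal using ha
  lift b to NNReal using hb
  lift c to NNReal using hc
  norm_cast
  rw [← NNReal.coe_le_coe]
  push_cast
  nlinarith [sq_nonneg ((a : ℝ) - b), sq_nonneg ((b : ℝ) - c), sq_nonneg ((a : ℝ) - c)]

section Bilinear

variable {P₀ P₁ P₂ : ℤ → ℝ} {c : ℝ} {K : ℝ≥0∞} {f g : ℤ × ℝ → ℝ≥0∞}

theorem modWeight_neg_mul_cancel (P : ℤ → ℝ) (b : ℝ) (f : ℤ × ℝ → ℝ≥0∞) (x : ℤ × ℝ) :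
    modWeight P (-b) x * (modWeight P b x * f x) = f x := by
  rw [← mul_assoc, modWeight_mul]; simp [modWeight_zero]

/-- For dominant output modulation: the weight of the output is used up by the derivative. The
output `k = 0` is left out since there the polynomial to be counted may degenerate. -/
theorem Nonresonant.lintegral_conv_sq_le (h : Nonresonant P₀ P₁ P₂ c K) (hf : Measurable f)
    (hg : Measurable g) :
    ∫⁻ x in {x : ℤ × ℝ | x.1 ≠ 0}, conv f g x ^ 2 ∂freqMeasure
      ≤ overlapConst * K * modNormSq P₁ (7 / 16) f * modNormSq P₂ (7 / 16) g := by
  have := Bourgain.lintegral_conv_sq_le (f := fun y => modWeight P₁ (7 / 16) y * f y)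
    (g := fun y => modWeight P₂ (7 / 16) y * g y) (by fun_prop) (by fun_prop)
    (measurable_modWeight P₁ (-(7 / 16))) (measurable_modWeight P₂ (-(7 / 16)))
    (S := {x : ℤ × ℝ | x.1 ≠ 0}) (measurable_fst (measurableSet_singleton 0).compl)
    (fun x hx => conv_modWeight_overlap_le P₁ P₂ x (h.count_zero x.1 hx x.2))
  simp only [modWeight_neg_mul_cancel] at this
  exact this

/-- For dominant modulation of the first input, which spends its weight `1/2` on the derivative. The
weights of the output and of `g` provide the overlap. -/
theorem Nonresonant.lintegral_conv_left_le (h : Nonresonant P₀ P₁ P₂ c K) (hf : Measurable f)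
    (hg : Measurable g) (hf0 : ∀ τ, f (0, τ) = 0) :
    ∫⁻ x, (modWeight P₀ (-(7 / 16)) x * conv (fun y => modWeight P₁ (1 / 2) y * f y) g x) ^ 2
        ∂freqMeasure
      ≤ overlapConst * K * modNormSq P₁ (1 / 2) f * modNormSq P₂ (7 / 16) g := by
  have := lintegral_weight_mul_conv_sq_le (f := fun y => modWeight P₁ (1 / 2) y * f y)
    (g := fun y => modWeight P₂ (7 / 16) y * g y) (by fun_prop) (by fun_prop)
    (measurable_modWeight P₀ (-(7 / 16))) (measurable_modWeight P₂ (-(7 / 16)))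
    (K := overlapConst * K) (fun y hy => lintegral_modWeight_overlap_le P₀ P₂ y.1 y.2
      (h.count_one y.1 (fun h0 => hy (by
        have : y = (0, y.2) := Prod.ext h0 rfl
        rw [this, hf0, mul_zero])) y.2))
  simp only [modWeight_neg_mul_cancel] at this
  exact this

theorem Nonresonant.lintegral_conv_right_le (h : Nonresonant P₀ P₁ P₂ c K) (hf : Measurable f)
    (hg : Measurable g) (hg0 : ∀ τ, g (0, τ) = 0) :
    ∫⁻ x, (modWeight P₀ (-(7 / 16)) x * conv f (fun y => modWeight P₂ (1 / 2) y * g y) x) ^ 2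
        ∂freqMeasure
      ≤ overlapConst * K * modNormSq P₁ (7 / 16) f * modNormSq P₂ (1 / 2) g := by
  have := lintegral_weight_mul_conv_sq_le (f := fun y => modWeight P₂ (1 / 2) y * g y)
    (g := fun y => modWeight P₁ (7 / 16) y * f y) (by fun_prop) (by fun_prop)
    (measurable_modWeight P₀ (-(7 / 16))) (measurable_modWeight P₁ (-(7 / 16)))
    (K := overlapConst * K) (fun y hy => lintegral_modWeight_overlap_le P₀ P₁ y.1 y.2
      (h.count_two y.1 (fun h0 => hy (by
        have : y = (0, y.2) := Prod.ext h0 rfl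
        rw [this, hg0, mul_zero])) y.2))
  simp only [modWeight_neg_mul_cancel] at this
  rw [conv_comm]
  refine this.trans (le_of_eq ?_)
  unfold modNormSq
  ring

/-- Both `τ` and `k` add under convolution, so the `τ` variables cancel in the signed sum of the
three modulations. -/
theorem abs_resonance_le (P₀ P₁ P₂ : ℤ → ℝ) (x y : ℤ × ℝ) :
    |P₀ x.1 - P₁ y.1 - P₂ (x.1 - y.1)| ≤ bracket (x.2 - P₀ x.1) + bracket (y.2 - P₁ y.1) +
      bracket (x.2 - y.2 - P₂ (x.1 - y.1)) := by
  have e : P₀ x.1 - P₁ y.1 - P₂ (x.1 - y.1) = -(x.2 - P₀ x.1) + (y.2 - P₁ y.1)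
    + (x.2 - y.2 - P₂ (x.1 - y.1)) := by ring
  have h1 := abs_add_three (-(x.2 - P₀ x.1)) (y.2 - P₁ y.1) (x.2 - y.2 - P₂ (x.1 - y.1))
  rw [abs_neg] at h1
  rw [e]
  unfold bracket
  linarith

theorem mul_rpow_neg_half_le {κ c s₀ s₁ s₂ : ℝ} (hc : 1 ≤ c) (h0 : 0 < s₀)
    (h1 : 0 ≤ s₁) (h2 : 0 ≤ s₂) (h : κ ^ 2 ≤ c * (s₀ + s₁ + s₂)) :
    κ * s₀ ^ (-(1 / 2) : ℝ) ≤ c * (1 + s₀ ^ (-(1 / 2) : ℝ) * s₁ ^ (1 / 2 : ℝ) +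
      s₀ ^ (-(1 / 2) : ℝ) * s₂ ^ (1 / 2 : ℝ)) := by
  have hk : κ ≤ c * (s₀ ^ (1 / 2 : ℝ) + s₁ ^ (1 / 2 : ℝ) + s₂ ^ (1 / 2 : ℝ)) := by
    simp only [← Real.sqrt_eq_rpow]
    have a0 := Real.sqrt_nonneg s₀
    have a1 := Real.sqrt_nonneg s₁
    have a2 := Real.sqrt_nonneg s₂
    refine (le_abs_self κ).trans (abs_le_of_sq_le_sq ?_ (by positivity))
    have hs : s₀ + s₁ + s₂ ≤ (√s₀ + √s₁ + √s₂) ^ 2 := by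
      nlinarith [Real.sq_sqrt h0.le, Real.sq_sqrt h1, Real.sq_sqrt h2, mul_nonneg a0 a1,
        mul_nonneg a1 a2, mul_nonneg a0 a2]
    calc κ ^ 2 ≤ c * (s₀ + s₁ + s₂) := h
      _ ≤ c * (c * (s₀ + s₁ + s₂)) := by
          gcongr; nlinarith
      _ ≤ c * (c * (√s₀ + √s₁ + √s₂) ^ 2) := by gcongr
      _ = _ := by ring
  have e : s₀ ^ (1 / 2 : ℝ) * s₀ ^ (-(1 / 2) : ℝ) = 1 := by
    rw [← Real.rpow_add h0]; norm_num
  calc κ * s₀ ^ (-(1 / 2) : ℝ)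
      ≤ c * (s₀ ^ (1 / 2 : ℝ) + s₁ ^ (1 / 2 : ℝ) + s₂ ^ (1 / 2 : ℝ)) * s₀ ^ (-(1 / 2) : ℝ) := by
        gcongr
    _ = c * (s₀ ^ (1 / 2 : ℝ) * s₀ ^ (-(1 / 2) : ℝ) + s₀ ^ (-(1 / 2) : ℝ) * s₁ ^ (1 / 2 : ℝ) +
      s₀ ^ (-(1 / 2) : ℝ) * s₂ ^ (1 / 2 : ℝ)) := by ring
    _ = _ := by rw [e]

/-- If `s₀` is the largest, then `hmul` gives `κ ≲ κ₁⁻¹ s₀^(3/4)`, and the resulting `s₀^(-1/4)` is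
split evenly between `s₁` and `s₂`. Otherwise `κ` is bounded by the square root of the larger of
`s₁` and `s₂`. The factor `2` in `hmul` leaves room for a bracket in the place of `|k₁|`. -/
theorem mul_inv_le_of_resonance {κ κ₁ X c s₀ s₁ s₂ : ℝ} (hc : 1 ≤ c) (hκ₁ : 0 < κ₁)
    (hX : 0 ≤ X) (h0 : 1 ≤ s₀) (h1 : 1 ≤ s₁) (h2 : 1 ≤ s₂) (hsq : κ ^ 2 ≤ X)
    (hmul : κ * κ₁ ≤ 2 * X ^ (3 / 4 : ℝ)) (h : X ≤ c * (s₀ + s₁ + s₂)) :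
    κ * s₀ ^ (-1 : ℝ) ≤ 6 * c * (κ₁⁻¹ * s₁ ^ (-(1 / 8) : ℝ) * s₂ ^ (-(1 / 8) : ℝ) +
      s₀ ^ (-1 : ℝ) * s₁ ^ (1 / 2 : ℝ) + s₀ ^ (-1 : ℝ) * s₂ ^ (1 / 2 : ℝ)) := by
  have p0 : 0 < s₀ := by linarith
  have p1 : 0 < s₁ := by linarith
  have p2 : 0 < s₂ := by linarith
  have q0 : 0 < κ₁⁻¹ * s₁ ^ (-(1 / 8) : ℝ) * s₂ ^ (-(1 / 8) : ℝ) := by positivity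
  have q1 : 0 < s₀ ^ (-1 : ℝ) * s₁ ^ (1 / 2 : ℝ) := by positivity
  have q2 : 0 < s₀ ^ (-1 : ℝ) * s₂ ^ (1 / 2 : ℝ) := by positivity
  have key : ∀ t, 0 < t → s₀ ≤ t → s₁ ≤ t → s₂ ≤ t →
      κ * s₀ ^ (-1 : ℝ) ≤ 6 * c * (s₀ ^ (-1 : ℝ) * t ^ (1 / 2 : ℝ)) := by
    intro t ht t0 t1 t2
    have : κ ≤ 3 * c * t ^ (1 / 2 : ℝ) := by
      rw [← Real.sqrt_eq_rpow]
      refine (le_abs_self κ).trans (abs_le_of_sq_le_sq ?_ (by positivity))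
      rw [mul_pow, Real.sq_sqrt ht.le]
      have e1 : c * (s₀ + s₁ + s₂) ≤ c * (3 * t) := by gcongr; linarith
      have e2 : 3 * c * t ≤ (3 * c) ^ 2 * t := by gcongr; nlinarith
      linarith
    have e3 : 0 < s₀ ^ (-1 : ℝ) * t ^ (1 / 2 : ℝ) := by positivity
    calc κ * s₀ ^ (-1 : ℝ) ≤ 3 * c * t ^ (1 / 2 : ℝ) * s₀ ^ (-1 : ℝ) := by gcongr
      _ ≤ _ := by nlinarith
  have dominant : s₁ ≤ s₀ → s₂ ≤ s₀ → κ * s₀ ^ (-1 : ℝ) ≤ 6 * c *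
      (κ₁⁻¹ * s₁ ^ (-(1 / 8) : ℝ) * s₂ ^ (-(1 / 8) : ℝ) +
        s₀ ^ (-1 : ℝ) * s₁ ^ (1 / 2 : ℝ) + s₀ ^ (-1 : ℝ) * s₂ ^ (1 / 2 : ℝ)) := by
    intro h10 h20
    have e1 : X ^ (3 / 4 : ℝ) ≤ 3 * c * s₀ ^ (3 / 4 : ℝ) := by
      calc X ^ (3 / 4 : ℝ) ≤ (3 * c * s₀) ^ (3 / 4 : ℝ) := by
            gcongr; nlinarith
        _ = (3 * c) ^ (3 / 4 : ℝ) * s₀ ^ (3 / 4 : ℝ) := Real.mul_rpow (by positivity) p0.le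
        _ ≤ (3 * c) ^ (1 : ℝ) * s₀ ^ (3 / 4 : ℝ) := by
            gcongr
            · linarith
            · norm_num
        _ = _ := by rw [Real.rpow_one]
    have e2 : κ ≤ 6 * c * κ₁⁻¹ * s₀ ^ (3 / 4 : ℝ) := by
      rw [← le_div_iff₀ hκ₁] at hmul
      refine hmul.trans ?_
      rw [div_eq_mul_inv]
      have : 0 < κ₁⁻¹ := by positivity
      nlinarith
    have e3 : s₀ ^ (3 / 4 : ℝ) * s₀ ^ (-1 : ℝ) = s₀ ^ (-(1 / 8) : ℝ) * s₀ ^ (-(1 / 8) : ℝ) := by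
      rw [← Real.rpow_add p0, ← Real.rpow_add p0]; norm_num
    have e4 : s₀ ^ (-(1 / 8) : ℝ) ≤ s₁ ^ (-(1 / 8) : ℝ) :=
      Real.rpow_le_rpow_of_nonpos p1 h10 (by norm_num)
    have e5 : s₀ ^ (-(1 / 8) : ℝ) ≤ s₂ ^ (-(1 / 8) : ℝ) :=
      Real.rpow_le_rpow_of_nonpos p2 h20 (by norm_num)
    calc κ * s₀ ^ (-1 : ℝ) ≤ 6 * c * κ₁⁻¹ * s₀ ^ (3 / 4 : ℝ) * s₀ ^ (-1 : ℝ) := by gcongr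
      _ = 6 * c * (κ₁⁻¹ * (s₀ ^ (-(1 / 8) : ℝ) * s₀ ^ (-(1 / 8) : ℝ))) := by
          rw [← e3]; ring
      _ ≤ 6 * c * (κ₁⁻¹ * (s₁ ^ (-(1 / 8) : ℝ) * s₂ ^ (-(1 / 8) : ℝ))) := by gcongr
      _ ≤ _ := by gcongr; linarith
  rcases le_total s₁ s₂ with h12 | h12
  · rcases le_total s₂ s₀ with h02 | h02
    · exact dominant (h12.trans h02) h02
    · refine (key s₂ p2 h02 h12 le_rfl).trans ?_
      gcongr; linarith
  · rcases le_total s₁ s₀ with h01 | h01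
    · exact dominant h01 (h12.trans h01)
    · refine (key s₁ p1 h01 le_rfl h12).trans ?_
      gcongr; linarith

end Bilinear

end Bourgain
end

/-! ### The bilinear estimates in weighted `L²` and in `ℓ²L¹` -/

noncomputable section

namespace Bourgain

section Bilinear

variable {P₀ P₁ P₂ : ℤ → ℝ} {c : ℝ} {K : ℝ≥0∞} {f g : ℤ × ℝ → ℝ≥0∞}

theorem Nonresonant.one_le_scale (h : Nonresonant P₀ P₁ P₂ c K) : 0 < c :=
  zero_lt_one.trans_le h.one_le

theorem Nonresonant.weight_half_le (h : Nonresonant P₀ P₁ P₂ c K) {x y : ℤ × ℝ} (hy : y.1 ≠ 0)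
    (hxy : x.1 - y.1 ≠ 0) :
    ENNReal.ofReal |(x.1 : ℝ)| * modWeight P₀ (-(1 / 2)) x ≤
      ENNReal.ofReal c * (1 + modWeight P₀ (-(1 / 2)) x * modWeight P₁ (1 / 2) y +
        modWeight P₀ (-(1 / 2)) x * modWeight P₂ (1 / 2) (x - y)) := by
  have hc := h.one_le
  have hsq := h.sq_le y.1 (x.1 - y.1) hy hxy
  rw [add_sub_cancel] at hsq
  have hle := abs_resonance_le P₀ P₁ P₂ x y
  have b0 := bracket_pos (x.2 - P₀ x.1)
  have b1 := bracket_pos (y.2 - P₁ y.1)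
  have b2 := bracket_pos (x.2 - y.2 - P₂ (x.1 - y.1))
  have := mul_rpow_neg_half_le (κ := |(x.1 : ℝ)|) hc b0 b1.le b2.le (by
    rw [sq_abs]; exact hsq.trans (by gcongr))
  unfold modWeight
  simp only [Prod.fst_sub, Prod.snd_sub]
  rw [← ENNReal.ofReal_mul (abs_nonneg _), ← ENNReal.ofReal_mul (by positivity),
    ← ENNReal.ofReal_mul (by positivity), ← ENNReal.ofReal_one,
    ← ENNReal.ofReal_add (by positivity) (by positivity),
    ← ENNReal.ofReal_add (by positivity) (by positivity), ← ENNReal.ofReal_mul (by positivity)]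
  exact ENNReal.ofReal_le_ofReal this

theorem Nonresonant.weight_one_le (h : Nonresonant P₀ P₁ P₂ c K) {x y : ℤ × ℝ} (hy : y.1 ≠ 0)
    (hxy : x.1 - y.1 ≠ 0) :
    ENNReal.ofReal |(x.1 : ℝ)| * modWeight P₀ (-1) x ≤
      ENNReal.ofReal (6 * c) * (ENNReal.ofReal (bracket y.1)⁻¹ * modWeight P₁ (-(1 / 8)) y *
          modWeight P₂ (-(1 / 8)) (x - y) +
        modWeight P₀ (-1) x * modWeight P₁ (1 / 2) y +
        modWeight P₀ (-1) x * modWeight P₂ (1 / 2) (x - y)) := by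
  have hc := h.one_le
  have hc0 := h.one_le_scale
  have hsq := h.sq_le y.1 (x.1 - y.1) hy hxy
  have hmul := h.mul_le y.1 (x.1 - y.1) hy hxy
  rw [add_sub_cancel] at hsq hmul
  have hle := abs_resonance_le P₀ P₁ P₂ x y
  have b0 := bracket_pos (x.2 - P₀ x.1)
  have b1 := bracket_pos (y.2 - P₁ y.1)
  have b2 := bracket_pos (x.2 - y.2 - P₂ (x.1 - y.1))
  have b3 := bracket_pos y.1
  set X := c * |P₀ x.1 - P₁ y.1 - P₂ (x.1 - y.1)| with hX
  have hX0 : 0 ≤ X := by positivity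
  have hy1 : 1 ≤ |(y.1 : ℝ)| := by exact_mod_cast Int.one_le_abs hy
  -- Interpolation of the two nonresonance bounds: `(|k| |k₁|)⁴ = k² (|k| k₁²)² ≤ X · X²`.
  have hk : |(x.1 : ℝ)| * |(y.1 : ℝ)| ≤ X ^ (3 / 4 : ℝ) := by
    have e : (|(x.1 : ℝ)| * |(y.1 : ℝ)|) ^ (4 : ℝ) ≤ X ^ (3 : ℝ) := by
      rw [show (4 : ℝ) = ((4 : ℕ) : ℝ) by norm_num, show (3 : ℝ) = ((3 : ℕ) : ℝ) by norm_num,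
        Real.rpow_natCast, Real.rpow_natCast]
      calc (|(x.1 : ℝ)| * |(y.1 : ℝ)|) ^ 4
          = |(x.1 : ℝ)| ^ 2 * (|(x.1 : ℝ)| * |(y.1 : ℝ)| ^ 2) ^ 2 := by ring
        _ ≤ X * X ^ 2 := by
            rw [sq_abs, sq_abs]
            gcongr
        _ = X ^ 3 := by ring
    calc |(x.1 : ℝ)| * |(y.1 : ℝ)| = ((|(x.1 : ℝ)| * |(y.1 : ℝ)|) ^ (4 : ℝ)) ^ (1 / 4 : ℝ) := by
          rw [← Real.rpow_mul (by positivity)]; norm_num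
      _ ≤ (X ^ (3 : ℝ)) ^ (1 / 4 : ℝ) := by gcongr
      _ = _ := by rw [← Real.rpow_mul hX0]; norm_num
  have := mul_inv_le_of_resonance (κ := |(x.1 : ℝ)|) (κ₁ := bracket y.1) (X := X) hc b3 hX0
    (one_le_bracket (x.2 - P₀ x.1)) (one_le_bracket (y.2 - P₁ y.1))
    (one_le_bracket (x.2 - y.2 - P₂ (x.1 - y.1))) (by rw [sq_abs]; exact hsq)
    (by
      refine le_trans ?_ (mul_le_mul_of_nonneg_left hk (by norm_num : (0 : ℝ) ≤ 2))
      have : bracket y.1 ≤ 2 * |(y.1 : ℝ)| := by unfold bracket; linarith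
      have := mul_le_mul_of_nonneg_left this (abs_nonneg (x.1 : ℝ))
      linarith)
    (by rw [hX]; gcongr)
  unfold modWeight
  simp only [Prod.fst_sub, Prod.snd_sub]
  rw [← ENNReal.ofReal_mul (abs_nonneg _), ← ENNReal.ofReal_mul (by positivity),
    ← ENNReal.ofReal_mul (by positivity),
    ← ENNReal.ofReal_mul (by positivity), ← ENNReal.ofReal_mul (by positivity),
    ← ENNReal.ofReal_add (by positivity) (by positivity),
    ← ENNReal.ofReal_add (by positivity) (by positivity), ← ENNReal.ofReal_mul (by positivity)]
  exact ENNReal.ofReal_le_ofReal this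

/-- Since `f` and `g` have no zero mode, the weight inequality is needed only where both input
frequencies are nonzero, the range covered by `Nonresonant`. -/
theorem conv_congr_weight {a : ℝ≥0∞} {w : ℤ × ℝ → ℝ≥0∞} {x : ℤ × ℝ}
    (hf : Measurable f) (hg : Measurable g)
    (hf0 : ∀ τ, f (0, τ) = 0) (hg0 : ∀ τ, g (0, τ) = 0)
    (h : ∀ y : ℤ × ℝ, y.1 ≠ 0 → x.1 - y.1 ≠ 0 → a ≤ w y) :
    a * conv f g x ≤ ∫⁻ y, w y * (f y * g (x - y)) ∂freqMeasure := by
  unfold conv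
  rw [← lintegral_const_mul _ (by fun_prop)]
  refine lintegral_mono fun y => ?_
  by_cases hy : y.1 = 0
  · have : f y = 0 := by rw [show y = (0, y.2) from Prod.ext hy rfl]; exact hf0 _
    simp [this]
  by_cases hxy : x.1 - y.1 = 0
  · have : g (x - y) = 0 := by
      rw [show x - y = (0, (x - y).2) from Prod.ext hxy rfl]; exact hg0 _
    simp [this]
  gcongr
  exact h y hy hxy

theorem Nonresonant.weight_half_conv_le (h : Nonresonant P₀ P₁ P₂ c K) (hf : Measurable f)
    (hg : Measurable g) (hf0 : ∀ τ, f (0, τ) = 0) (hg0 : ∀ τ, g (0, τ) = 0) (x : ℤ × ℝ) :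
    ENNReal.ofReal |(x.1 : ℝ)| * modWeight P₀ (-(1 / 2)) x * conv f g x ≤
      ENNReal.ofReal c * (indicator {x : ℤ × ℝ | x.1 ≠ 0} (conv f g) x +
        modWeight P₀ (-(1 / 2)) x * conv (fun y => modWeight P₁ (1 / 2) y * f y) g x +
        modWeight P₀ (-(1 / 2)) x * conv f (fun y => modWeight P₂ (1 / 2) y * g y) x) := by
  by_cases hx : x.1 = 0
  · simp [hx]
  rw [indicator_of_mem (show x ∈ {x : ℤ × ℝ | x.1 ≠ 0} from hx)]
  refine (conv_congr_weight hf hg hf0 hg0 fun y hy hxy => h.weight_half_le hy hxy).trans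
    (le_of_eq ?_)
  simp_rw [mul_assoc (ENNReal.ofReal c)]
  rw [lintegral_const_mul _ (by fun_prop)]
  congr 1
  simp_rw [add_mul, one_mul]
  rw [lintegral_add_right _ (by fun_prop), lintegral_add_right _ (by fun_prop)]
  unfold conv
  rw [← lintegral_const_mul _ (by fun_prop), ← lintegral_const_mul _ (by fun_prop)]
  congr 1
  · congr 1
    refine lintegral_congr fun y => ?_
    ring
  · refine lintegral_congr fun y => ?_
    ring

theorem Nonresonant.weight_one_conv_le (h : Nonresonant P₀ P₁ P₂ c K) (hf : Measurable f)
    (hg : Measurable g) (hf0 : ∀ τ, f (0, τ) = 0) (hg0 : ∀ τ, g (0, τ) = 0) (x : ℤ × ℝ) :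
    ENNReal.ofReal |(x.1 : ℝ)| * modWeight P₀ (-1) x * conv f g x ≤
      ENNReal.ofReal (6 * c) * (conv (fun y => ENNReal.ofReal (bracket y.1)⁻¹ *
          (modWeight P₁ (-(1 / 8)) y * f y)) (fun y => modWeight P₂ (-(1 / 8)) y * g y) x +
        modWeight P₀ (-1) x * conv (fun y => modWeight P₁ (1 / 2) y * f y) g x +
        modWeight P₀ (-1) x * conv f (fun y => modWeight P₂ (1 / 2) y * g y) x) := by
  refine (conv_congr_weight hf hg hf0 hg0 fun y hy hxy => h.weight_one_le hy hxy).trans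
    (le_of_eq ?_)
  have hb : Measurable fun y : ℤ × ℝ => ENNReal.ofReal (bracket y.1)⁻¹ := by fun_prop
  simp_rw [mul_assoc (ENNReal.ofReal (6 * c))]
  rw [lintegral_const_mul _ (by fun_prop)]
  congr 1
  simp_rw [add_mul]
  rw [lintegral_add_right _ (by fun_prop), lintegral_add_right _ (by fun_prop)]
  unfold conv
  rw [← lintegral_const_mul _ (by fun_prop), ← lintegral_const_mul _ (by fun_prop)]
  congr 1
  · congr 1
    · refine lintegral_congr fun y => ?_
      ring
    · refine lintegral_congr fun y => ?_
      ring
  · refine lintegral_congr fun y => ?_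
    ring

theorem modNormSq_mono (P : ℤ → ℝ) {a b : ℝ} (hab : a ≤ b) (f : ℤ × ℝ → ℝ≥0∞) :
    modNormSq P a f ≤ modNormSq P b f := by
  unfold modNormSq
  gcongr with x
  exact modWeight_mono P hab x

/-- The bilinear estimate for the `X_{0,-1/2}` norm. -/
theorem Nonresonant.lintegral_weight_half_sq_le (h : Nonresonant P₀ P₁ P₂ c K) (hf : Measurable f)
    (hg : Measurable g) (hf0 : ∀ τ, f (0, τ) = 0) (hg0 : ∀ τ, g (0, τ) = 0) :
    ∫⁻ x, (ENNReal.ofReal |(x.1 : ℝ)| * modWeight P₀ (-(1 / 2)) x * conv f g x) ^ 2 ∂freqMeasure ≤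
      ENNReal.ofReal c ^ 2 * 6 * (overlapConst * K) *
        (modNormSq P₁ (1 / 2) f * modNormSq P₂ (7 / 16) g +
          modNormSq P₁ (7 / 16) f * modNormSq P₂ (1 / 2) g) := by
  have hcv : Measurable (conv f g) := measurable_conv hf hg
  have hcv1 : Measurable (conv (fun y => modWeight P₁ (1 / 2) y * f y) g) :=
    measurable_conv (by fun_prop) hg
  have hcv2 : Measurable (conv f (fun y => modWeight P₂ (1 / 2) y * g y)) :=
    measurable_conv hf (by fun_prop)
  have hS : MeasurableSet {x : ℤ × ℝ | x.1 ≠ 0} := measurable_fst (measurableSet_singleton 0).compl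
  have i0 : ∫⁻ x, indicator {x : ℤ × ℝ | x.1 ≠ 0} (conv f g) x ^ 2 ∂freqMeasure
      ≤ overlapConst * K * (modNormSq P₁ (1 / 2) f * modNormSq P₂ (7 / 16) g) := by
    have : (fun x => indicator {x : ℤ × ℝ | x.1 ≠ 0} (conv f g) x ^ 2)
        = indicator {x : ℤ × ℝ | x.1 ≠ 0} (fun x => conv f g x ^ 2) := by
      ext x; by_cases hx : x.1 = 0 <;> simp [indicator, hx]
    rw [this, lintegral_indicator hS, ← mul_assoc]
    refine (h.lintegral_conv_sq_le hf hg).trans ?_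
    gcongr
    exact modNormSq_mono _ (by norm_num) _
  have i1 : ∫⁻ x, (modWeight P₀ (-(1 / 2)) x * conv (fun y => modWeight P₁ (1 / 2) y * f y) g x) ^ 2
      ∂freqMeasure ≤ overlapConst * K * (modNormSq P₁ (1 / 2) f * modNormSq P₂ (7 / 16) g) := by
    rw [← mul_assoc]
    refine le_trans (lintegral_mono fun x => ?_) (h.lintegral_conv_left_le hf hg hf0)
    gcongr
    exact modWeight_mono _ (by norm_num) _
  have i2 : ∫⁻ x, (modWeight P₀ (-(1 / 2)) x * conv f (fun y => modWeight P₂ (1 / 2) y * g y) x) ^ 2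
      ∂freqMeasure ≤ overlapConst * K * (modNormSq P₁ (7 / 16) f * modNormSq P₂ (1 / 2) g) := by
    rw [← mul_assoc]
    refine le_trans (lintegral_mono fun x => ?_) (h.lintegral_conv_right_le hf hg hg0)
    gcongr
    exact modWeight_mono _ (by norm_num) _
  have hpt : ∀ x : ℤ × ℝ, (ENNReal.ofReal |(x.1 : ℝ)| * modWeight P₀ (-(1 / 2)) x * conv f g x) ^ 2
      ≤ ENNReal.ofReal c ^ 2 * 3 * (indicator {x : ℤ × ℝ | x.1 ≠ 0} (conv f g) x ^ 2 +
        (modWeight P₀ (-(1 / 2)) x * conv (fun y => modWeight P₁ (1 / 2) y * f y) g x) ^ 2 +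
        (modWeight P₀ (-(1 / 2)) x * conv f (fun y => modWeight P₂ (1 / 2) y * g y) x) ^ 2) := by
    intro x
    refine (pow_le_pow_left' (h.weight_half_conv_le hf hg hf0 hg0 x) 2).trans ?_
    rw [mul_pow, mul_assoc]
    gcongr
    exact ennreal_add_sq_le _ _ _
  refine (lintegral_mono hpt).trans ?_
  rw [lintegral_const_mul _ (by fun_prop (disch := assumption)),
    lintegral_add_right _ (by fun_prop), lintegral_add_left ((hcv.indicator hS).pow_const 2)]
  set A := modNormSq P₁ (1 / 2) f * modNormSq P₂ (7 / 16) g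
  set B := modNormSq P₁ (7 / 16) f * modNormSq P₂ (1 / 2) g
  calc _ ≤ ENNReal.ofReal c ^ 2 * 3 * (overlapConst * K * A + overlapConst * K * A
        + overlapConst * K * B) := by gcongr
    -- The term with `B` is doubled only to factor out `A + B`.
    _ ≤ ENNReal.ofReal c ^ 2 * 3 * (overlapConst * K * A + overlapConst * K * A
        + (overlapConst * K * B + overlapConst * K * B)) := by gcongr; exact le_self_add
    _ = _ := by ring

/-- Passing from `L¹` to `L²` in `τ` costs the exponent `9/16`, just above `1/2`: the squared weight
`⟨·⟩^(-9/8)` is integrable. -/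
theorem lintegral_modWeight_mul_sq_le (P : ℤ → ℝ) (a : ℝ) (k : ℤ) {A : ℤ × ℝ → ℝ≥0∞}
    (hA : Measurable A) :
    (∫⁻ τ, modWeight P a (k, τ) * A (k, τ)) ^ 2 ≤
      (∫⁻ x : ℝ, ENNReal.ofReal (bracket x ^ (-(9 / 8) : ℝ))) *
        ∫⁻ τ, (modWeight P (a + 9 / 16) (k, τ) * A (k, τ)) ^ 2 := by
  have e : ∀ τ, modWeight P a (k, τ) * A (k, τ)
      = modWeight P (-(9 / 16)) (k, τ) * (modWeight P (a + 9 / 16) (k, τ) * A (k, τ)) := by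
    intro τ
    rw [← mul_assoc, modWeight_mul]
    congr 2
    ring
  simp_rw [e]
  refine (lintegral_mul_sq_le volume (by fun_prop) (by fun_prop)).trans (le_of_eq ?_)
  congr 1
  simp_rw [modWeight_sq]
  unfold modWeight
  norm_num
  exact lintegral_sub_right_eq_self
    (fun x => ENNReal.ofReal (bracket x ^ (-(9 / 8) : ℝ))) (P k)

theorem lintegral_conv_eq_tsum (hf : Measurable f) (hg : Measurable g) (k : ℤ) :
    ∫⁻ τ, conv f g (k, τ) = ∑' l : ℤ, (∫⁻ τ, f (l, τ)) * ∫⁻ τ, g (k - l, τ) := by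
  have h : ∀ τ, conv f g (k, τ) = ∑' l : ℤ, ∫⁻ σ, f (l, σ) * g (k - l, τ - σ) := by
    intro τ
    unfold conv
    rw [lintegral_freqMeasure (by fun_prop)]
    rfl
  simp_rw [h]
  rw [lintegral_tsum]
  · congr 1 with l
    rw [lintegral_lintegral_swap (by fun_prop)]
    have : ∀ σ, ∫⁻ τ, f (l, σ) * g (k - l, τ - σ) = f (l, σ) * ∫⁻ τ, g (k - l, τ) := by
      intro σ
      rw [lintegral_const_mul _ (by fun_prop), lintegral_sub_right_eq_self
        (fun τ => g (k - l, τ)) σ]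
    simp_rw [this]
    rw [lintegral_mul_const _ (by fun_prop)]
  · intro l
    refine Measurable.aemeasurable ?_
    refine Measurable.lintegral_prod_right ?_
    fun_prop

/-- Cauchy–Schwarz in `l` against the square summable `w`; the sum over `k` of the convolution of
`a²` and `b²` then factors. -/
theorem tsum_sq_tsum_le (w a b : ℤ → ℝ≥0∞) :
    ∑' k : ℤ, (∑' l : ℤ, w l * a l * b (k - l)) ^ 2
      ≤ (∑' l, w l ^ 2) * ((∑' l, a l ^ 2) * ∑' l, b l ^ 2) := by
  calc _ ≤ ∑' k : ℤ, (∑' l, w l ^ 2) * ∑' l, a l ^ 2 * b (k - l) ^ 2 := by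
        refine ENNReal.tsum_le_tsum fun k => ?_
        have := lintegral_mul_sq_le (Measure.count : Measure ℤ) (f := w)
          (g := fun l => a l * b (k - l)) measurable_from_top.aemeasurable
          measurable_from_top.aemeasurable
        simp only [lintegral_count, mul_pow, ← mul_assoc] at this
        simpa only [← mul_assoc] using this
    _ = _ := by
        rw [ENNReal.tsum_mul_left, ENNReal.tsum_comm]
        congr 1
        rw [← ENNReal.tsum_mul_right]
        congr 1 with l
        rw [ENNReal.tsum_mul_left]
        congr 1
        exact (Equiv.subRight l).tsum_eq (fun k : ℤ => b k ^ 2)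

/-- The bilinear estimate for the `Y_{0,-1}` norm. -/
theorem Nonresonant.tsum_weight_one_sq_le (h : Nonresonant P₀ P₁ P₂ c K) (hf : Measurable f)
    (hg : Measurable g) (hf0 : ∀ τ, f (0, τ) = 0) (hg0 : ∀ τ, g (0, τ) = 0) :
    ∑' k : ℤ, (∫⁻ τ, ENNReal.ofReal |(k : ℝ)| * modWeight P₀ (-1) (k, τ) * conv f g (k, τ)) ^ 2 ≤
      ENNReal.ofReal (6 * c) ^ 2 * 3 *
        ((∑' l : ℤ, ENNReal.ofReal (bracket l)⁻¹ ^ 2) *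
          (∫⁻ x : ℝ, ENNReal.ofReal (bracket x ^ (-(9 / 8) : ℝ))) ^ 2 +
          (∫⁻ x : ℝ, ENNReal.ofReal (bracket x ^ (-(9 / 8) : ℝ))) * (overlapConst * K)) *
        (modNormSq P₁ (1 / 2) f * modNormSq P₂ (7 / 16) g +
          modNormSq P₁ (7 / 16) f * modNormSq P₂ (1 / 2) g) := by
  set J := ∫⁻ x : ℝ, ENNReal.ofReal (bracket x ^ (-(9 / 8) : ℝ))
  set A := modNormSq P₁ (1 / 2) f * modNormSq P₂ (7 / 16) g
  set B := modNormSq P₁ (7 / 16) f * modNormSq P₂ (1 / 2) g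
  set S := ∑' l : ℤ, ENNReal.ofReal (bracket l)⁻¹ ^ 2
  have hb : Measurable fun y : ℤ × ℝ => ENNReal.ofReal (bracket y.1)⁻¹ := by fun_prop
  set F := fun y : ℤ × ℝ => ENNReal.ofReal (bracket y.1)⁻¹ * (modWeight P₁ (-(1 / 8)) y * f y)
    with hF
  set G := fun y : ℤ × ℝ => modWeight P₂ (-(1 / 8)) y * g y with hG
  set C₁ := conv (fun y => modWeight P₁ (1 / 2) y * f y) g with hC₁
  set C₂ := conv f (fun y => modWeight P₂ (1 / 2) y * g y) with hC₂
  have hFm : Measurable F := by fun_prop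
  have hGm : Measurable G := by fun_prop
  have hcv0 : Measurable (conv F G) := measurable_conv hFm hGm
  have hcv1 : Measurable C₁ := measurable_conv (by fun_prop) hg
  have hcv2 : Measurable C₂ := measurable_conv hf (by fun_prop)
  -- Dominant output modulation: the `L¹` norm in `τ` of a convolution is a convolution in `k` of
  -- `L¹` norms. As `-1/8 + 9/16 = 7/16`, these are controlled by the weaker input norms.
  have i0 : ∑' k : ℤ, (∫⁻ τ, conv F G (k, τ)) ^ 2 ≤ S * J ^ 2 * A := by
    have hFi : ∀ l : ℤ, ∫⁻ τ, F (l, τ)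
        = ENNReal.ofReal (bracket l)⁻¹ * ∫⁻ τ, modWeight P₁ (-(1 / 8)) (l, τ) * f (l, τ) := by
      intro l
      simp only [hF]
      rw [lintegral_const_mul _ (by fun_prop)]
    have hsum : ∀ (P : ℤ → ℝ) (f : ℤ × ℝ → ℝ≥0∞), Measurable f →
        ∑' l : ℤ, (∫⁻ τ, modWeight P (-(1 / 8)) (l, τ) * f (l, τ)) ^ 2
          ≤ J * modNormSq P (7 / 16) f := by
      intro P f hf
      unfold modNormSq
      rw [lintegral_freqMeasure (by fun_prop), ← ENNReal.tsum_mul_left]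
      refine ENNReal.tsum_le_tsum fun l => ?_
      have := lintegral_modWeight_mul_sq_le P (-(1 / 8)) l hf
      norm_num at this ⊢
      exact this
    simp_rw [lintegral_conv_eq_tsum hFm hGm, hFi]
    refine (tsum_sq_tsum_le (fun l : ℤ => ENNReal.ofReal (bracket l)⁻¹)
      (fun l => ∫⁻ τ, modWeight P₁ (-(1 / 8)) (l, τ) * f (l, τ))
      (fun l => ∫⁻ τ, G (l, τ))).trans ?_
    calc _ ≤ S * ((J * modNormSq P₁ (7 / 16) f) * (J * modNormSq P₂ (7 / 16) g)) := by
          gcongr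
          · exact hsum P₁ f hf
          · exact hsum P₂ g hg
      _ ≤ S * ((J * modNormSq P₁ (1 / 2) f) * (J * modNormSq P₂ (7 / 16) g)) := by
          gcongr
          exact modNormSq_mono _ (by norm_num) _
      _ = _ := by ring
  -- Here `-1 + 9/16 = -7/16`, the output weight of the `L²` estimates above.
  have hY : ∀ C : ℤ × ℝ → ℝ≥0∞, Measurable C →
      ∑' k : ℤ, (∫⁻ τ, modWeight P₀ (-1) (k, τ) * C (k, τ)) ^ 2
        ≤ J * ∫⁻ x, (modWeight P₀ (-(7 / 16)) x * C x) ^ 2 ∂freqMeasure := by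
    intro C hC
    rw [lintegral_freqMeasure (by fun_prop), ← ENNReal.tsum_mul_left]
    refine ENNReal.tsum_le_tsum fun l => ?_
    have := lintegral_modWeight_mul_sq_le P₀ (-1) l hC
    norm_num at this ⊢
    exact this
  have i1 : ∑' k : ℤ, (∫⁻ τ, modWeight P₀ (-1) (k, τ) * C₁ (k, τ)) ^ 2
      ≤ J * (overlapConst * K) * A := by
    refine (hY C₁ hcv1).trans ?_
    rw [mul_assoc]
    gcongr
    exact (h.lintegral_conv_left_le hf hg hf0).trans (le_of_eq (mul_assoc _ _ _))
  have i2 : ∑' k : ℤ, (∫⁻ τ, modWeight P₀ (-1) (k, τ) * C₂ (k, τ)) ^ 2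
      ≤ J * (overlapConst * K) * B := by
    refine (hY C₂ hcv2).trans ?_
    rw [mul_assoc]
    gcongr
    exact (h.lintegral_conv_right_le hf hg hg0).trans (le_of_eq (mul_assoc _ _ _))
  have hpt : ∀ k : ℤ,
      (∫⁻ τ, ENNReal.ofReal |(k : ℝ)| * modWeight P₀ (-1) (k, τ) * conv f g (k, τ)) ^ 2
      ≤ ENNReal.ofReal (6 * c) ^ 2 * 3 * ((∫⁻ τ, conv F G (k, τ)) ^ 2 +
        (∫⁻ τ, modWeight P₀ (-1) (k, τ) * C₁ (k, τ)) ^ 2 +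
        (∫⁻ τ, modWeight P₀ (-1) (k, τ) * C₂ (k, τ)) ^ 2) := by
    intro k
    have : ∫⁻ τ, ENNReal.ofReal |(k : ℝ)| * modWeight P₀ (-1) (k, τ) * conv f g (k, τ)
        ≤ ENNReal.ofReal (6 * c) * ((∫⁻ τ, conv F G (k, τ)) +
        (∫⁻ τ, modWeight P₀ (-1) (k, τ) * C₁ (k, τ)) +
        (∫⁻ τ, modWeight P₀ (-1) (k, τ) * C₂ (k, τ))) := by
      rw [← lintegral_add_left (by fun_prop), ← lintegral_add_left (by fun_prop),
        ← lintegral_const_mul _ (by fun_prop)]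
      exact lintegral_mono fun τ => h.weight_one_conv_le hf hg hf0 hg0 (k, τ)
    refine (pow_le_pow_left' this 2).trans ?_
    rw [mul_pow, mul_assoc]
    gcongr
    exact ennreal_add_sq_le _ _ _
  refine (ENNReal.tsum_le_tsum hpt).trans ?_
  rw [ENNReal.tsum_mul_left, ENNReal.tsum_add, ENNReal.tsum_add]
  calc _ ≤ ENNReal.ofReal (6 * c) ^ 2 * 3 * (S * J ^ 2 * A + J * (overlapConst * K) * A
        + J * (overlapConst * K) * B) := by gcongr
    _ ≤ ENNReal.ofReal (6 * c) ^ 2 * 3 * (S * J ^ 2 * A + J * (overlapConst * K) * A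
        + (J * (overlapConst * K) * B + S * J ^ 2 * B)) := by gcongr; exact le_self_add
    _ = _ := by ring

end Bilinear

end Bourgain
end

/-! ### Nonresonance of the cubic phases -/

noncomputable section

namespace Bourgain

/-- The form `A x² + B x y + A y²` is definite when `B² < 4 A²`. With `A = β₂ - β₁` and `B = β₂ +
2β₁` this is the condition `β₁ / β₂ < 1 / 4`, and the gap measures the definiteness. -/
theorem gap_pos {β₁ β₂ : ℝ} (h2 : β₂ ≠ 0) (h : β₁ / β₂ < 1 / 4) :
    0 < |β₂ - β₁| - |β₂ + 2 * β₁| / 2 := by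
  have hsq : (β₂ + 2 * β₁) ^ 2 < (2 * (β₂ - β₁)) ^ 2 := by
    have e : (2 * (β₂ - β₁)) ^ 2 - (β₂ + 2 * β₁) ^ 2 = 3 * β₂ ^ 2 * (1 - 4 * (β₁ / β₂)) := by
      field_simp; ring
    have : 0 < 3 * β₂ ^ 2 * (1 - 4 * (β₁ / β₂)) := by
      have : 0 < β₂ ^ 2 := by positivity
      have : 0 < 1 - 4 * (β₁ / β₂) := by linarith
      positivity
    linarith
  have := sq_lt_sq.1 hsq
  rw [abs_mul, abs_two] at this
  linarith

/-- By `2|xy| ≤ x² + y²` the form is at least the gap times `x² + y²`. Half of this is sacrificed to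
the perturbation `δ`. -/
theorem abs_form_ge (A B x y δ : ℝ) (h : |δ| ≤ (|A| - |B| / 2) / 2 * (x ^ 2 + y ^ 2)) :
    (|A| - |B| / 2) / 2 * (x ^ 2 + y ^ 2) ≤ |A * x ^ 2 + B * (x * y) + A * y ^ 2 + δ| := by
  have h1 : |A| * (x ^ 2 + y ^ 2) = |A * (x ^ 2 + y ^ 2)| := by
    rw [abs_mul, abs_of_nonneg (by positivity : 0 ≤ x ^ 2 + y ^ 2)]
  have h2 : |B * (x * y)| ≤ |B| * ((x ^ 2 + y ^ 2) / 2) := by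
    rw [abs_mul]
    gcongr
    rw [abs_le]
    constructor <;> nlinarith [sq_nonneg (x + y), sq_nonneg (x - y)]
  have h3 : A * (x ^ 2 + y ^ 2) = (A * x ^ 2 + B * (x * y) + A * y ^ 2 + δ) + -(B * (x * y)) + -δ := by
    ring
  have h4 := abs_add_three (A * x ^ 2 + B * (x * y) + A * y ^ 2 + δ) (-(B * (x * y))) (-δ)
  rw [← h3, ← h1, abs_neg, abs_neg] at h4
  linarith

section Counting

open Polynomial

theorem exists_tsum_bracket_cubic_le {b : ℝ} (hb : b ≠ 0) :
    ∃ K : ℝ≥0∞, K < ⊤ ∧ ∀ (p : ℝ → ℝ) (a₂ a₁ a₀ : ℝ),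
      (∀ x, p x = b * x ^ 3 + a₂ * x ^ 2 + a₁ * x + a₀) →
      ∑' k : ℤ, ENNReal.ofReal (bracket (p k) ^ (-(5 / 8) : ℝ)) ≤ K := by
  obtain ⟨K, hK, h⟩ := exists_tsum_bracket_eval_le (d := 3) (by norm_num) (abs_pos.2 hb)
  refine ⟨K, hK, fun p a₂ a₁ a₀ hp => ?_⟩
  have := h (C b * X ^ 3 + C a₂ * X ^ 2 + C a₁ * X + C a₀) (natDegree_cubic hb)
    (by rw [leadingCoeff_cubic hb])
  simpa [hp] using this

/-- The leading coefficient is only bounded below because in the applications it is `3β₂k`, which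
varies with the integer `k ≠ 0`. -/
theorem exists_tsum_bracket_quadratic_le {b : ℝ} (hb : 0 < b) :
    ∃ K : ℝ≥0∞, K < ⊤ ∧ ∀ (p : ℝ → ℝ) (a₂ a₁ a₀ : ℝ), b ≤ |a₂| →
      (∀ x, p x = a₂ * x ^ 2 + a₁ * x + a₀) →
      ∑' k : ℤ, ENNReal.ofReal (bracket (p k) ^ (-(5 / 8) : ℝ)) ≤ K := by
  obtain ⟨K, hK, h⟩ := exists_tsum_bracket_eval_le (d := 2) le_rfl hb
  refine ⟨K, hK, fun p a₂ a₁ a₀ ha hp => ?_⟩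
  have ha0 : a₂ ≠ 0 := by rintro rfl; simp at ha; linarith
  have := h (C a₂ * X ^ 2 + C a₁ * X + C a₀) (natDegree_quadratic ha0)
    (by rw [leadingCoeff_quadratic ha0]; exact ha)
  simpa [hp] using this

end Counting

theorem sq_le_mul_of_gap {κ x y r G q : ℝ} (hr : 1 ≤ |r|) (hG : 0 < G) (hκ : κ ^ 2 ≤ 2 * (x ^ 2 + y ^ 2) * |r|)
    (h : G / 2 * (x ^ 2 + y ^ 2) ≤ |q|) : κ ^ 2 ≤ (1 + 8 / G) * |r * q| := by
  have h1 : x ^ 2 + y ^ 2 ≤ 2 / G * |q| := by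
    rw [div_mul_eq_mul_div, le_div_iff₀ hG]; linarith
  rw [abs_mul]
  calc κ ^ 2 ≤ 2 * (x ^ 2 + y ^ 2) * |r| := hκ
    _ ≤ 2 * (2 / G * |q|) * |r| := by gcongr
    _ = 4 / G * (|r| * |q|) := by ring
    _ ≤ _ := by
        gcongr
        have : 4 / G ≤ 8 / G := by gcongr; norm_num
        linarith


/-- `H` is `k₁` times a definite form in `(k, k₂)`, up to `γ₁ - γ₂`. The counting polynomials that
pair `β₁` with `β₂` are cubic with leading coefficient `±(β₁ - β₂)`; in `count_one` the two phases
share `β₂`, the cubes cancel, and `3β₂k` leads. -/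
theorem exists_nonresonant_mixed {β₁ β₂ : ℝ} (h2 : β₂ ≠ 0) (h12 : β₁ ≠ β₂)
    (h : β₁ / β₂ < 1 / 4) :
    ∃ c : ℝ, ∃ K : ℝ≥0∞, ∀ γ₁ γ₂ : ℝ, |γ₁| + |γ₂| < (|β₂ - β₁| - |β₂ + 2 * β₁| / 2) / 2 →
      Nonresonant (phase β₂ γ₂) (phase β₁ γ₁) (phase β₂ γ₂) c K := by
  set G := |β₂ - β₁| - |β₂ + 2 * β₁| / 2 with hGdef
  have hG : 0 < G := gap_pos h2 h
  obtain ⟨K₁, hK₁, hc₁⟩ := exists_tsum_bracket_cubic_le (sub_ne_zero.2 h12)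
  obtain ⟨K₂, hK₂, hc₂⟩ := exists_tsum_bracket_quadratic_le (b := |3 * β₂|) (by positivity)
  obtain ⟨K₃, hK₃, hc₃⟩ := exists_tsum_bracket_cubic_le (sub_ne_zero.2 h12.symm)
  -- Definiteness gives `x² + y² ≤ (2 / G)|q|`, and both frequency bounds lose at most a further
  -- factor `2`, so `4 / G` would do; the summand `1` secures `1 ≤ c`.
  refine ⟨1 + 8 / G, K₁ + K₂ + K₃, fun γ₁ γ₂ hγ => ?_⟩
  have hres : ∀ k₁ k₂ : ℤ, k₁ ≠ 0 → G / 2 * (((k₁ + k₂ : ℤ) : ℝ) ^ 2 + (k₂ : ℝ) ^ 2) ≤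
      |(β₂ - β₁) * ((k₁ + k₂ : ℤ) : ℝ) ^ 2 + (β₂ + 2 * β₁) * (((k₁ + k₂ : ℤ) : ℝ) * k₂) +
        (β₂ - β₁) * (k₂ : ℝ) ^ 2 + (γ₁ - γ₂)| := by
    intro k₁ k₂ hk₁
    apply abs_form_ge
    have : (1 : ℝ) ≤ ((k₁ + k₂ : ℤ) : ℝ) ^ 2 + (k₂ : ℝ) ^ 2 := by
      have : 0 < (k₁ + k₂) ^ 2 + k₂ ^ 2 := by
        by_cases hk : k₂ = 0
        · subst hk
          have : 0 < k₁ ^ 2 := by positivity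
          simpa using this
        · positivity
      exact_mod_cast this
    calc |γ₁ - γ₂| ≤ |γ₁| + |γ₂| := abs_sub _ _
      _ ≤ G / 2 * 1 := by linarith
      _ ≤ _ := by gcongr
  have hH : ∀ k₁ k₂ : ℤ, phase β₂ γ₂ (k₁ + k₂) - phase β₁ γ₁ k₁ - phase β₂ γ₂ k₂ =
      k₁ * ((β₂ - β₁) * ((k₁ + k₂ : ℤ) : ℝ) ^ 2 + (β₂ + 2 * β₁) * (((k₁ + k₂ : ℤ) : ℝ) * k₂) +
        (β₂ - β₁) * (k₂ : ℝ) ^ 2 + (γ₁ - γ₂)) := by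
    intro k₁ k₂
    unfold phase
    push_cast
    ring
  have hone : ∀ k : ℤ, k ≠ 0 → (1 : ℝ) ≤ |(k : ℝ)| := fun k hk => by
    exact_mod_cast Int.one_le_abs hk
  refine ⟨by have := div_pos (by norm_num : (0 : ℝ) < 8) hG; linarith, by simp [hK₁, hK₂, hK₃],
    ?_, ?_, ?_, ?_, ?_⟩
  · intro k₁ k₂ hk₁ _
    rw [hH]
    refine sq_le_mul_of_gap (hone k₁ hk₁) hG ?_ (hres k₁ k₂ hk₁)
    nlinarith [hone k₁ hk₁, sq_nonneg (k₂ : ℝ), sq_nonneg (((k₁ + k₂ : ℤ) : ℝ))]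
  · intro k₁ k₂ hk₁ _
    rw [hH]
    have h3 := hres k₁ k₂ hk₁
    set q := (β₂ - β₁) * ((k₁ + k₂ : ℤ) : ℝ) ^ 2 + (β₂ + 2 * β₁) * (((k₁ + k₂ : ℤ) : ℝ) * k₂) +
        (β₂ - β₁) * (k₂ : ℝ) ^ 2 + (γ₁ - γ₂)
    -- From `|k₁| ≤ |k| + |k₂|`. The second factor `|k₁|` is supplied by `H` itself.
    have h4 : |((k₁ + k₂ : ℤ) : ℝ)| * |(k₁ : ℝ)| ≤
        2 * (((k₁ + k₂ : ℤ) : ℝ) ^ 2 + (k₂ : ℝ) ^ 2) := by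
      have e : (k₁ : ℝ) = ((k₁ + k₂ : ℤ) : ℝ) - k₂ := by push_cast; ring
      have := abs_sub ((k₁ + k₂ : ℤ) : ℝ) (k₂ : ℝ)
      rw [← e] at this
      nlinarith [sq_nonneg (|((k₁ + k₂ : ℤ) : ℝ)| - |(k₂ : ℝ)|), sq_abs ((k₁ + k₂ : ℤ) : ℝ),
        sq_abs (k₂ : ℝ), abs_nonneg ((k₁ + k₂ : ℤ) : ℝ)]
    have h5 : ((k₁ + k₂ : ℤ) : ℝ) ^ 2 + (k₂ : ℝ) ^ 2 ≤ 2 / G * |q| := by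
      rw [div_mul_eq_mul_div, le_div_iff₀ hG]; linarith
    rw [abs_mul, ← sq_abs (k₁ : ℝ)]
    calc |((k₁ + k₂ : ℤ) : ℝ)| * |(k₁ : ℝ)| ^ 2
        = |((k₁ + k₂ : ℤ) : ℝ)| * |(k₁ : ℝ)| * |(k₁ : ℝ)| := by ring
      _ ≤ 2 * (2 / G * |q|) * |(k₁ : ℝ)| := by
          gcongr ?_ * _; linarith
      _ = 4 / G * (|(k₁ : ℝ)| * |q|) := by ring
      _ ≤ _ := by
          gcongr
          have : 4 / G ≤ 8 / G := by gcongr; norm_num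
          linarith
  · intro k _ τ
    refine (hc₁ (fun x => β₁ * x ^ 3 - γ₁ * x + (β₂ * (k - x) ^ 3 - γ₂ * (k - x)) - τ)
      (3 * β₂ * k) (-γ₁ - 3 * β₂ * k ^ 2 + γ₂) (β₂ * k ^ 3 - γ₂ * k - τ)
      (fun x => by ring)).trans' (le_of_eq ?_) |>.trans ?_
    · simp [phase]
    · rw [add_assoc]; exact le_self_add
  · intro k hk τ
    refine (hc₂ (fun x => β₂ * x ^ 3 - γ₂ * x - (β₂ * (x - k) ^ 3 - γ₂ * (x - k)) - τ)
      (3 * β₂ * k) (-3 * β₂ * k ^ 2) (β₂ * k ^ 3 - γ₂ * k - τ) ?_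
      (fun x => by ring)).trans' (le_of_eq ?_) |>.trans ?_
    · rw [abs_mul (3 * β₂)]; exact le_mul_of_one_le_right (abs_nonneg _) (hone k hk)
    · simp [phase]
    · rw [add_right_comm]; exact le_add_self
  · intro k _ τ
    refine (hc₃ (fun x => β₂ * x ^ 3 - γ₂ * x - (β₁ * (x - k) ^ 3 - γ₁ * (x - k)) - τ)
      (3 * β₁ * k) (-γ₂ - 3 * β₁ * k ^ 2 + γ₁) (β₁ * k ^ 3 - γ₁ * k - τ)
      (fun x => by ring)).trans' (le_of_eq ?_) |>.trans ?_
    · simp [phase]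
    · exact le_add_self

/-- Now `H` is `-k` times a definite form in `(k₁, k₂)`, up to `γ₁ - γ₂`. Only `count_zero` pairs
equal dispersions and is quadratic; the other two counts are cubic with leading coefficient `β₁ -
β₂`. -/
theorem exists_nonresonant_diagonal {β₁ β₂ : ℝ} (h2 : β₂ ≠ 0) (h12 : β₁ ≠ β₂)
    (h : β₁ / β₂ < 1 / 4) :
    ∃ c : ℝ, ∃ K : ℝ≥0∞, ∀ γ₁ γ₂ : ℝ, |γ₁| + |γ₂| < (|β₂ - β₁| - |β₂ + 2 * β₁| / 2) / 2 →
      Nonresonant (phase β₁ γ₁) (phase β₂ γ₂) (phase β₂ γ₂) c K := by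
  set G := |β₂ - β₁| - |β₂ + 2 * β₁| / 2 with hGdef
  have hG : 0 < G := gap_pos h2 h
  obtain ⟨K₁, hK₁, hc₁⟩ := exists_tsum_bracket_quadratic_le (b := |3 * β₂|) (by positivity)
  obtain ⟨K₂, hK₂, hc₂⟩ := exists_tsum_bracket_cubic_le (sub_ne_zero.2 h12)
  refine ⟨1 + 8 / G, K₁ + K₂, fun γ₁ γ₂ hγ => ?_⟩
  have hone : ∀ k : ℤ, k ≠ 0 → (1 : ℝ) ≤ |(k : ℝ)| := fun k hk => by
    exact_mod_cast Int.one_le_abs hk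
  have hsq : ∀ k : ℤ, k ≠ 0 → (1 : ℝ) ≤ (k : ℝ) ^ 2 := fun k hk => by
    have := hone k hk
    rw [← sq_abs]; nlinarith
  have hres : ∀ k₁ k₂ : ℤ, k₁ ≠ 0 → G / 2 * ((k₁ : ℝ) ^ 2 + (k₂ : ℝ) ^ 2) ≤
      |(β₂ - β₁) * (k₁ : ℝ) ^ 2 + -(β₂ + 2 * β₁) * ((k₁ : ℝ) * k₂) +
        (β₂ - β₁) * (k₂ : ℝ) ^ 2 + (γ₁ - γ₂)| := by
    intro k₁ k₂ hk₁
    rw [hGdef, ← abs_neg (β₂ + 2 * β₁)]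
    apply abs_form_ge
    rw [abs_neg, ← hGdef]
    calc |γ₁ - γ₂| ≤ |γ₁| + |γ₂| := abs_sub _ _
      _ ≤ G / 2 * 1 := by linarith
      _ ≤ _ := by gcongr; nlinarith [hsq k₁ hk₁, sq_nonneg (k₂ : ℝ)]
  have hH : ∀ k₁ k₂ : ℤ, phase β₁ γ₁ (k₁ + k₂) - phase β₂ γ₂ k₁ - phase β₂ γ₂ k₂ =
      -((k₁ + k₂ : ℤ) : ℝ) * ((β₂ - β₁) * (k₁ : ℝ) ^ 2 + -(β₂ + 2 * β₁) * ((k₁ : ℝ) * k₂) +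
        (β₂ - β₁) * (k₂ : ℝ) ^ 2 + (γ₁ - γ₂)) := by
    intro k₁ k₂
    unfold phase
    push_cast
    ring
  refine ⟨by have := div_pos (by norm_num : (0 : ℝ) < 8) hG; linarith, by simp [hK₁, hK₂],
    ?_, ?_, ?_, ?_, ?_⟩
  · intro k₁ k₂ hk₁ _
    rw [hH]
    -- At `k = 0` the resonance function vanishes, but so does the quantity to be bounded.
    by_cases hk : k₁ + k₂ = 0
    · simp [hk]
    refine sq_le_mul_of_gap (by rw [abs_neg]; exact hone _ hk) hG ?_ (hres k₁ k₂ hk₁)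
    rw [abs_neg, ← sq_abs, sq]
    gcongr
    push_cast
    have e1 := abs_add_le (k₁ : ℝ) k₂
    have e2 : ∀ k : ℤ, |(k : ℝ)| ≤ (k : ℝ) ^ 2 := by
      intro k
      by_cases hk : k = 0
      · simp [hk]
      · rw [← sq_abs]; nlinarith [hone k hk]
    nlinarith [e2 k₁, e2 k₂, sq_nonneg (k₁ : ℝ), sq_nonneg (k₂ : ℝ)]
  · intro k₁ k₂ hk₁ _
    rw [hH]
    have h3 := hres k₁ k₂ hk₁
    set q := (β₂ - β₁) * (k₁ : ℝ) ^ 2 + -(β₂ + 2 * β₁) * ((k₁ : ℝ) * k₂) +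
        (β₂ - β₁) * (k₂ : ℝ) ^ 2 + (γ₁ - γ₂)
    have h5 : (k₁ : ℝ) ^ 2 + (k₂ : ℝ) ^ 2 ≤ 2 / G * |q| := by
      rw [div_mul_eq_mul_div, le_div_iff₀ hG]; linarith
    rw [abs_mul, abs_neg]
    calc |((k₁ + k₂ : ℤ) : ℝ)| * (k₁ : ℝ) ^ 2
        ≤ |((k₁ + k₂ : ℤ) : ℝ)| * (2 / G * |q|) := by
          gcongr; nlinarith [sq_nonneg (k₂ : ℝ)]
      _ = 2 / G * (|((k₁ + k₂ : ℤ) : ℝ)| * |q|) := by ring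
      _ ≤ _ := by
          gcongr
          have : 2 / G ≤ 8 / G := by gcongr; norm_num
          linarith
  · intro k hk τ
    refine (hc₁ (fun x => β₂ * x ^ 3 - γ₂ * x + (β₂ * (k - x) ^ 3 - γ₂ * (k - x)) - τ)
      (3 * β₂ * k) (-3 * β₂ * k ^ 2) (β₂ * k ^ 3 - γ₂ * k - τ) ?_
      (fun x => by ring)).trans' (le_of_eq ?_) |>.trans ?_
    · rw [abs_mul (3 * β₂)]; exact le_mul_of_one_le_right (abs_nonneg _) (hone k hk)
    · simp [phase]
    · exact le_self_add
  all_goals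
    intro k _ τ
    refine (hc₂ (fun x => β₁ * x ^ 3 - γ₁ * x - (β₂ * (x - k) ^ 3 - γ₂ * (x - k)) - τ)
      (3 * β₂ * k) (-γ₁ - 3 * β₂ * k ^ 2 + γ₂) (β₂ * k ^ 3 - γ₂ * k - τ)
      (fun x => by ring)).trans' (le_of_eq ?_) |>.trans ?_
    · simp [phase]
    · exact le_add_self

end Bourgain
end

/-! ### From weighted `L²` to the norms with spatial weight -/

noncomputable section

namespace Bourgain

/-- The function `⟨k⟩^s |F(k, τ)|` on `ℤ × ℝ`. -/
def spaceWeighted (s : ℝ) (F : ℤ → ℝ → ℂ) (x : ℤ × ℝ) : ℝ≥0∞ :=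
  ENNReal.ofReal (bracket x.1 ^ s) * ‖F x.1 x.2‖ₑ

theorem measurable_uncurry_of_forall {E : Type*} [MeasurableSpace E] {F : ℤ → ℝ → E}
    (hF : ∀ k, Measurable (F k)) : Measurable fun x : ℤ × ℝ => F x.1 x.2 :=
  measurable_from_prod_countable_right hF

theorem measurable_spaceWeighted (s : ℝ) {F : ℤ → ℝ → ℂ} (hF : ∀ k, Measurable (F k)) :
    Measurable (spaceWeighted s F) := by
  have := measurable_uncurry_of_forall hF
  unfold spaceWeighted
  fun_prop

theorem weight_mul_enorm (β γ s b : ℝ) (F : ℤ → ℝ → ℂ) (k : ℤ) (τ : ℝ) :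
    ENNReal.ofReal (bracket k ^ s * bracket (τ - phase β γ k) ^ b) * ‖F k τ‖ₑ
      = modWeight (phase β γ) b (k, τ) * spaceWeighted s F (k, τ) := by
  unfold modWeight spaceWeighted
  rw [ENNReal.ofReal_mul (Real.rpow_nonneg (bracket_pos _).le _)]
  ring

theorem normX_eq (β γ s b : ℝ) {F : ℤ → ℝ → ℂ} (hF : ∀ k, Measurable (F k)) :
    normX β γ s b F = modNormSq (phase β γ) b (spaceWeighted s F) ^ (1 / 2 : ℝ) := by
  have := measurable_spaceWeighted s hF
  unfold normX modNormSq
  simp_rw [weight_mul_enorm]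
  rw [lintegral_freqMeasure (by fun_prop)]

/-- `⟨k⟩ ≤ ⟨k₁⟩⟨k - k₁⟩` holds with constant one, and so does its power `s ≥ 0`; hence no constant
depends on `s`. -/
theorem spaceWeighted_conv_le {s : ℝ} (hs : 0 ≤ s) {F G : ℤ → ℝ → ℂ} (hF : ∀ k, Measurable (F k))
    (hG : ∀ k, Measurable (G k)) (x : ℤ × ℝ) :
    ENNReal.ofReal (bracket x.1 ^ s) * conv (fun y => ‖F y.1 y.2‖ₑ) (fun y => ‖G y.1 y.2‖ₑ) x
      ≤ conv (spaceWeighted s F) (spaceWeighted s G) x := by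
  have h1 := measurable_uncurry_of_forall hF
  have h2 := measurable_uncurry_of_forall hG
  unfold conv
  rw [← lintegral_const_mul _ (by fun_prop)]
  refine lintegral_mono fun y => ?_
  unfold spaceWeighted
  calc _ ≤ ENNReal.ofReal (bracket y.1 ^ s * bracket ((x - y).1 : ℤ) ^ s) *
        (‖F y.1 y.2‖ₑ * ‖G (x - y).1 (x - y).2‖ₑ) := by
        gcongr
        rw [← Real.mul_rpow (bracket_pos _).le (bracket_pos _).le]
        refine Real.rpow_le_rpow (bracket_pos _).le ?_ hs
        have := bracket_add_le_mul (y.1 : ℝ) ((x - y).1 : ℤ)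
        convert this using 2
        simp
    _ = _ := by
        rw [ENNReal.ofReal_mul (Real.rpow_nonneg (bracket_pos _).le _)]
        ring

theorem rpow_half_add_le (D A B : ℝ≥0∞) :
    (D * (A + B)) ^ (1 / 2 : ℝ) ≤ D ^ (1 / 2 : ℝ) * (A ^ (1 / 2 : ℝ) + B ^ (1 / 2 : ℝ)) := by
  rw [ENNReal.mul_rpow_of_nonneg _ _ (by norm_num)]
  gcongr
  exact ENNReal.rpow_add_le_add_rpow A B (by norm_num) (by norm_num)

/-- The constant is fixed by `c` and `K` before the phases and `s` are chosen, which gives the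
uniformity in `γ₁`, `γ₂` and `s`. In each summand one input is measured with the weaker exponent
`7/16`; this is where the power of `T` will be gained. -/
theorem Nonresonant.exists_normZ_le (c : ℝ) {K : ℝ≥0∞} (hK : K < ⊤) :
    ∃ C : ℝ≥0∞, C < ⊤ ∧ ∀ (β₀ γ₀ β₁ γ₁ β₂ γ₂ : ℝ),
      Nonresonant (phase β₀ γ₀) (phase β₁ γ₁) (phase β₂ γ₂) c K →
      ∀ s : ℝ, 0 ≤ s → ∀ F G H : ℤ → ℝ → ℂ,
      (∀ k, Measurable (F k)) → (∀ k, Measurable (G k)) → F 0 = 0 → G 0 = 0 →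
      (∀ k τ, ‖H k τ‖ₑ ≤ ENNReal.ofReal |(k : ℝ)| *
        conv (fun y => ‖F y.1 y.2‖ₑ) (fun y => ‖G y.1 y.2‖ₑ) (k, τ)) →
      normZ β₀ γ₀ s (-1 / 2) H ≤ C *
        (normX β₁ γ₁ s (1 / 2) F * normX β₂ γ₂ s (7 / 16) G +
          normX β₁ γ₁ s (7 / 16) F * normX β₂ γ₂ s (1 / 2) G) := by
  set D₁ : ℝ≥0∞ := ENNReal.ofReal c ^ 2 * 6 * (overlapConst * K) with hD₁
  set D₂ : ℝ≥0∞ := ENNReal.ofReal (6 * c) ^ 2 * 3 *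
        ((∑' l : ℤ, ENNReal.ofReal (bracket l)⁻¹ ^ 2) *
          (∫⁻ x : ℝ, ENNReal.ofReal (bracket x ^ (-(9 / 8) : ℝ))) ^ 2 +
          (∫⁻ x : ℝ, ENNReal.ofReal (bracket x ^ (-(9 / 8) : ℝ))) * (overlapConst * K)) with hD₂
  have hJ : ∫⁻ x : ℝ, ENNReal.ofReal (bracket x ^ (-(9 / 8) : ℝ)) < ⊤ :=
    lintegral_bracket_rpow_lt_top (by norm_num)
  have hS : ∑' l : ℤ, ENNReal.ofReal (bracket l)⁻¹ ^ 2 < ⊤ := by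
    refine lt_of_eq_of_lt ?_ (tsum_bracket_rpow_lt_top (p := 2) (by norm_num))
    congr 1 with l
    have := bracket_pos l
    rw [← ENNReal.ofReal_pow (by positivity), Real.rpow_neg this.le, Real.rpow_two, inv_pow]
  have hO := overlapConst_lt_top
  have hD₁t : D₁ < ⊤ := by
    rw [hD₁]
    exact ENNReal.mul_lt_top (ENNReal.mul_lt_top (by simp) (by simp)) (ENNReal.mul_lt_top hO hK)
  have hD₂t : D₂ < ⊤ := by
    rw [hD₂]
    refine ENNReal.mul_lt_top (ENNReal.mul_lt_top
      (ENNReal.pow_lt_top ENNReal.ofReal_lt_top) (by simp)) (ENNReal.add_lt_top.2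
      ⟨ENNReal.mul_lt_top hS (ENNReal.pow_lt_top hJ), ENNReal.mul_lt_top hJ
        (ENNReal.mul_lt_top hO hK)⟩)
  refine ⟨D₁ ^ (1 / 2 : ℝ) + D₂ ^ (1 / 2 : ℝ), ENNReal.add_lt_top.2
    ⟨ENNReal.rpow_lt_top_of_nonneg (by norm_num) hD₁t.ne,
      ENNReal.rpow_lt_top_of_nonneg (by norm_num) hD₂t.ne⟩, ?_⟩
  intro β₀ γ₀ β₁ γ₁ β₂ γ₂ hnr s hs F G H hF hG hF0 hG0 hH
  have hf := measurable_spaceWeighted s hF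
  have hg := measurable_spaceWeighted s hG
  have hf0 : ∀ τ, spaceWeighted s F (0, τ) = 0 := by simp [spaceWeighted, hF0]
  have hg0 : ∀ τ, spaceWeighted s G (0, τ) = 0 := by simp [spaceWeighted, hG0]
  have hcv := measurable_conv hf hg
  have hle : ∀ (b : ℝ) (k : ℤ) (τ : ℝ),
      ENNReal.ofReal (bracket k ^ s * bracket (τ - phase β₀ γ₀ k) ^ b) * ‖H k τ‖ₑ ≤
        ENNReal.ofReal |(k : ℝ)| * modWeight (phase β₀ γ₀) b (k, τ) *
          conv (spaceWeighted s F) (spaceWeighted s G) (k, τ) := by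
    intro b k τ
    rw [ENNReal.ofReal_mul (Real.rpow_nonneg (bracket_pos _).le _)]
    calc _ ≤ ENNReal.ofReal (bracket k ^ s) * ENNReal.ofReal (bracket (τ - phase β₀ γ₀ k) ^ b) *
          (ENNReal.ofReal |(k : ℝ)| *
            conv (fun y => ‖F y.1 y.2‖ₑ) (fun y => ‖G y.1 y.2‖ₑ) (k, τ)) := by
          gcongr; exact hH k τ
      _ = ENNReal.ofReal |(k : ℝ)| * ENNReal.ofReal (bracket (τ - phase β₀ γ₀ k) ^ b) *
          (ENNReal.ofReal (bracket k ^ s) *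
            conv (fun y => ‖F y.1 y.2‖ₑ) (fun y => ‖G y.1 y.2‖ₑ) (k, τ)) := by ring
      _ ≤ _ := by
          gcongr
          · exact le_rfl
          · exact spaceWeighted_conv_le hs hF hG (k, τ)
  rw [normX_eq _ _ _ _ hF, normX_eq _ _ _ _ hG, normX_eq _ _ _ _ hF, normX_eq _ _ _ _ hG]
  rw [← ENNReal.mul_rpow_of_nonneg _ _ (by norm_num), ← ENNReal.mul_rpow_of_nonneg _ _ (by norm_num)]
  unfold normZ
  rw [add_mul]
  refine add_le_add ?_ ?_
  · refine le_trans ?_ (rpow_half_add_le _ _ _)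
    unfold normX
    gcongr
    refine le_trans ?_ (hnr.lintegral_weight_half_sq_le hf hg hf0 hg0)
    rw [lintegral_freqMeasure (by fun_prop)]
    refine ENNReal.tsum_le_tsum fun k => lintegral_mono fun τ => pow_le_pow_left' ?_ 2
    have := hle (-1 / 2) k τ
    rwa [show (-1 / 2 : ℝ) = -(1 / 2) by norm_num] at this ⊢
  · refine le_trans ?_ (rpow_half_add_le _ _ _)
    unfold normY
    gcongr
    refine le_trans ?_ (hnr.tsum_weight_one_sq_le hf hg hf0 hg0)
    refine ENNReal.tsum_le_tsum fun k => pow_le_pow_left' (lintegral_mono fun τ => ?_) 2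
    have := hle (-1) k τ
    rwa [show (-1 / 2 - 1 / 2 : ℝ) = -1 by norm_num]

end Bourgain
end

/-! ### The Fourier transform in time and Plancherel's theorem -/

noncomputable section

namespace Bourgain

open scoped FourierTransform SchwartzMap

/-- The Fourier transform in time, `∫ h(t) exp(i τ t) dt`. -/
def timeFourier (h : ℝ → ℂ) (τ : ℝ) : ℂ :=
  ∫ t : ℝ, h t * Complex.exp (Complex.I * (τ : ℂ) * (t : ℂ))

theorem norm_exp_I_mul_mul (a b : ℝ) : ‖Complex.exp (Complex.I * (a : ℂ) * (b : ℂ))‖ = 1 := by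
  rw [mul_assoc, mul_comm, ← Complex.ofReal_mul, Complex.norm_exp_ofReal_mul_I]

theorem timeFourier_eq (h : ℝ → ℂ) (τ : ℝ) :
    timeFourier h τ = 𝓕 h ((-(2 * Real.pi)⁻¹) * τ) := by
  rw [Real.fourier_real_eq_integral_exp_smul, timeFourier]
  refine integral_congr_ae (Filter.Eventually.of_forall fun t => ?_)
  simp only [smul_eq_mul]
  rw [mul_comm]
  congr 2
  push_cast
  have : (Real.pi : ℂ) ≠ 0 := by exact_mod_cast Real.pi_ne_zero
  field_simp

theorem norm_timeFourier_le (h : ℝ → ℂ) (τ : ℝ) : ‖timeFourier h τ‖ ≤ ∫ t, ‖h t‖ := by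
  refine (norm_integral_le_integral_norm _).trans (le_of_eq ?_)
  simp_rw [norm_mul, norm_exp_I_mul_mul, mul_one]

theorem continuous_timeFourier {h : ℝ → ℂ} (hh : Integrable h) : Continuous (timeFourier h) := by
  have : Continuous (𝓕 h) := VectorFourier.fourierIntegral_continuous
    Real.continuous_fourierChar (by exact continuous_inner) hh
  have e : timeFourier h = fun τ => 𝓕 h ((-(2 * Real.pi)⁻¹) * τ) := funext (timeFourier_eq h)
  rw [e]
  fun_prop

/-- A Schwartz-like kernel whose inverse Fourier transform is `1` on `[0, 1]`. -/
theorem exists_cutoff_kernel : ∃ (Ψ : ℝ → ℂ) (C : ℝ), 0 < C ∧ Continuous Ψ ∧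
    (∀ σ, ‖Ψ σ‖ ≤ C * bracket σ ^ (-2 : ℝ)) ∧
    ∀ r ∈ Icc (0 : ℝ) 1, ∫ σ : ℝ, Ψ σ * Complex.exp (Complex.I * (σ : ℂ) * (r : ℂ)) = 1 := by
  -- The bump equals `1` on `[-1/2, 3/2]`, which contains `[0, 1]`; the kernel is its Fourier
  -- transform, rescaled to the convention `exp(i σ r)`.
  let φ : ContDiffBump (1 / 2 : ℝ) := ⟨1, 2, by norm_num, by norm_num⟩
  have hφ1 : ContDiff ℝ ∞ (Complex.ofRealCLM ∘ φ) := Complex.ofRealCLM.contDiff.comp φ.contDiff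
  have hφ2 : HasCompactSupport (Complex.ofRealCLM ∘ φ) := φ.hasCompactSupport.comp_left rfl
  let ψ : 𝓢(ℝ, ℂ) := hφ2.toSchwartzMap hφ1
  let g : 𝓢(ℝ, ℂ) := 𝓕 ψ
  have hpi : (0 : ℝ) < 2 * Real.pi := by positivity
  obtain ⟨C₀, hC₀, hd⟩ : ∃ C₀ : ℝ, 0 < C₀ ∧ ∀ x, (1 + ‖x‖) ^ 2 * ‖g x‖ ≤ C₀ := by
    refine ⟨2 ^ 2 * (Finset.Iic (2, 0)).sup (fun m => SchwartzMap.seminorm ℝ m.1 m.2) g + 1,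
      by positivity, fun x => ?_⟩
    have := SchwartzMap.one_add_le_sup_seminorm_apply (𝕜 := ℝ) (m := (2, 0)) (k := 2) (n := 0)
      le_rfl le_rfl g x
    rw [norm_iteratedFDeriv_zero] at this
    exact this.trans (lt_add_one _).le
  refine ⟨fun σ => ((2 * Real.pi)⁻¹ : ℝ) * g ((2 * Real.pi)⁻¹ * σ), C₀ * (2 * Real.pi) ^ 2,
    by positivity, by fun_prop, ?_, ?_⟩
  · intro σ
    have h1 := hd ((2 * Real.pi)⁻¹ * σ)
    have hpi1 : (1 : ℝ) ≤ 2 * Real.pi := by linarith [Real.pi_gt_three]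
    have hb : bracket σ ≤ (2 * Real.pi) * (1 + ‖(2 * Real.pi)⁻¹ * σ‖) := by
      rw [norm_mul, Real.norm_eq_abs, Real.norm_eq_abs, abs_of_pos (by positivity : 0 < (2 * Real.pi)⁻¹),
        mul_add, ← mul_assoc, mul_inv_cancel₀ hpi.ne', one_mul, mul_one]
      unfold bracket
      linarith
    have hbp := bracket_pos σ
    have e1 : ‖g ((2 * Real.pi)⁻¹ * σ)‖ * bracket σ ^ 2 ≤ C₀ * (2 * Real.pi) ^ 2 := by
      calc ‖g ((2 * Real.pi)⁻¹ * σ)‖ * bracket σ ^ 2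
          ≤ ‖g ((2 * Real.pi)⁻¹ * σ)‖ * ((2 * Real.pi) * (1 + ‖(2 * Real.pi)⁻¹ * σ‖)) ^ 2 := by gcongr
        _ = (2 * Real.pi) ^ 2 *
          ((1 + ‖(2 * Real.pi)⁻¹ * σ‖) ^ 2 * ‖g ((2 * Real.pi)⁻¹ * σ)‖) := by ring
        _ ≤ (2 * Real.pi) ^ 2 * C₀ := by gcongr
        _ = _ := mul_comm _ _
    have e2 : ‖(((2 * Real.pi)⁻¹ : ℝ) : ℂ) * g ((2 * Real.pi)⁻¹ * σ)‖
        ≤ ‖g ((2 * Real.pi)⁻¹ * σ)‖ := by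
      rw [norm_mul, Complex.norm_real, Real.norm_eq_abs, abs_of_pos (by positivity)]
      exact mul_le_of_le_one_left (norm_nonneg _) (inv_le_one_of_one_le₀ hpi1)
    refine e2.trans ?_
    rw [Real.rpow_neg hbp.le, Real.rpow_two, ← div_eq_mul_inv, le_div_iff₀ (by positivity)]
    exact e1
  · intro r hr
    have h1 : 𝓕⁻ (g : ℝ → ℂ) r = 1 := by
      have : 𝓕⁻ g = ψ := FourierTransform.fourierInv_fourier_eq ψ
      rw [← SchwartzMap.fourierInv_coe, this]
      change ((φ r : ℝ) : ℂ) = 1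
      rw [φ.one_of_mem_closedBall]
      · simp
      · rw [Metric.mem_closedBall, Real.dist_eq, abs_le]
        change -1 ≤ r - 1 / 2 ∧ r - 1 / 2 ≤ 1
        constructor <;> linarith [hr.1, hr.2]
    rw [Real.fourierInv_eq'] at h1
    rw [← h1]
    have := Measure.integral_comp_mul_left
      (fun ξ : ℝ => g ξ * Complex.exp (Complex.I * ((2 * Real.pi * ξ : ℝ) : ℂ) * (r : ℂ)))
      (2 * Real.pi)⁻¹
    rw [inv_inv, abs_of_pos hpi] at this
    have e3 : ∀ σ : ℝ, ((2 * Real.pi)⁻¹ : ℝ) * g ((2 * Real.pi)⁻¹ * σ) *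
        Complex.exp (Complex.I * (σ : ℂ) * (r : ℂ)) = ((2 * Real.pi)⁻¹ : ℝ) *
        (g ((2 * Real.pi)⁻¹ * σ) * Complex.exp (Complex.I *
          ((2 * Real.pi * ((2 * Real.pi)⁻¹ * σ) : ℝ) : ℂ) * (r : ℂ))) := by
      intro σ
      rw [mul_inv_cancel_left₀ hpi.ne', mul_assoc]
    simp_rw [e3]
    rw [integral_const_mul, this, Complex.real_smul, ← mul_assoc, ← Complex.ofReal_mul,
      inv_mul_cancel₀ hpi.ne', Complex.ofReal_one, one_mul]
    refine integral_congr_ae (Filter.Eventually.of_forall fun ξ => ?_)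
    simp only [smul_eq_mul]
    rw [mul_comm]
    congr 2
    simp
    ring

section Plancherel

/-- True on Schwartz functions, hence on `L²`, since both sides are continuous and Schwartz
functions are dense. -/
theorem lpPairing_fourier (f g : Lp ℂ 2 (volume : Measure ℝ)) :
    (ContinuousLinearMap.mul ℂ ℂ).lpPairing volume 2 2 (𝓕 f) g
      = (ContinuousLinearMap.mul ℂ ℂ).lpPairing volume 2 2 f (𝓕 g) := by
  have hd := SchwartzMap.denseRange_toLpCLM (E := ℝ) (F := ℂ) (p := 2) (μ := volume)
    ENNReal.ofNat_ne_top
  have hF : Continuous fun f : Lp ℂ 2 (volume : Measure ℝ) => 𝓕 f :=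
    (FourierTransform.fourierCLM ℂ (Lp ℂ 2 (volume : Measure ℝ))).continuous
  refine DenseRange.induction_on₂ (p := fun f g =>
    (ContinuousLinearMap.mul ℂ ℂ).lpPairing volume 2 2 (𝓕 f) g
      = (ContinuousLinearMap.mul ℂ ℂ).lpPairing volume 2 2 f (𝓕 g)) hd ?_ ?_ f g
  · apply isClosed_eq
    · fun_prop
    · fun_prop
  · intro f g
    simp only [SchwartzMap.toLpCLM_apply, SchwartzMap.toLp_fourier_eq]
    rw [ContinuousLinearMap.lpPairing_eq_integral, ContinuousLinearMap.lpPairing_eq_integral]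
    simp only [ContinuousLinearMap.mul_apply']
    have e1 : ∫ x, (SchwartzMap.toLp (𝓕 f) 2 : ℝ → ℂ) x * (g.toLp 2 : ℝ → ℂ) x
        = ∫ x, 𝓕 f x * g x := by
      apply integral_congr_ae
      filter_upwards [(𝓕 f).coeFn_toLp 2 volume, g.coeFn_toLp 2 volume] with x h1 h2
      rw [h1, h2]
    have e2 : ∫ x, (SchwartzMap.toLp f 2 : ℝ → ℂ) x * ((𝓕 g).toLp 2 : ℝ → ℂ) x
        = ∫ x, f x * 𝓕 g x := by
      apply integral_congr_ae
      filter_upwards [f.coeFn_toLp 2 volume, (𝓕 g).coeFn_toLp 2 volume] with x h1 h2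
      rw [h1, h2]
    rw [e1, e2]
    exact SchwartzMap.integral_fourier_mul_eq f g

/-- On `L¹ ∩ L²` the `L²` Fourier transform is given by the Fourier integral. -/
theorem coeFn_fourier_toLp {h : ℝ → ℂ} (h1 : Integrable h) (h2 : MemLp h 2) :
    (𝓕 (h2.toLp h) : Lp ℂ 2 (volume : Measure ℝ)) =ᵐ[volume] 𝓕 h := by
  have hcont : Continuous (𝓕 h) := VectorFourier.fourierIntegral_continuous
    Real.continuous_fourierChar (by exact continuous_inner) h1
  -- Against a smooth compactly supported function, both transforms can be moved onto it, the first
  -- by `L²` duality and the second by Fubini; both sides then pair `h` with the same Schwartz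
  -- function.
  refine ae_eq_of_integral_contDiff_smul_eq
    ((Lp.memLp _).locallyIntegrable (by norm_num)) hcont.locallyIntegrable ?_
  intro g hg hgs
  have hg₁ : HasCompactSupport (Complex.ofRealCLM ∘ g) := hgs.comp_left rfl
  have hg₂ : ContDiff ℝ ∞ (Complex.ofRealCLM ∘ g) := by fun_prop
  set ψ : 𝓢(ℝ, ℂ) := hg₁.toSchwartzMap hg₂ with hψ
  have e1 : ∫ x, g x • (𝓕 (h2.toLp h) : Lp ℂ 2 (volume : Measure ℝ)) x
      = (ContinuousLinearMap.mul ℂ ℂ).lpPairing volume 2 2 (𝓕 (h2.toLp h)) (ψ.toLp 2) := by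
    rw [ContinuousLinearMap.lpPairing_eq_integral]
    apply integral_congr_ae
    filter_upwards [ψ.coeFn_toLp 2 volume] with x hx
    rw [hx]
    simp [hψ, mul_comm]
  have e2 : (ContinuousLinearMap.mul ℂ ℂ).lpPairing volume 2 2 (h2.toLp h) ((𝓕 ψ).toLp 2)
      = ∫ x, h x * 𝓕 ψ x := by
    rw [ContinuousLinearMap.lpPairing_eq_integral]
    apply integral_congr_ae
    filter_upwards [(𝓕 ψ).coeFn_toLp 2 volume, h2.coeFn_toLp] with x hx hx2
    rw [hx, hx2]
    simp
  rw [e1, lpPairing_fourier, SchwartzMap.toLp_fourier_eq, e2]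
  have := VectorFourier.integral_fourierIntegral_smul_eq_flip (μ := volume) (ν := volume)
    (L := innerₗ ℝ) (f := h) (g := (ψ : ℝ → ℂ)) Real.continuous_fourierChar
    (by exact continuous_inner) h1 ψ.integrable
  rw [flip_innerₗ] at this
  have e3 : ∀ x, g x • 𝓕 h x = 𝓕 h x • ψ x := by intro x; simp [hψ, mul_comm]
  simp_rw [e3]
  exact this.symm

theorem memLp_two_timeFourier {h : ℝ → ℂ} (h1 : Integrable h) (h2 : MemLp h 2) :
    MemLp (timeFourier h) 2 := by
  have e : timeFourier h = fun τ => 𝓕 h ((-(2 * Real.pi)⁻¹) * τ) := funext (timeFourier_eq h)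
  have hm : MemLp (𝓕 h) 2 := (memLp_congr_ae (coeFn_fourier_toLp h1 h2)).1 (Lp.memLp _)
  rw [memLp_two_iff_integrable_sq_norm (continuous_timeFourier h1).aestronglyMeasurable, e]
  exact ((memLp_two_iff_integrable_sq_norm hm.1).1 hm).comp_mul_left'
    (R := (-(2 * Real.pi)⁻¹)) (by simp [Real.pi_ne_zero])

/-- The inverse Fourier transform of an `L²` function, in the sense of duality. -/
theorem exists_dual_timeFourier {f : ℝ → ℂ} (hf : MemLp f 2) (hfm : Measurable f) :
    ∃ g : ℝ → ℂ, MemLp g 2 ∧ ∀ h : ℝ → ℂ, Integrable h → MemLp h 2 →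
      ∫ t, g t * h t = ∫ τ, f τ * timeFourier h τ := by
  have hpi : (0 : ℝ) < 2 * Real.pi := by positivity
  -- The scaling by `-2π` converts between `timeFourier` and the transform `𝓕`.
  set f₁ : ℝ → ℂ := fun ξ => (2 * Real.pi : ℝ) * f (-(2 * Real.pi) * ξ) with hf₁
  have hf₁m : MemLp f₁ 2 := by
    have hm : Measurable fun ξ => f (-(2 * Real.pi) * ξ) := by fun_prop
    refine MemLp.const_mul ?_ _
    rw [memLp_two_iff_integrable_sq_norm hm.aestronglyMeasurable]
    exact ((memLp_two_iff_integrable_sq_norm hf.1).1 hf).comp_mul_left'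
      (R := -(2 * Real.pi)) (by simp [Real.pi_ne_zero])
  refine ⟨(𝓕 (hf₁m.toLp f₁) : Lp ℂ 2 (volume : Measure ℝ)), Lp.memLp _, fun h h1 h2 => ?_⟩
  have e := lpPairing_fourier (hf₁m.toLp f₁) (h2.toLp h)
  rw [ContinuousLinearMap.lpPairing_eq_integral, ContinuousLinearMap.lpPairing_eq_integral] at e
  simp only [ContinuousLinearMap.mul_apply'] at e
  have e1 : ∫ x, (𝓕 (hf₁m.toLp f₁) : Lp ℂ 2 (volume : Measure ℝ)) x * h x
      = ∫ x, (𝓕 (hf₁m.toLp f₁) : Lp ℂ 2 (volume : Measure ℝ)) x * (h2.toLp h : ℝ → ℂ) x := by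
    apply integral_congr_ae
    filter_upwards [h2.coeFn_toLp] with x hx
    rw [hx]
  have e2 : ∫ x, (hf₁m.toLp f₁ : ℝ → ℂ) x * (𝓕 (h2.toLp h) : Lp ℂ 2 (volume : Measure ℝ)) x
      = ∫ x, f₁ x * 𝓕 h x := by
    apply integral_congr_ae
    filter_upwards [hf₁m.coeFn_toLp, coeFn_fourier_toLp h1 h2] with x hx hx2
    rw [hx, hx2]
  rw [e1, e, e2]
  have e3 := Measure.integral_comp_mul_left (fun τ : ℝ => f τ * timeFourier h τ) (-(2 * Real.pi))
  rw [abs_inv, abs_neg, abs_of_pos hpi] at e3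
  have e4 : ∀ ξ, f₁ ξ * 𝓕 h ξ = (2 * Real.pi : ℝ) *
      (f (-(2 * Real.pi) * ξ) * timeFourier h (-(2 * Real.pi) * ξ)) := by
    intro ξ
    rw [timeFourier_eq, ← mul_assoc (-(2 * Real.pi)⁻¹), neg_mul_neg, inv_mul_cancel₀ hpi.ne',
      one_mul]
    simp only [hf₁]
    ring
  simp_rw [e4]
  rw [integral_const_mul, e3, Complex.real_smul, ← mul_assoc, ← Complex.ofReal_mul,
    mul_inv_cancel₀ hpi.ne', Complex.ofReal_one, one_mul]

end Plancherel

end Bourgain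
end

/-! ### Time localization does not change the function on `(0, T)` -/

noncomputable section

namespace Bourgain

theorem integrable_mul_of_memLp_two {α : Type*} [MeasurableSpace α] {μ : Measure α} {f g : α → ℂ}
    (hf : MemLp f 2 μ) (hg : MemLp g 2 μ) : Integrable (fun t => f t * g t) μ :=
  hf.integrable_mul hg

/-- On `(0, T)` the function `a` is the inverse Fourier transform of `2π f`, in the sense of
distributions. -/
def Represents (T : ℝ) (a f : ℝ → ℂ) : Prop :=
  ∀ h : ℝ → ℂ, ContDiff ℝ ∞ h → HasCompactSupport h → tsupport h ⊆ Ioo 0 T →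
    ∫ t, a t * h t = ∫ τ, f τ * timeFourier h τ

/-- `Represents` tests only with smooth functions, but the product formula needs rough ones. Since
`f` is in `L²`, it has an `L²` dual function, which the smooth tests identify with `a` almost
everywhere on `(0, T)`. -/
theorem Represents.integral_eq {T : ℝ} {a f : ℝ → ℂ} (h : Represents T a f) (ha : MemLp a 2)
    (hf : MemLp f 2) (hfm : Measurable f) {q : ℝ → ℂ} (hq1 : Integrable q) (hq2 : MemLp q 2)
    (hq0 : ∀ t, t ∉ Ioo 0 T → q t = 0) :
    ∫ t, a t * q t = ∫ τ, f τ * timeFourier q τ := by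
  obtain ⟨g, hg, hgq⟩ := exists_dual_timeFourier hf hfm
  rw [← hgq q hq1 hq2]
  have hz : ∀ᵐ t, t ∈ Ioo 0 T → (a - g) t = 0 := by
    refine isOpen_Ioo.ae_eq_zero_of_integral_contDiff_smul_eq_zero
      (((ha.sub hg).locallyIntegrable (by norm_num)).locallyIntegrableOn _) ?_
    intro p hp hpc hps
    have hp₁ : HasCompactSupport (Complex.ofRealCLM ∘ p) := hpc.comp_left rfl
    have hp₂ : ContDiff ℝ ∞ (Complex.ofRealCLM ∘ p) := by fun_prop
    have hpm : MemLp (Complex.ofRealCLM ∘ p) 2 := hp₂.continuous.memLp_of_hasCompactSupport hp₁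
    have e1 := h (Complex.ofRealCLM ∘ p) hp₂ hp₁ ((tsupport_comp_subset rfl p).trans hps)
    have e2 := hgq (Complex.ofRealCLM ∘ p) (hp₂.continuous.integrable_of_hasCompactSupport hp₁) hpm
    have e3 : ∀ t, p t • (a - g) t
        = a t * (Complex.ofRealCLM ∘ p) t - g t * (Complex.ofRealCLM ∘ p) t := by
      intro t; simp; ring
    simp_rw [e3]
    rw [integral_sub (integrable_mul_of_memLp_two ha hpm) (integrable_mul_of_memLp_two hg hpm), e1, e2, sub_self]
  apply integral_congr_ae
  filter_upwards [hz] with t ht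
  by_cases htT : t ∈ Ioo 0 T
  · have := ht htT
    rw [Pi.sub_apply, sub_eq_zero] at this
    rw [this]
  · rw [hq0 t htT, mul_zero, mul_zero]

/-- Frequencies at distance at most `T⁻¹` of `a`. -/
def lowModulation (a T : ℝ) : Set ℝ := {τ | |τ - a| ≤ T⁻¹}

theorem measurableSet_lowModulation (a T : ℝ) : MeasurableSet (lowModulation a T) := by
  unfold lowModulation
  exact measurableSet_le (by fun_prop) measurable_const

/-- Localization in time to the scale `T` of the low modulations of `f`. -/
def cutoffLow (Ψ : ℝ → ℂ) (a T : ℝ) (f : ℝ → ℂ) (τ : ℝ) : ℂ :=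
  ∫ σ, (lowModulation a T).indicator f σ * (T * Ψ (T * (τ - σ)))

/-- Localization in time to the scale `T` of the modulations below `T⁻¹`, leaving the other
modulations unchanged. -/
def cutoffTransform (Ψ : ℝ → ℂ) (a T : ℝ) (f : ℝ → ℂ) (τ : ℝ) : ℂ :=
  (lowModulation a T)ᶜ.indicator f τ + cutoffLow Ψ a T f τ

theorem measurable_cutoffLow {Ψ : ℝ → ℂ} (hΨ : Continuous Ψ) (a T : ℝ) {f : ℝ → ℂ}
    (hf : Measurable f) : Measurable (cutoffLow Ψ a T f) := by
  have hl : Measurable ((lowModulation a T).indicator f) :=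
    hf.indicator (measurableSet_lowModulation a T)
  have : Measurable fun p : ℝ × ℝ =>
      (lowModulation a T).indicator f p.2 * (T * Ψ (T * (p.1 - p.2))) := by fun_prop
  exact this.stronglyMeasurable.integral_prod_right'.measurable

theorem measurable_cutoffTransform {Ψ : ℝ → ℂ} (hΨ : Continuous Ψ) (a T : ℝ) {f : ℝ → ℂ}
    (hf : Measurable f) : Measurable (cutoffTransform Ψ a T f) :=
  (hf.indicator (measurableSet_lowModulation a T).compl).add (measurable_cutoffLow hΨ a T hf)

theorem integrable_bracket_rpow {p : ℝ} (hp : 1 < p) : Integrable fun x : ℝ => bracket x ^ (-p) := by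
  have := integrable_one_add_norm (E := ℝ) (μ := volume) (r := p) (by simpa using hp)
  simpa [bracket, Real.norm_eq_abs] using this

theorem integrable_of_norm_le_bracket {Ψ : ℝ → ℂ} (hΨ : Continuous Ψ) {C : ℝ}
    (hC : ∀ σ, ‖Ψ σ‖ ≤ C * bracket σ ^ (-2 : ℝ)) : Integrable Ψ :=
  ((integrable_bracket_rpow (p := 2) (by norm_num)).const_mul C).mono' hΨ.aestronglyMeasurable
    (Filter.Eventually.of_forall hC)

/-- Convolution with `T Ψ(T ·)` corresponds to multiplication by a function of `t / T` that is `1`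
on `[0, 1]`, hence leaves the transform of a function living on `(0, T)` unchanged. -/
theorem integral_kernel_mul_timeFourier {Ψ : ℝ → ℂ} (hΨ : Integrable Ψ)
    (h1 : ∀ r ∈ Icc (0 : ℝ) 1, ∫ σ : ℝ, Ψ σ * Complex.exp (Complex.I * (σ : ℂ) * (r : ℂ)) = 1)
    {T : ℝ} (hT : 0 < T) {h : ℝ → ℂ} (hh : Integrable h)
    (h0 : ∀ t, t ∉ Ioo 0 T → h t = 0) (σ : ℝ) :
    ∫ τ, (T * Ψ (T * (τ - σ))) * timeFourier h τ = timeFourier h σ := by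
  have hk : Integrable fun τ : ℝ => (T : ℂ) * Ψ (T * (τ - σ)) :=
    ((hΨ.comp_mul_left' hT.ne').comp_sub_right σ).const_mul _
  have hin : ∀ t ∈ Ioo 0 T, ∫ τ : ℝ, (T * Ψ (T * (τ - σ))) *
      Complex.exp (Complex.I * (τ : ℂ) * (t : ℂ)) = Complex.exp (Complex.I * (σ : ℂ) * (t : ℂ)) := by
    intro t ht
    rw [← integral_add_right_eq_self _ σ]
    have e1 : ∀ x : ℝ, (T * Ψ (T * (x + σ - σ))) *
        Complex.exp (Complex.I * ((x + σ : ℝ) : ℂ) * (t : ℂ)) =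
        (T * Complex.exp (Complex.I * (σ : ℂ) * (t : ℂ))) * (Ψ (T * x) *
          Complex.exp (Complex.I * ((T * x : ℝ) : ℂ) * ((t / T : ℝ) : ℂ))) := by
      intro x
      have hTc : (T : ℂ) ≠ 0 := by exact_mod_cast hT.ne'
      rw [add_sub_cancel_right]
      have : Complex.exp (Complex.I * ((x + σ : ℝ) : ℂ) * (t : ℂ))
          = Complex.exp (Complex.I * (σ : ℂ) * (t : ℂ)) *
            Complex.exp (Complex.I * ((T * x : ℝ) : ℂ) * ((t / T : ℝ) : ℂ)) := by
        rw [← Complex.exp_add]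
        congr 1
        push_cast
        field_simp
        ring
      rw [this]
      ring
    simp_rw [e1]
    rw [integral_const_mul, Measure.integral_comp_mul_left (fun y : ℝ => Ψ y *
      Complex.exp (Complex.I * (y : ℂ) * ((t / T : ℝ) : ℂ))) T,
      h1 (t / T) ⟨(div_pos ht.1 hT).le, (div_le_one hT).2 ht.2.le⟩, abs_of_pos (inv_pos.2 hT),
      Complex.real_smul, mul_one, Complex.ofReal_inv]
    have hTc : (T : ℂ) ≠ 0 := by exact_mod_cast hT.ne'
    field_simp
  have hprod : Integrable (fun p : ℝ × ℝ => ((T : ℂ) * Ψ (T * (p.1 - σ))) *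
      (h p.2 * Complex.exp (Complex.I * (p.1 : ℂ) * (p.2 : ℂ)))) (volume.prod volume) := by
    have := hk.mul_prod hh
    refine (this.bdd_mul (c := 1) (f := fun p : ℝ × ℝ =>
      Complex.exp (Complex.I * (p.1 : ℂ) * (p.2 : ℂ))) (by fun_prop)
      (Filter.Eventually.of_forall fun p => (norm_exp_I_mul_mul _ _).le)).congr
      (Filter.Eventually.of_forall fun p => ?_)
    simp only
    ring
  unfold timeFourier
  simp_rw [← integral_const_mul]
  rw [integral_integral_swap hprod]
  refine integral_congr_ae (Filter.Eventually.of_forall fun t => ?_)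
  simp only
  by_cases ht : t ∈ Ioo 0 T
  · rw [← hin t ht, ← integral_const_mul]
    refine integral_congr_ae (Filter.Eventually.of_forall fun τ => ?_)
    simp only
    ring
  · simp [h0 t ht]

theorem integrable_indicator_lowModulation {f : ℝ → ℂ} (hf : MemLp f 2) (a T : ℝ) :
    Integrable ((lowModulation a T).indicator f) := by
  have hs := measurableSet_lowModulation a T
  rw [integrable_indicator_iff hs]
  have : IsFiniteMeasure (volume.restrict (lowModulation a T)) := by
    refine ⟨?_⟩
    rw [Measure.restrict_apply_univ]
    have : lowModulation a T = Metric.closedBall a T⁻¹ := by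
      ext x; simp [lowModulation, Real.dist_eq]
    rw [this]
    exact measure_closedBall_lt_top
  exact (hf.restrict _).integrable (by norm_num)

/-- Fubini moves the kernel from the low part of `f` to the transform of the test function, where it
acts as the identity. The truncation to low modulations makes that part integrable, so that Fubini
applies. -/
theorem Represents.cutoffTransform {Ψ : ℝ → ℂ} (hΨ : Integrable Ψ)
    (h1 : ∀ r ∈ Icc (0 : ℝ) 1, ∫ σ : ℝ, Ψ σ * Complex.exp (Complex.I * (σ : ℂ) * (r : ℂ)) = 1)
    {T : ℝ} (hT : 0 < T) (φ : ℝ) {a f : ℝ → ℂ} (h : Represents T a f) (hf : MemLp f 2) :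
    Represents T a (cutoffTransform Ψ φ T f) := by
  intro q hq hqc hqs
  rw [h q hq hqc hqs]
  have hq1 : Integrable q := hq.continuous.integrable_of_hasCompactSupport hqc
  have hq2 : MemLp q 2 := hq.continuous.memLp_of_hasCompactSupport hqc
  have hq0 : ∀ t, t ∉ Ioo 0 T → q t = 0 := fun t ht =>
    image_eq_zero_of_notMem_tsupport fun hh => ht (hqs hh)
  have hF2 := memLp_two_timeFourier hq1 hq2
  have hs := measurableSet_lowModulation φ T
  have hlow := integrable_indicator_lowModulation hf φ T
  have hhigh : MemLp ((lowModulation φ T)ᶜ.indicator f) 2 := hf.indicator hs.compl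
  have hlow2 : MemLp ((lowModulation φ T).indicator f) 2 := hf.indicator hs
  have hk : Integrable fun x : ℝ => (T : ℂ) * Ψ (T * x) := (hΨ.comp_mul_left' hT.ne').const_mul _
  have hprod : Integrable (fun p : ℝ × ℝ => (lowModulation φ T).indicator f p.2 *
      (T * Ψ (T * (p.1 - p.2))) * timeFourier q p.1) (volume.prod volume) := by
    have := hlow.convolution_integrand (ContinuousLinearMap.mul ℂ ℂ) hk
    refine (this.bdd_mul (c := ∫ t, ‖q t‖) (f := fun p : ℝ × ℝ => timeFourier q p.1)
      ?_ ?_).congr ?_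
    · exact ((continuous_timeFourier hq1).comp continuous_fst).aestronglyMeasurable
    · exact Filter.Eventually.of_forall fun p => norm_timeFourier_le q p.1
    · refine Filter.Eventually.of_forall fun p => ?_
      simp only [ContinuousLinearMap.mul_apply']
      ring
  have e1 : ∫ τ, cutoffLow Ψ φ T f τ * timeFourier q τ
      = ∫ σ, (lowModulation φ T).indicator f σ * timeFourier q σ := by
    unfold cutoffLow
    simp_rw [← integral_mul_const]
    rw [integral_integral_swap hprod]
    refine integral_congr_ae (Filter.Eventually.of_forall fun σ => ?_)
    simp only
    rw [← integral_kernel_mul_timeFourier hΨ h1 hT hq1 hq0 σ, ← integral_const_mul]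
    refine integral_congr_ae (Filter.Eventually.of_forall fun τ => ?_)
    simp only
    ring
  have hint : Integrable fun τ => cutoffLow Ψ φ T f τ * timeFourier q τ := by
    unfold cutoffLow
    simp_rw [← integral_mul_const]
    exact hprod.integral_prod_left
  unfold Bourgain.cutoffTransform
  simp_rw [add_mul]
  rw [integral_add (integrable_mul_of_memLp_two hhigh hF2) hint, e1,
    ← integral_add (integrable_mul_of_memLp_two hhigh hF2) (integrable_mul_of_memLp_two hlow2 hF2)]
  refine integral_congr_ae (Filter.Eventually.of_forall fun σ => ?_)
  simp only
  rw [← add_mul, add_comm, indicator_self_add_compl_apply]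

end Bourgain
end

/-! ### The power of `T` gained by the localization -/

noncomputable section

namespace Bourgain

theorem lintegral_mul_sq_le_weighted {α : Type*} [MeasurableSpace α] (μ : Measure α)
    {k g : α → ℝ≥0∞} (hk : Measurable k) (hg : Measurable g) :
    (∫⁻ x, k x * g x ∂μ) ^ 2 ≤ (∫⁻ x, g x ∂μ) * ∫⁻ x, k x ^ 2 * g x ∂μ := by
  have hs : ∀ x, (g x ^ (1 / 2 : ℝ)) ^ 2 = g x := by
    intro x
    rw [← ENNReal.rpow_natCast, ← ENNReal.rpow_mul]; norm_num
  have := lintegral_mul_sq_le μ (f := fun x => g x ^ (1 / 2 : ℝ))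
    (g := fun x => k x * g x ^ (1 / 2 : ℝ)) (by fun_prop) (by fun_prop)
  simp_rw [mul_pow, hs] at this
  refine le_trans (le_of_eq ?_) this
  congr 2 with x
  rw [mul_left_comm, ← sq, hs]

theorem lintegral_bracket_mul_sq {T : ℝ} (hT : 0 < T) :
    ∫⁻ x : ℝ, ENNReal.ofReal (bracket (T * x) ^ (-1 : ℝ)) ^ 2
      = ENNReal.ofReal T⁻¹ * ∫⁻ x : ℝ, ENNReal.ofReal (bracket x ^ (-2 : ℝ)) := by
  have h0 : ∀ r p : ℝ, 0 ≤ bracket r ^ p := fun r p => Real.rpow_nonneg (bracket_pos r).le p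
  have hi := integrable_bracket_rpow (p := 2) (by norm_num)
  have e : ∀ x : ℝ, ENNReal.ofReal (bracket (T * x) ^ (-1 : ℝ)) ^ 2
      = ENNReal.ofReal (bracket (T * x) ^ (-2 : ℝ)) := by
    intro x
    rw [← ENNReal.ofReal_pow (h0 _ _), ← Real.rpow_natCast, ← Real.rpow_mul (bracket_pos _).le]
    norm_num
  simp_rw [e]
  rw [← ofReal_integral_eq_lintegral_ofReal hi (Filter.Eventually.of_forall fun x => h0 _ _),
    ← ofReal_integral_eq_lintegral_ofReal (hi.comp_mul_left' hT.ne')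
      (Filter.Eventually.of_forall fun x => h0 _ _),
    Measure.integral_comp_mul_left (fun x => bracket x ^ (-2 : ℝ)) T, abs_of_pos (inv_pos.2 hT),
    smul_eq_mul, ENNReal.ofReal_mul (inv_pos.2 hT).le]

/-- For `σ` within `T⁻¹` of `a`, the distance of `τ` from `a` is at most `T⁻¹` plus the distance
from `σ`: the decay of the kernel can absorb the modulation weight, at the cost of powers of `T⁻¹`.
-/
theorem bracket_le_of_mem_lowModulation {a T σ : ℝ} (hT : 0 < T) (hσ : σ ∈ lowModulation a T)
    (hT1 : T < 1) (τ : ℝ) : bracket (τ - a) ≤ 2 / T * bracket (T * (τ - σ)) := by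
  have h1 : |σ - a| ≤ T⁻¹ := hσ
  have h2 := abs_add_le (τ - σ) (σ - a)
  rw [sub_add_sub_cancel] at h2
  have h3 : 1 ≤ T⁻¹ := (one_le_inv₀ hT).2 hT1.le
  have e : 2 / T * bracket (T * (τ - σ)) = 2 * T⁻¹ + 2 * |τ - σ| := by
    unfold bracket
    rw [abs_mul, abs_of_pos hT]
    field_simp
  rw [e]
  unfold bracket
  linarith [abs_nonneg (τ - σ)]

/-- The weight `⟨·⟩^(1/2)` just fails to bound the `L¹` norm. Low modulations have bracket at most
`2 / T`, so the missing exponent `1/64` costs `(2 / T)^(1/64)`. This is the source of the loss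
`1/64` in the powers of `T`. -/
theorem lintegral_indicator_low_sq_le {a T : ℝ} (hT : 0 < T) (hT1 : T < 1) {f : ℝ → ℂ}
    (hf : Measurable f) :
    (∫⁻ τ, ‖(lowModulation a T).indicator f τ‖ₑ) ^ 2 ≤
      ENNReal.ofReal ((2 / T) ^ (1 / 32 : ℝ)) *
        (∫⁻ x : ℝ, ENNReal.ofReal (bracket x ^ (-(33 / 32) : ℝ))) *
        ∫⁻ τ, (ENNReal.ofReal (bracket (τ - a) ^ (1 / 2 : ℝ)) * ‖f τ‖ₑ) ^ 2 := by
  have h0 : ∀ r p : ℝ, 0 ≤ bracket r ^ p := fun r p => Real.rpow_nonneg (bracket_pos r).le p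
  have hpt : ∀ τ, ‖(lowModulation a T).indicator f τ‖ₑ ≤
      ENNReal.ofReal ((2 / T) ^ (1 / 64 : ℝ) * bracket (τ - a) ^ (-(33 / 64) : ℝ)) *
        (ENNReal.ofReal (bracket (τ - a) ^ (1 / 2 : ℝ)) * ‖f τ‖ₑ) := by
    intro τ
    by_cases hτ : τ ∈ lowModulation a T
    · rw [indicator_of_mem hτ, ← mul_assoc, ← ENNReal.ofReal_mul (by have := h0 (τ - a) (-(33 / 64)); positivity)]
      refine le_mul_of_one_le_left zero_le ?_
      rw [ENNReal.one_le_ofReal, mul_assoc, ← Real.rpow_add (bracket_pos _)]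
      have h1 := bracket_le_of_mem_lowModulation hT hτ hT1 τ
      rw [sub_self, mul_zero] at h1
      have h2 : bracket 0 = 1 := by simp [bracket]
      rw [h2, mul_one] at h1
      norm_num
      rw [Real.rpow_neg (bracket_pos _).le, ← div_eq_mul_inv,
        one_le_div (Real.rpow_pos_of_pos (bracket_pos _) _)]
      exact Real.rpow_le_rpow (bracket_pos _).le h1 (by norm_num)
    · rw [indicator_of_notMem hτ]; simp
  refine (pow_le_pow_left' (lintegral_mono hpt) 2).trans ?_
  refine (lintegral_mul_sq_le _ (by fun_prop) (by fun_prop)).trans (le_of_eq ?_)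
  congr 1
  have e : ∀ τ, ENNReal.ofReal ((2 / T) ^ (1 / 64 : ℝ) * bracket (τ - a) ^ (-(33 / 64) : ℝ)) ^ 2
      = ENNReal.ofReal ((2 / T) ^ (1 / 32 : ℝ)) *
        ENNReal.ofReal (bracket (τ - a) ^ (-(33 / 32) : ℝ)) := by
    intro τ
    have h1 := h0 (τ - a) (-(33 / 64))
    rw [← ENNReal.ofReal_pow (by positivity), ← ENNReal.ofReal_mul (by positivity), mul_pow,
      ← Real.rpow_natCast, ← Real.rpow_natCast, ← Real.rpow_mul (bracket_pos _).le,
      ← Real.rpow_mul (by positivity)]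
    norm_num
  simp_rw [e]
  rw [lintegral_const_mul _ (by fun_prop), lintegral_sub_right_eq_self
    (fun τ => ENNReal.ofReal (bracket τ ^ (-(33 / 32) : ℝ))) a]

/-- Of the two powers of decay of `Ψ`, one absorbs `⟨T(τ - σ)⟩^c`; the other is kept for square
integrability in `τ`. -/
theorem weight_mul_cutoffLow_le {Ψ : ℝ → ℂ} {C : ℝ} (hC : 0 < C)
    (hΨ : ∀ σ, ‖Ψ σ‖ ≤ C * bracket σ ^ (-2 : ℝ)) {a T c : ℝ} (hT : 0 < T) (hT1 : T < 1)
    (hc0 : 0 ≤ c) (hc1 : c ≤ 1 / 2) {f : ℝ → ℂ} (hf : Measurable f) (τ : ℝ) :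
    ENNReal.ofReal (bracket (τ - a) ^ c) * ‖cutoffLow Ψ a T f τ‖ₑ ≤
      ENNReal.ofReal (C * (2 / T) ^ c * T) *
        ∫⁻ σ, ENNReal.ofReal (bracket (T * (τ - σ)) ^ (-1 : ℝ)) *
          ‖(lowModulation a T).indicator f σ‖ₑ := by
  have hl : Measurable ((lowModulation a T).indicator f) :=
    hf.indicator (measurableSet_lowModulation a T)
  calc _ ≤ ENNReal.ofReal (bracket (τ - a) ^ c) *
        ∫⁻ σ, ‖(lowModulation a T).indicator f σ‖ₑ *
          ENNReal.ofReal (T * (C * bracket (T * (τ - σ)) ^ (-2 : ℝ))) := by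
        gcongr
        refine (enorm_integral_le_lintegral_enorm _).trans (lintegral_mono fun σ => ?_)
        rw [enorm_mul]
        gcongr
        rw [← ofReal_norm]
        apply ENNReal.ofReal_le_ofReal
        rw [norm_mul, Complex.norm_real, Real.norm_eq_abs, abs_of_pos hT]
        gcongr
        exact hΨ _
    _ = ∫⁻ σ, ENNReal.ofReal (bracket (τ - a) ^ c) * (‖(lowModulation a T).indicator f σ‖ₑ *
          ENNReal.ofReal (T * (C * bracket (T * (τ - σ)) ^ (-2 : ℝ)))) := by
        rw [lintegral_const_mul _ (by fun_prop)]
    _ ≤ ∫⁻ σ, ENNReal.ofReal (C * (2 / T) ^ c * T) *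
          (ENNReal.ofReal (bracket (T * (τ - σ)) ^ (-1 : ℝ)) *
          ‖(lowModulation a T).indicator f σ‖ₑ) := by
        refine lintegral_mono fun σ => ?_
        by_cases hσ : σ ∈ lowModulation a T
        · have b1 := bracket_pos (τ - a)
          have b2 := bracket_pos (T * (τ - σ))
          rw [mul_left_comm, ← ENNReal.ofReal_mul (by positivity), mul_comm,
            ← mul_assoc (ENNReal.ofReal (C * (2 / T) ^ c * T)), ← ENNReal.ofReal_mul (by positivity)]
          gcongr ENNReal.ofReal ?_ * _
          have h1 := bracket_le_of_mem_lowModulation hT hσ hT1 τ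
          set B := bracket (T * (τ - σ))
          have h2 : bracket (τ - a) ^ c ≤ (2 / T) ^ c * B ^ c := by
            rw [← Real.mul_rpow (by positivity) b2.le]
            exact Real.rpow_le_rpow b1.le h1 hc0
          have h3 : B ^ c * B ^ (-2 : ℝ) ≤ B ^ (-1 : ℝ) := by
            rw [← Real.rpow_add b2]
            exact Real.rpow_le_rpow_of_exponent_le (one_le_bracket _) (by linarith)
          calc bracket (τ - a) ^ c * (T * (C * B ^ (-2 : ℝ)))
              ≤ ((2 / T) ^ c * B ^ c) * (T * (C * B ^ (-2 : ℝ))) := by gcongr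
            _ = C * (2 / T) ^ c * T * (B ^ c * B ^ (-2 : ℝ)) := by ring
            _ ≤ _ := by gcongr
        · simp [indicator_of_notMem hσ]
    _ = _ := by rw [lintegral_const_mul _ (by fun_prop)]

/-- Young's inequality `L² * L¹ → L²`; the square of the kernel integrates to a multiple of `T⁻¹`.
-/
theorem lintegral_conv_kernel_sq_le {T : ℝ} (hT : 0 < T) {g : ℝ → ℝ≥0∞} (hg : Measurable g) :
    ∫⁻ τ, (∫⁻ σ, ENNReal.ofReal (bracket (T * (τ - σ)) ^ (-1 : ℝ)) * g σ) ^ 2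
      ≤ ENNReal.ofReal T⁻¹ * (∫⁻ x : ℝ, ENNReal.ofReal (bracket x ^ (-2 : ℝ))) *
        (∫⁻ σ, g σ) ^ 2 := by
  calc _ ≤ ∫⁻ τ, (∫⁻ σ, g σ) *
        ∫⁻ σ, ENNReal.ofReal (bracket (T * (τ - σ)) ^ (-1 : ℝ)) ^ 2 * g σ :=
        lintegral_mono fun τ => lintegral_mul_sq_le_weighted _ (by fun_prop) hg
    _ = _ := by
        rw [lintegral_const_mul _ (by
          refine Measurable.lintegral_prod_right ?_
          fun_prop), lintegral_lintegral_swap (by fun_prop)]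
        have : ∀ σ, ∫⁻ τ, ENNReal.ofReal (bracket (T * (τ - σ)) ^ (-1 : ℝ)) ^ 2 * g σ
            = ENNReal.ofReal T⁻¹ * (∫⁻ x : ℝ, ENNReal.ofReal (bracket x ^ (-2 : ℝ))) * g σ := by
          intro σ
          rw [lintegral_mul_const _ (by fun_prop), lintegral_sub_right_eq_self
            (fun τ => ENNReal.ofReal (bracket (T * τ) ^ (-1 : ℝ)) ^ 2) σ,
            lintegral_bracket_mul_sq hT]
        simp_rw [this]
        rw [lintegral_const_mul _ hg]
        ring

/-- The constant in `lintegral_cutoffTransform_sq_le`. -/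
def cutoffConst (C : ℝ) : ℝ≥0∞ :=
  3 * (1 + ENNReal.ofReal (4 * C ^ 2) * (∫⁻ x : ℝ, ENNReal.ofReal (bracket x ^ (-2 : ℝ))) *
    ∫⁻ x : ℝ, ENNReal.ofReal (bracket x ^ (-(33 / 32) : ℝ)))

theorem cutoffConst_lt_top (C : ℝ) : cutoffConst C < ⊤ := by
  unfold cutoffConst
  exact ENNReal.mul_lt_top (by simp) (ENNReal.add_lt_top.2 ⟨by simp, ENNReal.mul_lt_top
    (ENNReal.mul_lt_top ENNReal.ofReal_lt_top (lintegral_bracket_rpow_lt_top (by norm_num)))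
    (lintegral_bracket_rpow_lt_top (by norm_num))⟩)

/-- High modulations exceed `T⁻¹`, so lowering the exponent from `1/2` to `c` gains `T^(1-2c)`. For
low ones the kernel contributes `T² T⁻¹`, its weight `T^(-2c)`, and the passage to `L¹` costs
`T^(-1/32)`. -/
theorem lintegral_cutoffTransform_sq_le {Ψ : ℝ → ℂ} {C : ℝ} (hC : 0 < C) (hΨc : Continuous Ψ)
    (hΨ : ∀ σ, ‖Ψ σ‖ ≤ C * bracket σ ^ (-2 : ℝ)) {a T c : ℝ} (hT : 0 < T) (hT1 : T < 1)
    (hc0 : 0 ≤ c) (hc1 : c ≤ 1 / 2) {f : ℝ → ℂ} (hf : Measurable f) :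
    ∫⁻ τ, (ENNReal.ofReal (bracket (τ - a) ^ c) * ‖cutoffTransform Ψ a T f τ‖ₑ) ^ 2 ≤
      cutoffConst C * ENNReal.ofReal (T ^ (1 - 2 * c - 1 / 32)) *
        ∫⁻ τ, (ENNReal.ofReal (bracket (τ - a) ^ (1 / 2 : ℝ)) * ‖f τ‖ₑ) ^ 2 := by
  set N := ∫⁻ τ, (ENNReal.ofReal (bracket (τ - a) ^ (1 / 2 : ℝ)) * ‖f τ‖ₑ) ^ 2 with hN
  set J₂ := ∫⁻ x : ℝ, ENNReal.ofReal (bracket x ^ (-2 : ℝ)) with hJ₂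
  set J := ∫⁻ x : ℝ, ENNReal.ofReal (bracket x ^ (-(33 / 32) : ℝ)) with hJ
  set R := ENNReal.ofReal (T ^ (1 - 2 * c - 1 / 32)) with hR
  have hlm : Measurable ((lowModulation a T).indicator f) :=
    hf.indicator (measurableSet_lowModulation a T)
  have hhm : Measurable ((lowModulation a T)ᶜ.indicator f) :=
    hf.indicator (measurableSet_lowModulation a T).compl
  have hcm := measurable_cutoffLow hΨc a T hf
  have high : ∫⁻ τ, (ENNReal.ofReal (bracket (τ - a) ^ c) *
      ‖(lowModulation a T)ᶜ.indicator f τ‖ₑ) ^ 2 ≤ R * N := by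
    rw [hN, ← lintegral_const_mul _ (by fun_prop)]
    refine lintegral_mono fun τ => ?_
    by_cases hτ : τ ∈ lowModulation a T
    · rw [indicator_of_notMem (by simpa using hτ)]; simp
    · rw [indicator_of_mem (by simpa using hτ)]
      have b := bracket_pos (τ - a)
      rw [mul_pow, mul_pow, ← mul_assoc]
      gcongr ?_ * _
      rw [← ENNReal.ofReal_pow (by positivity), ← ENNReal.ofReal_pow (by positivity), hR,
        ← ENNReal.ofReal_mul (by positivity)]
      apply ENNReal.ofReal_le_ofReal
      rw [← Real.rpow_natCast, ← Real.rpow_natCast, ← Real.rpow_mul b.le, ← Real.rpow_mul b.le]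
      have h1 : T⁻¹ ≤ bracket (τ - a) := by
        have : T⁻¹ < |τ - a| := by simpa [lowModulation] using hτ
        unfold bracket; linarith
      have h2 : bracket (τ - a) ^ (-(1 - 2 * c)) ≤ T ^ (1 - 2 * c) := by
        rw [← inv_inv T, Real.inv_rpow (by positivity), ← Real.rpow_neg (by positivity)]
        exact Real.rpow_le_rpow_of_nonpos (by positivity) h1 (by linarith)
      calc bracket (τ - a) ^ (c * ((2 : ℕ) : ℝ))
          = bracket (τ - a) ^ (-(1 - 2 * c)) * bracket (τ - a) ^ (1 / 2 * ((2 : ℕ) : ℝ)) := by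
            rw [← Real.rpow_add b]; congr 1; push_cast; ring
        _ ≤ T ^ (1 - 2 * c) * bracket (τ - a) ^ (1 / 2 * ((2 : ℕ) : ℝ)) := by gcongr
        _ ≤ _ := by
            gcongr ?_ * _
            exact Real.rpow_le_rpow_of_exponent_ge hT hT1.le (by linarith)
  have low : ∫⁻ τ, (ENNReal.ofReal (bracket (τ - a) ^ c) * ‖cutoffLow Ψ a T f τ‖ₑ) ^ 2 ≤
      ENNReal.ofReal (4 * C ^ 2) * J₂ * J * (R * N) := by
    have hgm : Measurable fun σ => ‖(lowModulation a T).indicator f σ‖ₑ := by fun_prop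
    calc _ ≤ ∫⁻ τ, ENNReal.ofReal (C * (2 / T) ^ c * T) ^ 2 *
          (∫⁻ σ, ENNReal.ofReal (bracket (T * (τ - σ)) ^ (-1 : ℝ)) *
          ‖(lowModulation a T).indicator f σ‖ₑ) ^ 2 := by
          refine lintegral_mono fun τ => ?_
          rw [← mul_pow]
          exact pow_le_pow_left' (weight_mul_cutoffLow_le hC hΨ hT hT1 hc0 hc1 hf τ) 2
      _ = ENNReal.ofReal (C * (2 / T) ^ c * T) ^ 2 *
          ∫⁻ τ, (∫⁻ σ, ENNReal.ofReal (bracket (T * (τ - σ)) ^ (-1 : ℝ)) *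
          ‖(lowModulation a T).indicator f σ‖ₑ) ^ 2 := by
          rw [lintegral_const_mul _ (by
            refine Measurable.pow_const (Measurable.lintegral_prod_right ?_) 2
            fun_prop)]
      _ ≤ ENNReal.ofReal (C * (2 / T) ^ c * T) ^ 2 * (ENNReal.ofReal T⁻¹ * J₂ *
          (ENNReal.ofReal ((2 / T) ^ (1 / 32 : ℝ)) * J * N)) := by
          gcongr
          refine (lintegral_conv_kernel_sq_le hT hgm).trans ?_
          gcongr
          exact lintegral_indicator_low_sq_le hT hT1 hf
      _ = (ENNReal.ofReal (C * (2 / T) ^ c * T) ^ 2 * ENNReal.ofReal T⁻¹ *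
          ENNReal.ofReal ((2 / T) ^ (1 / 32 : ℝ))) * (J₂ * J * N) := by ring
      _ ≤ (ENNReal.ofReal (4 * C ^ 2) * R) * (J₂ * J * N) := by
          gcongr ?_ * _
          rw [← ENNReal.ofReal_pow (by positivity), ← ENNReal.ofReal_mul (by positivity),
            ← ENNReal.ofReal_mul (by positivity), hR, ← ENNReal.ofReal_mul (by positivity)]
          apply ENNReal.ofReal_le_ofReal
          have e1 : T ^ (1 - 2 * c - 1 / 32) = T * (T⁻¹ ^ c) ^ 2 * T⁻¹ ^ (1 / 32 : ℝ) := by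
            rw [Real.inv_rpow hT.le, Real.inv_rpow hT.le, ← Real.rpow_neg hT.le,
              ← Real.rpow_neg hT.le, ← Real.rpow_natCast, ← Real.rpow_mul hT.le]
            nth_rewrite 2 [← Real.rpow_one T]
            rw [← Real.rpow_add hT, ← Real.rpow_add hT]
            congr 1
            push_cast
            ring
          have e2 : ∀ p : ℝ, (2 / T) ^ p = 2 ^ p * T⁻¹ ^ p := fun p => by
            rw [div_eq_mul_inv, Real.mul_rpow (by norm_num) (by positivity)]
          have e3 : ((2 : ℝ) ^ c) ^ 2 * 2 ^ (1 / 32 : ℝ) ≤ 4 := by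
            rw [← Real.rpow_natCast, ← Real.rpow_mul (by norm_num), ← Real.rpow_add (by norm_num)]
            calc (2 : ℝ) ^ (c * ((2 : ℕ) : ℝ) + 1 / 32) ≤ 2 ^ (2 : ℝ) := by
                  apply Real.rpow_le_rpow_of_exponent_le (by norm_num)
                  push_cast
                  linarith
              _ = 4 := by norm_num
          rw [e1, e2, e2]
          calc (C * (2 ^ c * T⁻¹ ^ c) * T) ^ 2 * T⁻¹ * (2 ^ (1 / 32 : ℝ) * T⁻¹ ^ (1 / 32 : ℝ))
              = ((2 : ℝ) ^ c) ^ 2 * 2 ^ (1 / 32 : ℝ) * (C ^ 2 *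
                (T * (T⁻¹ ^ c) ^ 2 * T⁻¹ ^ (1 / 32 : ℝ)) * (T * T⁻¹)) := by ring
            _ ≤ 4 * (C ^ 2 * (T * (T⁻¹ ^ c) ^ 2 * T⁻¹ ^ (1 / 32 : ℝ)) * (T * T⁻¹)) := by
                gcongr
            _ = _ := by rw [mul_inv_cancel₀ hT.ne']; ring
      _ = _ := by ring
  have hpt : ∀ τ, (ENNReal.ofReal (bracket (τ - a) ^ c) * ‖cutoffTransform Ψ a T f τ‖ₑ) ^ 2 ≤
      3 * ((ENNReal.ofReal (bracket (τ - a) ^ c) * ‖(lowModulation a T)ᶜ.indicator f τ‖ₑ) ^ 2 +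
        (ENNReal.ofReal (bracket (τ - a) ^ c) * ‖cutoffLow Ψ a T f τ‖ₑ) ^ 2) := by
    intro τ
    have h1 := ennreal_add_sq_le
      (ENNReal.ofReal (bracket (τ - a) ^ c) * ‖(lowModulation a T)ᶜ.indicator f τ‖ₑ)
      (ENNReal.ofReal (bracket (τ - a) ^ c) * ‖cutoffLow Ψ a T f τ‖ₑ) 0
    rw [add_zero, ← mul_add, zero_pow (by norm_num), add_zero] at h1
    refine le_trans ?_ h1
    gcongr
    exact enorm_add_le _ _
  refine (lintegral_mono hpt).trans ?_
  rw [lintegral_const_mul _ (by fun_prop), lintegral_add_left (by fun_prop)]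
  calc _ ≤ 3 * (R * N + ENNReal.ofReal (4 * C ^ 2) * J₂ * J * (R * N)) := by gcongr
    _ = _ := by rw [cutoffConst]; ring

/-- The modified extension: no zero mode, and low modulations localized in time. -/
def modifiedExtension (Ψ : ℝ → ℂ) (β γ T : ℝ) (F : ℤ → ℝ → ℂ) (k : ℤ) : ℝ → ℂ :=
  if k = 0 then 0 else cutoffTransform Ψ (phase β γ k) T (F k)

theorem measurable_modifiedExtension {Ψ : ℝ → ℂ} (hΨ : Continuous Ψ) (β γ T : ℝ) {F : ℤ → ℝ → ℂ}
    (hF : ∀ k, Measurable (F k)) (k : ℤ) : Measurable (modifiedExtension Ψ β γ T F k) := by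
  unfold modifiedExtension
  split_ifs
  · exact measurable_zero
  · exact measurable_cutoffTransform hΨ _ _ (hF k)

theorem normX_modifiedExtension_le {Ψ : ℝ → ℂ} {C : ℝ} (hC : 0 < C) (hΨc : Continuous Ψ)
    (hΨ : ∀ σ, ‖Ψ σ‖ ≤ C * bracket σ ^ (-2 : ℝ)) (β γ s : ℝ) {T c : ℝ} (hT : 0 < T) (hT1 : T < 1)
    (hc0 : 0 ≤ c) (hc1 : c ≤ 1 / 2) {F : ℤ → ℝ → ℂ} (hF : ∀ k, Measurable (F k)) :
    normX β γ s c (modifiedExtension Ψ β γ T F) ≤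
      cutoffConst C ^ (1 / 2 : ℝ) * ENNReal.ofReal (T ^ (1 / 2 - c - 1 / 64)) *
        normX β γ s (1 / 2) F := by
  have hTp : ENNReal.ofReal (T ^ (1 / 2 - c - 1 / 64))
      = ENNReal.ofReal (T ^ (1 - 2 * c - 1 / 32)) ^ (1 / 2 : ℝ) := by
    rw [ENNReal.ofReal_rpow_of_nonneg (by positivity) (by norm_num), ← Real.rpow_mul hT.le]
    congr 2
    ring
  have hsplit : ∀ (b : ℝ) (k : ℤ) (g : ℝ → ℂ), Measurable g → ∫⁻ τ : ℝ,
      (ENNReal.ofReal (bracket k ^ s * bracket (τ - phase β γ k) ^ b) * ‖g τ‖ₑ) ^ 2 =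
      ENNReal.ofReal (bracket k ^ s) ^ 2 * ∫⁻ τ : ℝ,
        (ENNReal.ofReal (bracket (τ - phase β γ k) ^ b) * ‖g τ‖ₑ) ^ 2 := by
    intro b k g hg
    rw [← lintegral_const_mul _ (by fun_prop)]
    refine lintegral_congr fun τ => ?_
    rw [ENNReal.ofReal_mul (Real.rpow_nonneg (bracket_pos _).le _)]
    ring
  unfold normX
  rw [hTp, ← ENNReal.mul_rpow_of_nonneg _ _ (by norm_num),
    ← ENNReal.mul_rpow_of_nonneg _ _ (by norm_num)]
  gcongr
  rw [← ENNReal.tsum_mul_left]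
  refine ENNReal.tsum_le_tsum fun k => ?_
  rw [hsplit _ _ _ (hF k), hsplit _ _ _ (measurable_modifiedExtension hΨc β γ T hF k), mul_left_comm]
  gcongr
  unfold modifiedExtension
  split_ifs
  · simp
  · exact lintegral_cutoffTransform_sq_le hC hΨc hΨ hT hT1 hc0 hc1 (hF k)

end Bourgain
end

/-! ### Parseval's identity in time and space -/

noncomputable section

namespace Bourgain

open scoped FourierTransform ComplexConjugate

theorem eLpNorm_two_sq {α E : Type*} [MeasurableSpace α] [NormedAddCommGroup E] (μ : Measure α)
    (f : α → E) : eLpNorm f 2 μ ^ 2 = ∫⁻ x, ‖f x‖ₑ ^ 2 ∂μ := by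
  have := eLpNorm_nnreal_pow_eq_lintegral (f := f) (μ := μ) (p := 2) (by norm_num)
  simpa using this

theorem memLp_two_of_lintegral_lt_top {α E : Type*} [MeasurableSpace α] [NormedAddCommGroup E]
    {μ : Measure α} {f : α → E} (hf : AEStronglyMeasurable f μ)
    (h : ∫⁻ x, ‖f x‖ₑ ^ 2 ∂μ < ⊤) : MemLp f 2 μ := by
  refine ⟨hf, ?_⟩
  rw [← eLpNorm_two_sq] at h
  by_contra hc
  rw [not_lt, top_le_iff] at hc
  rw [hc] at h
  simp at h

theorem lintegral_sq_lt_top_of_memLp_two {α E : Type*} [MeasurableSpace α] [NormedAddCommGroup E]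
    {μ : Measure α} {f : α → E} (hf : MemLp f 2 μ) : ∫⁻ x, ‖f x‖ₑ ^ 2 ∂μ < ⊤ := by
  rw [← eLpNorm_two_sq]
  exact ENNReal.pow_lt_top hf.2

/-- Plancherel's identity for `timeFourier`, as an inequality. -/
theorem lintegral_timeFourier_sq_le {h : ℝ → ℂ} (h1 : Integrable h) (h2 : MemLp h 2) :
    ∫⁻ τ, ‖timeFourier h τ‖ₑ ^ 2 ≤ ENNReal.ofReal (2 * Real.pi) * ∫⁻ t, ‖h t‖ₑ ^ 2 := by
  have hcont : Continuous (𝓕 h) := VectorFourier.fourierIntegral_continuous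
    Real.continuous_fourierChar (by exact continuous_inner) h1
  have e1 : ∫⁻ ξ, ‖𝓕 h ξ‖ₑ ^ 2 = ∫⁻ t, ‖h t‖ₑ ^ 2 := by
    rw [← eLpNorm_two_sq, ← eLpNorm_two_sq, ← eLpNorm_congr_ae (coeFn_fourier_toLp h1 h2)]
    have := Lp.norm_fourier_eq (h2.toLp h)
    rw [Lp.norm_def, Lp.norm_def, ENNReal.toReal_eq_toReal_iff' (Lp.eLpNorm_ne_top _)
      (Lp.eLpNorm_ne_top _), eLpNorm_congr_ae h2.coeFn_toLp] at this
    rw [this]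
  have hpi : (0 : ℝ) < 2 * Real.pi := by positivity
  have e2 := Real.map_volume_mul_left (a := -(2 * Real.pi)⁻¹) (by simp [Real.pi_ne_zero])
  have e3 : ∫⁻ τ : ℝ, ‖𝓕 h (-(2 * Real.pi)⁻¹ * τ)‖ₑ ^ 2
      = ENNReal.ofReal (2 * Real.pi) * ∫⁻ ξ, ‖𝓕 h ξ‖ₑ ^ 2 := by
    rw [← lintegral_map (f := fun ξ => ‖𝓕 h ξ‖ₑ ^ 2) (by fun_prop) (measurable_const_mul _), e2,
      lintegral_smul_measure, abs_inv, abs_neg, abs_inv, inv_inv, abs_of_pos hpi, smul_eq_mul]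
  simp_rw [timeFourier_eq]
  rw [e3, e1]

/-- The integral of `g` against `exp(i k x)` over the torus. -/
def circleCoeff (g : Torus → ℂ) (k : ℤ) : ℂ := ∫ x : Torus, g x * fourier k x

/-- `circleCoeff` pairs with `exp(i k x)` over length `2π`, whereas `fourierCoeff` pairs with
`exp(-i k x)` in normalized measure. This sign is why `-k` appears in the statements about
`spaceCoeff`. -/
theorem fourierCoeff_eq_circleCoeff (g : Torus → ℂ) (k : ℤ) :
    fourierCoeff g k = (2 * Real.pi : ℂ)⁻¹ * circleCoeff g (-k) := by
  unfold fourierCoeff circleCoeff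
  rw [AddCircle.integral_haarAddCircle, Complex.real_smul]
  push_cast
  congr 1
  refine integral_congr_ae (Filter.Eventually.of_forall fun x => ?_)
  simp only [smul_eq_mul]
  ring

theorem ofReal_two_pi_ne_zero : (2 * Real.pi : ℂ) ≠ 0 := by
  exact_mod_cast Real.two_pi_pos.ne'

theorem tsum_circleCoeff_sq_le {g : Torus → ℂ} (hg : Measurable g) :
    ∑' k : ℤ, ‖circleCoeff g k‖ₑ ^ 2 ≤ ENNReal.ofReal (2 * Real.pi) * ∫⁻ x, ‖g x‖ₑ ^ 2 := by
  have hpi : (0 : ℝ) < 2 * Real.pi := by positivity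
  by_cases htop : ∫⁻ x, ‖g x‖ₑ ^ 2 = ⊤
  · rw [htop, ENNReal.mul_top (by simpa using Real.pi_pos)]
    exact le_top
  have hgL : MemLp g 2 := memLp_two_of_lintegral_lt_top hg.aestronglyMeasurable (lt_top_iff_ne_top.2 htop)
  have hgH : MemLp g 2 AddCircle.haarAddCircle := memLp_haarAddCircle_iff.2 hgL
  have hs := hasSum_sq_fourierCoeff (hgH.toLp g)
  have hc : ∀ k, ‖fourierCoeff (hgH.toLp g) k‖ ^ 2
      = ((2 * Real.pi)⁻¹) ^ 2 * ‖circleCoeff g (-k)‖ ^ 2 := by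
    intro k
    rw [fourierCoeff_congr_ae hgH.coeFn_toLp, fourierCoeff_eq_circleCoeff, norm_mul, mul_pow]
    congr 2
    rw [norm_inv]
    congr 1
    have : ((2 * Real.pi : ℝ) : ℂ) = 2 * Real.pi := by push_cast; rfl
    rw [← this, Complex.norm_real, Real.norm_eq_abs, abs_of_pos hpi]
  have hi : ∫ t, ‖(hgH.toLp g) t‖ ^ 2 ∂AddCircle.haarAddCircle
      = (2 * Real.pi)⁻¹ * ∫ x, ‖g x‖ ^ 2 := by
    have : ∫ t, ‖(hgH.toLp g) t‖ ^ 2 ∂AddCircle.haarAddCircle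
        = ∫ t, ‖g t‖ ^ 2 ∂AddCircle.haarAddCircle := by
      apply integral_congr_ae
      filter_upwards [hgH.coeFn_toLp] with x hx
      rw [hx]
    rw [this, AddCircle.integral_haarAddCircle, smul_eq_mul]
  simp_rw [hc] at hs
  rw [hi] at hs
  have hs2 := hs.mul_left ((2 * Real.pi) ^ 2)
  have e1 : ∀ k, (2 * Real.pi) ^ 2 * (((2 * Real.pi)⁻¹) ^ 2 * ‖circleCoeff g (-k)‖ ^ 2)
      = ‖circleCoeff g (-k)‖ ^ 2 := by
    intro k
    rw [← mul_assoc, ← mul_pow, mul_inv_cancel₀ hpi.ne', one_pow, one_mul]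
  have e2 : (2 * Real.pi) ^ 2 * ((2 * Real.pi)⁻¹ * ∫ x, ‖g x‖ ^ 2)
      = (2 * Real.pi) * ∫ x, ‖g x‖ ^ 2 := by
    rw [← mul_assoc, sq, mul_assoc (2 * Real.pi), mul_inv_cancel₀ hpi.ne', mul_one]
  simp_rw [e1] at hs2
  rw [e2] at hs2
  have hs3 : HasSum (fun k : ℤ => ‖circleCoeff g k‖ ^ 2) ((2 * Real.pi) * ∫ x, ‖g x‖ ^ 2) :=
    ((Equiv.neg ℤ).hasSum_iff (f := fun k : ℤ => ‖circleCoeff g k‖ ^ 2)).1 hs2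
  have e3 : ∀ z : ℂ, ‖z‖ₑ ^ 2 = ENNReal.ofReal (‖z‖ ^ 2) := by
    intro z
    rw [ENNReal.ofReal_pow (norm_nonneg _), ofReal_norm]
  simp_rw [e3]
  rw [← ENNReal.ofReal_tsum_of_nonneg (fun _ => by positivity) hs3.summable, hs3.tsum_eq,
    ENNReal.ofReal_mul hpi.le, ofReal_integral_eq_lintegral_ofReal
    ((memLp_two_iff_integrable_sq_norm hgL.1).1 hgL)
    (Filter.Eventually.of_forall fun _ => by positivity)]

/-- Parseval for the pair `g₁` and `conj g₂`, as the pairing here is bilinear. -/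
theorem integral_mul_eq_tsum_circleCoeff {g₁ g₂ : Torus → ℂ} (h1 : MemLp g₁ 2) (h2 : MemLp g₂ 2) :
    ∫ x, g₁ x * g₂ x
      = ∑' k : ℤ, (2 * Real.pi : ℂ)⁻¹ * (circleCoeff g₁ (-k) * circleCoeff g₂ k) := by
  have h1H : MemLp g₁ 2 AddCircle.haarAddCircle := memLp_haarAddCircle_iff.2 h1
  have h2H : MemLp g₂ 2 AddCircle.haarAddCircle := memLp_haarAddCircle_iff.2 h2
  have h3H : MemLp (fun x => conj (g₂ x)) 2 AddCircle.haarAddCircle := h2H.star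
  have hs := (fourierBasis (T := 2 * Real.pi)).tsum_inner_mul_inner (h3H.toLp _) (h1H.toLp _)
  have e1 : ∀ k, inner ℂ (fourierBasis (T := 2 * Real.pi) k) (h1H.toLp g₁)
      = (2 * Real.pi : ℂ)⁻¹ * circleCoeff g₁ (-k) := by
    intro k
    rw [← HilbertBasis.repr_apply_apply, fourierBasis_repr, fourierCoeff_congr_ae h1H.coeFn_toLp,
      fourierCoeff_eq_circleCoeff]
  have e2 : ∀ k, inner ℂ (h3H.toLp (fun x => conj (g₂ x))) (fourierBasis (T := 2 * Real.pi) k)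
      = (2 * Real.pi : ℂ)⁻¹ * circleCoeff g₂ k := by
    intro k
    rw [← inner_conj_symm, ← HilbertBasis.repr_apply_apply, fourierBasis_repr,
      fourierCoeff_congr_ae h3H.coeFn_toLp, fourierCoeff_eq_circleCoeff, map_mul, map_inv₀]
    congr 1
    · rw [map_mul, Complex.conj_ofReal, map_ofNat]
    · unfold circleCoeff
      rw [← integral_conj]
      refine integral_congr_ae (Filter.Eventually.of_forall fun x => ?_)
      simp only [map_mul, Complex.conj_conj]
      rw [← fourier_neg, neg_neg]
  have e3 : inner ℂ (h3H.toLp (fun x => conj (g₂ x))) (h1H.toLp g₁)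
      = (2 * Real.pi : ℂ)⁻¹ * ∫ x, g₁ x * g₂ x := by
    rw [L2.inner_def]
    have : ∫ x, inner ℂ (h3H.toLp (fun x => conj (g₂ x)) x) (h1H.toLp g₁ x)
        ∂AddCircle.haarAddCircle = ∫ x, g₁ x * g₂ x ∂AddCircle.haarAddCircle := by
      apply integral_congr_ae
      filter_upwards [h1H.coeFn_toLp, h3H.coeFn_toLp] with x hx1 hx3
      rw [hx1, hx3]
      simp
    rw [this, AddCircle.integral_haarAddCircle, Complex.real_smul]
    push_cast
    rfl
  simp_rw [e1, e2] at hs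
  rw [e3] at hs
  have : ∫ x, g₁ x * g₂ x = (2 * Real.pi : ℂ) * ((2 * Real.pi : ℂ)⁻¹ * ∫ x, g₁ x * g₂ x) := by
    rw [mul_inv_cancel_left₀ ofReal_two_pi_ne_zero]
  rw [this, ← hs, ← tsum_mul_left]
  congr 1 with k
  have := ofReal_two_pi_ne_zero
  field_simp

/-- The spatial Fourier coefficients of a function on `𝕋 × ℝ`. -/
def spaceCoeff (U : Torus × ℝ → ℂ) (k : ℤ) (t : ℝ) : ℂ := circleCoeff (fun x => U (x, t)) k

theorem measurable_spaceCoeff {U : Torus × ℝ → ℂ} (hU : Measurable U) (k : ℤ) :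
    Measurable (spaceCoeff U k) := by
  have h : Measurable fun p : ℝ × Torus => U (p.2, p.1) * fourier k p.2 := by fun_prop
  exact h.stronglyMeasurable.integral_prod_right'.measurable

theorem lintegral_spaceCoeff_sq_le {U : Torus × ℝ → ℂ} (hU : Measurable U) :
    ∫⁻ y, ‖spaceCoeff U y.1 y.2‖ₑ ^ 2 ∂freqMeasure
      ≤ ENNReal.ofReal (2 * Real.pi) * ∫⁻ p, ‖U p‖ₑ ^ 2 := by
  have hm := measurable_uncurry_of_forall (measurable_spaceCoeff hU)
  have hmk := measurable_spaceCoeff hU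
  have hU2 : Measurable fun p => ‖U p‖ₑ ^ 2 := by fun_prop
  have hprod : ∫⁻ p, ‖U p‖ₑ ^ 2 = ∫⁻ t : ℝ, ∫⁻ x : Torus, ‖U (x, t)‖ₑ ^ 2 :=
    lintegral_prod_symm _ hU2.aemeasurable
  have hpart : Measurable fun t : ℝ => ∫⁻ x : Torus, ‖U (x, t)‖ₑ ^ 2 :=
    Measurable.lintegral_prod_right' (f := fun p : ℝ × Torus => ‖U (p.2, p.1)‖ₑ ^ 2) (by fun_prop)
  calc ∫⁻ y, ‖spaceCoeff U y.1 y.2‖ₑ ^ 2 ∂freqMeasure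
      = ∑' k : ℤ, ∫⁻ t, ‖spaceCoeff U k t‖ₑ ^ 2 := lintegral_freqMeasure (by fun_prop)
    _ = ∫⁻ t, ∑' k : ℤ, ‖spaceCoeff U k t‖ₑ ^ 2 :=
        (lintegral_tsum fun k => by fun_prop).symm
    _ ≤ ∫⁻ t : ℝ, ENNReal.ofReal (2 * Real.pi) * ∫⁻ x : Torus, ‖U (x, t)‖ₑ ^ 2 :=
        lintegral_mono fun t =>
          tsum_circleCoeff_sq_le (hU.comp (measurable_id.prodMk measurable_const))
    _ = ENNReal.ofReal (2 * Real.pi) * ∫⁻ p, ‖U p‖ₑ ^ 2 := by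
        rw [lintegral_const_mul _ hpart, hprod]

theorem memLp_spaceCoeff {U : Torus × ℝ → ℂ} (hU : Measurable U) (h2 : MemLp U 2) :
    MemLp (fun y : ℤ × ℝ => spaceCoeff U y.1 y.2) 2 freqMeasure :=
  memLp_two_of_lintegral_lt_top
    (measurable_uncurry_of_forall (measurable_spaceCoeff hU)).aestronglyMeasurable
    ((lintegral_spaceCoeff_sq_le hU).trans_lt
      (ENNReal.mul_lt_top ENNReal.ofReal_lt_top (lintegral_sq_lt_top_of_memLp_two h2)))

theorem memLp_slice {F : ℤ → ℝ → ℂ} (hF : ∀ k, Measurable (F k))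
    (h : MemLp (fun y : ℤ × ℝ => F y.1 y.2) 2 freqMeasure) (k : ℤ) : MemLp (F k) 2 := by
  have hm := measurable_uncurry_of_forall hF
  refine memLp_two_of_lintegral_lt_top (hF k).aestronglyMeasurable ?_
  have := lintegral_sq_lt_top_of_memLp_two h
  rw [lintegral_freqMeasure (by fun_prop)] at this
  exact (ENNReal.le_tsum k).trans_lt this

theorem integral_freqMeasure {A : ℤ × ℝ → ℂ} (hA : Integrable A freqMeasure) :
    ∫ y, A y ∂freqMeasure = ∑' k : ℤ, ∫ t, A (k, t) := by
  unfold freqMeasure at *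
  rw [integral_prod _ hA, integral_countable hA.integral_prod_left]
  simp

theorem integral_freqMeasure_symm {A : ℤ × ℝ → ℂ} (hA : Integrable A freqMeasure) :
    ∫ y, A y ∂freqMeasure = ∫ t, ∑' k : ℤ, A (k, t) := by
  unfold freqMeasure at *
  rw [integral_prod_symm _ hA]
  apply integral_congr_ae
  filter_upwards [hA.prod_left_ae] with t ht
  rw [integral_countable ht]
  simp

end Bourgain
end

/-! ### Square integrable functions on the slab and their space-time transform -/

noncomputable section

namespace Bourgain

/-- The pairing of `g` with `exp(i k x + i τ t)`. -/
def expPairing (g : Torus × ℝ → ℂ) (y : ℤ × ℝ) : ℂ :=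
  ∫ p : Torus × ℝ, g p * fourier y.1 p.1 * Complex.exp (Complex.I * (y.2 : ℂ) * (p.2 : ℂ))

theorem volume_torus_prod :
    (volume : Measure (Torus × ℝ)) = (volume : Measure Torus).prod volume := rfl

/-- A measurable square integrable function on `𝕋 × ℝ` that vanishes off `𝕋 × (0, T)`. -/
structure IsSlabFunction (T : ℝ) (g : Torus × ℝ → ℂ) : Prop where
  measurable : Measurable g
  memLp : MemLp g 2
  eq_zero : ∀ x t, t ∉ Ioo 0 T → g (x, t) = 0

theorem norm_fourier_apply (k : ℤ) (x : Torus) : ‖fourier k x‖ = 1 := by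
  rw [fourier_apply, Circle.norm_coe]

theorem integrable_of_memLp_two_of_eq_zero {α : Type*} [MeasurableSpace α] {μ : Measure α}
    {f : α → ℂ} (hf : MemLp f 2 μ) {s : Set α} (hμ : μ s ≠ ⊤)
    (h0 : ∀ x, x ∉ s → f x = 0) : Integrable f μ := by
  have h : IntegrableOn f s μ := by
    have : IsFiniteMeasure (μ.restrict s) := ⟨by simpa using hμ.lt_top⟩
    exact (hf.restrict s).integrable (by norm_num)
  exact h.integrable_of_forall_notMem_eq_zero h0

theorem volume_slab_lt_top (T : ℝ) :
    (volume : Measure (Torus × ℝ)) (univ ×ˢ Ioo 0 T) < ⊤ := by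
  rw [volume_torus_prod, Measure.prod_prod]
  exact ENNReal.mul_lt_top (measure_lt_top _ _) (by simp)

namespace IsSlabFunction

variable {T : ℝ} {g : Torus × ℝ → ℂ}

theorem integrable (hg : IsSlabFunction T g) : Integrable g :=
  integrable_of_memLp_two_of_eq_zero hg.memLp
    (volume_slab_lt_top T).ne fun p hp => hg.eq_zero p.1 p.2 fun h => hp ⟨mem_univ _, h⟩

theorem spaceCoeff_eq_zero (hg : IsSlabFunction T g) (k : ℤ) {t : ℝ} (ht : t ∉ Ioo 0 T) :
    spaceCoeff g k t = 0 := by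
  simp [spaceCoeff, circleCoeff, hg.eq_zero _ t ht]

theorem memLp_spaceCoeff (hg : IsSlabFunction T g) (k : ℤ) : MemLp (spaceCoeff g k) 2 :=
  memLp_slice (measurable_spaceCoeff hg.measurable)
    (Bourgain.memLp_spaceCoeff hg.measurable hg.memLp) k

theorem integrable_spaceCoeff (hg : IsSlabFunction T g) (k : ℤ) : Integrable (spaceCoeff g k) :=
  integrable_of_memLp_two_of_eq_zero (hg.memLp_spaceCoeff k) (s := Ioo 0 T) (by simp)
    fun _ ht => hg.spaceCoeff_eq_zero k ht

end IsSlabFunction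

theorem expPairing_eq {g : Torus × ℝ → ℂ} (hg : Integrable g) (k : ℤ) (τ : ℝ) :
    expPairing g (k, τ) = timeFourier (spaceCoeff g k) τ := by
  have hi : Integrable fun p : Torus × ℝ =>
      g p * fourier k p.1 * Complex.exp (Complex.I * (τ : ℂ) * (p.2 : ℂ)) := by
    refine hg.mono ?_ (Filter.Eventually.of_forall fun p => ?_)
    · exact (hg.aestronglyMeasurable.mul (by fun_prop)).mul (by fun_prop)
    · rw [norm_mul, norm_mul, norm_fourier_apply, norm_exp_I_mul_mul, mul_one, mul_one]
  unfold expPairing timeFourier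
  rw [volume_torus_prod] at hi ⊢
  rw [integral_prod_symm _ hi]
  refine integral_congr_ae (Filter.Eventually.of_forall fun t => ?_)
  simp only [spaceCoeff, circleCoeff]
  rw [integral_mul_const]

theorem IsSlabFunction.measurable_expPairing {T : ℝ} {g : Torus × ℝ → ℂ}
    (hg : IsSlabFunction T g) : Measurable (expPairing g) := by
  have : expPairing g = fun y : ℤ × ℝ => (fun k τ => timeFourier (spaceCoeff g k) τ) y.1 y.2 :=
    funext fun y => expPairing_eq hg.integrable y.1 y.2
  rw [this]
  exact measurable_uncurry_of_forall fun k =>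
    (continuous_timeFourier (hg.integrable_spaceCoeff k)).measurable

theorem IsSlabFunction.memLp_expPairing {T : ℝ} {g : Torus × ℝ → ℂ}
    (hg : IsSlabFunction T g) : MemLp (expPairing g) 2 freqMeasure := by
  have hm := hg.measurable_expPairing
  have hmc := measurable_uncurry_of_forall (measurable_spaceCoeff hg.measurable)
  refine memLp_two_of_lintegral_lt_top hm.aestronglyMeasurable ?_
  calc ∫⁻ y, ‖expPairing g y‖ₑ ^ 2 ∂freqMeasure
      = ∑' k : ℤ, ∫⁻ τ, ‖timeFourier (spaceCoeff g k) τ‖ₑ ^ 2 := by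
        rw [lintegral_freqMeasure (by fun_prop)]
        simp_rw [expPairing_eq hg.integrable]
    _ ≤ ∑' k : ℤ, ENNReal.ofReal (2 * Real.pi) * ∫⁻ t, ‖spaceCoeff g k t‖ₑ ^ 2 :=
        ENNReal.tsum_le_tsum fun k =>
          lintegral_timeFourier_sq_le (hg.integrable_spaceCoeff k) (hg.memLp_spaceCoeff k)
    _ = ENNReal.ofReal (2 * Real.pi) * ∫⁻ y, ‖spaceCoeff g y.1 y.2‖ₑ ^ 2 ∂freqMeasure := by
        rw [ENNReal.tsum_mul_left, lintegral_freqMeasure (by fun_prop)]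
    _ < ⊤ := ENNReal.mul_lt_top ENNReal.ofReal_lt_top
        (lintegral_sq_lt_top_of_memLp_two (Bourgain.memLp_spaceCoeff hg.measurable hg.memLp))

theorem ae_memLp_slice {U : Torus × ℝ → ℂ} (hU : Measurable U) (h2 : MemLp U 2) :
    ∀ᵐ t : ℝ, MemLp (fun x : Torus => U (x, t)) 2 := by
  have hU2 : Measurable fun p => ‖U p‖ₑ ^ 2 := by fun_prop
  have hprod : ∫⁻ p, ‖U p‖ₑ ^ 2 = ∫⁻ t : ℝ, ∫⁻ x : Torus, ‖U (x, t)‖ₑ ^ 2 :=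
    lintegral_prod_symm _ hU2.aemeasurable
  have hpart : Measurable fun t : ℝ => ∫⁻ x : Torus, ‖U (x, t)‖ₑ ^ 2 :=
    Measurable.lintegral_prod_right' (f := fun p : ℝ × Torus => ‖U (p.2, p.1)‖ₑ ^ 2) (by fun_prop)
  have hlt := lintegral_sq_lt_top_of_memLp_two h2
  rw [hprod] at hlt
  filter_upwards [ae_lt_top hpart hlt.ne] with t ht
  exact memLp_two_of_lintegral_lt_top
    (hU.comp (measurable_id.prodMk measurable_const)).aestronglyMeasurable ht

theorem memLp_spaceCoeff_neg {U : Torus × ℝ → ℂ} (hU : Measurable U) (h2 : MemLp U 2) :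
    MemLp (fun y : ℤ × ℝ => spaceCoeff U (-y.1) y.2) 2 freqMeasure := by
  have hm := measurable_uncurry_of_forall (measurable_spaceCoeff hU)
  have hm' := measurable_uncurry_of_forall fun k => measurable_spaceCoeff hU (-k)
  refine memLp_two_of_lintegral_lt_top hm'.aestronglyMeasurable ?_
  have := lintegral_sq_lt_top_of_memLp_two (memLp_spaceCoeff hU h2)
  rw [lintegral_freqMeasure (by fun_prop)] at this ⊢
  rwa [← (Equiv.neg ℤ).tsum_eq] at this

/-- Parseval's identity in the space variable. -/
theorem integral_mul_eq_integral_spaceCoeff {U g : Torus × ℝ → ℂ} (hU : Measurable U)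
    (hU2 : MemLp U 2) (hg : Measurable g) (hg2 : MemLp g 2) :
    ∫ p, U p * g p = (2 * Real.pi : ℂ)⁻¹ *
      ∫ y, spaceCoeff U (-y.1) y.2 * spaceCoeff g y.1 y.2 ∂freqMeasure := by
  have hi := integrable_mul_of_memLp_two hU2 hg2
  have hi2 := integrable_mul_of_memLp_two (memLp_spaceCoeff_neg hU hU2) (memLp_spaceCoeff hg hg2)
  rw [integral_freqMeasure_symm hi2, ← integral_const_mul]
  rw [volume_torus_prod] at hi ⊢
  rw [integral_prod_symm _ hi]
  apply integral_congr_ae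
  filter_upwards [ae_memLp_slice hU hU2, ae_memLp_slice hg hg2] with t h1 h2
  rw [integral_mul_eq_tsum_circleCoeff h1 h2, tsum_mul_left]
  rfl

/-- Parseval's identity for a function represented by `F` on the slab. -/
theorem integral_mul_eq_of_represents {T : ℝ} {U g : Torus × ℝ → ℂ} (hU : IsSlabFunction T U)
    (hg : IsSlabFunction T g) {F : ℤ → ℝ → ℂ} (hF : ∀ k, Measurable (F k))
    (hF2 : MemLp (fun y : ℤ × ℝ => F y.1 y.2) 2 freqMeasure)
    (hrep : ∀ k, Represents T (spaceCoeff U (-k)) (F k)) :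
    ∫ p, U p * g p
      = (2 * Real.pi : ℂ)⁻¹ * ∫ y, F y.1 y.2 * expPairing g y ∂freqMeasure := by
  rw [integral_mul_eq_integral_spaceCoeff hU.measurable hU.memLp hg.measurable hg.memLp,
    integral_freqMeasure (integrable_mul_of_memLp_two (memLp_spaceCoeff_neg hU.measurable hU.memLp)
      (memLp_spaceCoeff hg.measurable hg.memLp)),
    integral_freqMeasure (integrable_mul_of_memLp_two hF2 hg.memLp_expPairing)]
  congr 2 with k
  simp_rw [expPairing_eq hg.integrable]
  exact (hrep k).integral_eq (hU.memLp_spaceCoeff (-k)) (memLp_slice hF hF2 k) (hF k)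
    (hg.integrable_spaceCoeff k) (hg.memLp_spaceCoeff k) fun _ ht => hg.spaceCoeff_eq_zero k ht

end Bourgain
end

/-! ### Test functions, and extensions seen frequency by frequency -/

noncomputable section

namespace Bourgain

namespace IsTestFunction

variable {T : ℝ} {φ : Torus × ℝ → ℂ}

theorem continuous (hφ : IsTestFunction T φ) : Continuous φ := by
  -- Smoothness is assumed for the periodic lift; continuity descends through the quotient map.
  have hq : IsOpenQuotientMap (Prod.map ((↑) : ℝ → Torus) (id : ℝ → ℝ)) :=
    QuotientAddGroup.isOpenQuotientMap_mk.prodMap .id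
  rw [← hq.continuous_comp_iff]
  exact hφ.1.continuous

theorem hasCompactSupport (hφ : IsTestFunction T φ) : HasCompactSupport φ := by
  obtain ⟨a, b, _, _, h⟩ := hφ.2
  exact HasCompactSupport.intro (isCompact_univ.prod (isCompact_Icc (a := a) (b := b)))
    fun p hp => h p.1 p.2 fun ht => hp ⟨mem_univ _, ht⟩

theorem eq_zero (hφ : IsTestFunction T φ) (x : Torus) (t : ℝ) (ht : t ∉ Ioo 0 T) :
    φ (x, t) = 0 := by
  obtain ⟨a, b, ha, hb, h⟩ := hφ.2
  exact h x t fun hm => ht ⟨ha.trans_le hm.1, hm.2.trans_lt hb⟩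

theorem isSlabFunction (hφ : IsTestFunction T φ) : IsSlabFunction T φ :=
  ⟨hφ.continuous.measurable, hφ.continuous.memLp_of_hasCompactSupport hφ.hasCompactSupport,
    hφ.eq_zero⟩

theorem exists_norm_le (hφ : IsTestFunction T φ) : ∃ C : ℝ, ∀ p, ‖φ p‖ ≤ C :=
  hφ.continuous.bounded_above_of_compact_support hφ.hasCompactSupport

end IsTestFunction

theorem integral_fourier_torus (n : ℤ) :
    ∫ x : Torus, fourier n x = if n = 0 then (2 * Real.pi : ℂ) else 0 := by
  split_ifs with hn
  · subst hn
    simp [Measure.real, AddCircle.measure_univ, Real.pi_pos.le]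
  · have := integral_eq_zero_of_add_right_eq_neg (μ := (volume : Measure Torus))
      (fourier_add_half_inv_index hn (Fact.out : 0 < 2 * Real.pi))
    exact this

theorem contDiff_fourier_coe (k : ℤ) :
    ContDiff ℝ ∞ fun x : ℝ => (fourier k (x : Torus) : ℂ) := by
  have : (fun x : ℝ => (fourier k (x : Torus) : ℂ))
      = fun x : ℝ => Complex.exp (Complex.I * k * Complex.ofRealCLM x) := by
    funext x
    rw [fourier_coe_apply]
    congr 1
    have := ofReal_two_pi_ne_zero
    push_cast
    rw [Complex.ofRealCLM_apply]
    field_simp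
  rw [this]
  fun_prop

theorem isTestFunction_fourier_mul {T : ℝ} (hT : 0 < T) (k : ℤ) {h : ℝ → ℂ}
    (h1 : ContDiff ℝ ∞ h) (h2 : HasCompactSupport h) (h3 : tsupport h ⊆ Ioo 0 T) :
    IsTestFunction T fun p => fourier k p.1 * h p.2 := by
  refine ⟨((contDiff_fourier_coe k).comp contDiff_fst).mul (h1.comp contDiff_snd), ?_⟩
  rcases (tsupport h).eq_empty_or_nonempty with he | hne
  -- For `h = 0` the support has no endpoints, so any interval inside `(0, T)` serves.
  · refine ⟨T / 2, T / 2, by positivity, by linarith, fun x t _ => ?_⟩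
    have : h = 0 := tsupport_eq_empty_iff.1 he
    simp [this]
  · have hc : IsCompact (tsupport h) := h2
    refine ⟨sInf (tsupport h), sSup (tsupport h), (h3 (hc.sInf_mem hne)).1,
      (h3 (hc.sSup_mem hne)).2, fun x t ht => ?_⟩
    have : t ∉ tsupport h := fun hm => ht ⟨csInf_le hc.bddBelow hm, le_csSup hc.bddAbove hm⟩
    simp [image_eq_zero_of_notMem_tsupport this]

theorem spaceCoeff_fourier_mul (k n : ℤ) (h : ℝ → ℂ) (t : ℝ) :
    spaceCoeff (fun p => fourier (-k) p.1 * h p.2) n t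
      = if n = k then (2 * Real.pi : ℂ) * h t else 0 := by
  have e : ∀ x : Torus, fourier (-k) x * h t * fourier n x = fourier (n - k) x * h t := by
    intro x
    rw [sub_eq_add_neg, fourier_add]
    ring
  simp only [spaceCoeff, circleCoeff]
  simp_rw [e]
  rw [integral_mul_const, integral_fourier_torus]
  simp only [sub_eq_zero]
  split_ifs <;> simp

theorem ofFunction_eq {T : ℝ} {U : Torus × ℝ → ℂ} (hU : ∀ x t, t ∉ Ioo 0 T → U (x, t) = 0)
    (φ : Torus × ℝ → ℂ) : ofFunction T U φ = ∫ p, U p * φ p := by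
  unfold ofFunction slab
  refine setIntegral_eq_integral_of_forall_compl_eq_zero fun p hp => ?_
  rw [show U p = 0 from hU p.1 p.2 fun h => hp ⟨mem_univ _, h⟩, zero_mul]

theorem ofFourier_eq (F : ℤ → ℝ → ℂ) (φ : Torus × ℝ → ℂ) :
    ofFourier F φ = ∑' k : ℤ, (2 * Real.pi : ℂ)⁻¹ * ∫ τ, F k τ * expPairing φ (k, τ) := rfl

/-- Testing with `exp(-i k x) h(t)` isolates the mode `k`: all other terms of the series vanish by
orthogonality. -/
theorem represents_of_isExtension {T : ℝ} (hT : 0 < T) {U : Torus × ℝ → ℂ}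
    (hU : IsSlabFunction T U) {F : ℤ → ℝ → ℂ} (hF : IsExtension T (ofFunction T U) F) (k : ℤ) :
    Represents T (spaceCoeff U (-k)) (F k) := by
  intro h h1 h2 h3
  have key := hF.2 _ (isTestFunction_fourier_mul hT (-k) h1 h2 h3)
  have hslab := (isTestFunction_fourier_mul hT (-k) h1 h2 h3).isSlabFunction
  have hi := hslab.integrable
  rw [ofFunction_eq hU.eq_zero, ofFourier_eq, tsum_eq_single k] at key
  · have e1 : ∀ τ, expPairing (fun p => fourier (-k) p.1 * h p.2) (k, τ)
        = 2 * Real.pi * timeFourier h τ := by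
      intro τ
      rw [expPairing_eq hi]
      unfold timeFourier
      rw [← integral_const_mul]
      simp_rw [spaceCoeff_fourier_mul, if_true, mul_assoc]
    have e2 : ∀ τ, F k τ * (2 * Real.pi * timeFourier h τ)
        = 2 * Real.pi * (F k τ * timeFourier h τ) := fun τ => by ring
    simp_rw [e1, e2] at key
    rw [integral_const_mul, inv_mul_cancel_left₀ ofReal_two_pi_ne_zero] at key
    rw [← key]
    have hi2 := integrable_mul_of_memLp_two hU.memLp hslab.memLp
    rw [volume_torus_prod] at hi2 ⊢
    rw [integral_prod_symm _ hi2]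
    refine integral_congr_ae (Filter.Eventually.of_forall fun t => ?_)
    simp only [spaceCoeff, circleCoeff, ← mul_assoc]
    rw [integral_mul_const]
  · intro n hn
    have : ∀ τ, expPairing (fun p => fourier (-k) p.1 * h p.2) (n, τ) = 0 := by
      intro τ
      rw [expPairing_eq hi]
      unfold timeFourier
      simp_rw [spaceCoeff_fourier_mul, if_neg hn]
      simp
    simp_rw [this, mul_zero, integral_zero, mul_zero]

/-- Used for the zero mode of a function of vanishing mean. -/
theorem represents_zero {T : ℝ} {a : ℝ → ℂ} (h : ∀ᵐ t, t ∈ Ioo 0 T → a t = 0) :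
    Represents T a 0 := by
  intro q _ _ hq
  simp only [Pi.zero_apply, zero_mul, integral_zero]
  refine integral_eq_zero_of_ae ?_
  filter_upwards [h] with t ht
  by_cases hm : t ∈ Ioo 0 T
  · simp [ht hm]
  · simp [image_eq_zero_of_notMem_tsupport fun h' => hm (hq h')]

end Bourgain
end

/-! ### Derivatives of test functions and decay of their transforms -/

noncomputable section

namespace Bourgain

/-- The time derivative of a function on `𝕋 × ℝ`. -/
def derivT (φ : Torus × ℝ → ℂ) (p : Torus × ℝ) : ℂ := deriv (fun r : ℝ => φ (p.1, r)) p.2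

theorem derivX_coe {φ : Torus × ℝ → ℂ} (hφ : Differentiable ℝ fun p : ℝ × ℝ => φ ((p.1 : Torus), p.2))
    (x t : ℝ) : HasDerivAt (fun y : ℝ => φ ((y : Torus), t)) (derivX φ ((x : Torus), t)) x := by
  have h : DifferentiableAt ℝ (fun y : ℝ => φ ((y : Torus), t)) x :=
    (hφ.comp (differentiable_id.prodMk (differentiable_const t))) x
  have e : derivX φ ((x : Torus), t) = deriv (fun y : ℝ => φ ((y : Torus), t)) x := by
    unfold derivX
    have := deriv_comp_const_add (fun y : ℝ => φ ((y : Torus), t)) x 0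
    rw [add_zero] at this
    rw [← this]
    rfl
  rw [e]
  exact h.hasDerivAt

theorem derivT_coe {φ : Torus × ℝ → ℂ} (hφ : Differentiable ℝ fun p : ℝ × ℝ => φ ((p.1 : Torus), p.2))
    (x : Torus) (t : ℝ) : HasDerivAt (fun r : ℝ => φ (x, r)) (derivT φ (x, t)) t := by
  induction x using QuotientAddGroup.induction_on with | H x => ?_
  have h : DifferentiableAt ℝ (fun r : ℝ => φ ((x : Torus), r)) t :=
    (hφ.comp ((differentiable_const x).prodMk differentiable_id)) t
  exact h.hasDerivAt

/-- On the lift, the derivative in the direction `w` is the Fréchet derivative applied to `w`, hence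
smooth; `derivX` and `derivT` are the two coordinate directions. -/
theorem isTestFunction_of_hasDerivAt {T : ℝ} {φ ψ : Torus × ℝ → ℂ} (hφ : IsTestFunction T φ)
    (w : ℝ × ℝ) (hψ : ∀ x t : ℝ, HasDerivAt (fun r : ℝ => φ (((x + r * w.1 : ℝ) : Torus), t + r * w.2))
      (ψ ((x : Torus), t)) 0)
    (h0 : ∀ a b : ℝ, (∀ x t, t ∉ Icc a b → φ (x, t) = 0) → ∀ x t, t ∉ Icc a b → ψ (x, t) = 0) :
    IsTestFunction T ψ := by
  obtain ⟨h1, a, b, ha, hb, h⟩ := hφ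
  refine ⟨?_, a, b, ha, hb, h0 a b h⟩
  have e : (fun p : ℝ × ℝ => ψ ((p.1 : Torus), p.2))
      = fun p => fderiv ℝ (fun p : ℝ × ℝ => φ ((p.1 : Torus), p.2)) p w := by
    funext p
    have hd : DifferentiableAt ℝ (fun p : ℝ × ℝ => φ ((p.1 : Torus), p.2)) p :=
      h1.differentiable (by simp) p
    have h2 := hd.hasFDerivAt.hasLineDerivAt w
    refine (hψ p.1 p.2).unique ?_
    exact h2
  rw [e]
  exact (h1.fderiv_right (m := ∞) (by simp)).clm_apply contDiff_const

theorem IsTestFunction.differentiable {T : ℝ} {φ : Torus × ℝ → ℂ} (hφ : IsTestFunction T φ) :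
    Differentiable ℝ fun p : ℝ × ℝ => φ ((p.1 : Torus), p.2) := hφ.1.differentiable (by simp)

theorem IsTestFunction.derivX {T : ℝ} {φ : Torus × ℝ → ℂ} (hφ : IsTestFunction T φ) :
    IsTestFunction T (derivX φ) := by
  refine isTestFunction_of_hasDerivAt hφ (1, 0) (fun x t => ?_) fun a b h x t ht => ?_
  · have h := derivX_coe hφ.differentiable x t
    have h2 : HasDerivAt (fun r : ℝ => x + r * 1) 1 0 := by
      simpa using ((hasDerivAt_id (0 : ℝ)).mul_const 1).const_add x
    have h3 := HasDerivAt.scomp (0 : ℝ) (h := fun r : ℝ => x + r * 1) (by simpa using h) h2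
    simpa [Function.comp_def] using h3
  · simp [Bourgain.derivX, h _ t ht]

theorem IsTestFunction.derivT {T : ℝ} {φ : Torus × ℝ → ℂ} (hφ : IsTestFunction T φ) :
    IsTestFunction T (derivT φ) := by
  refine isTestFunction_of_hasDerivAt hφ (0, 1) (fun x t => ?_) fun a b h x t ht => ?_
  · have h := derivT_coe hφ.differentiable (x : Torus) t
    have h2 : HasDerivAt (fun r : ℝ => t + r * 1) 1 0 := by
      simpa using ((hasDerivAt_id (0 : ℝ)).mul_const 1).const_add t
    have h3 := HasDerivAt.scomp (0 : ℝ) (h := fun r : ℝ => t + r * 1) (by simpa using h) h2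
    simpa [Function.comp_def] using h3
  · have : (fun r : ℝ => φ (x, r)) =ᶠ[nhds t] fun _ => 0 := by
      filter_upwards [isClosed_Icc.isOpen_compl.mem_nhds ht] with r hr
      exact h x r hr
    rw [Bourgain.derivT, this.deriv_eq]
    simp

/-- Integration by parts over a period; periodicity cancels the boundary terms. -/
theorem expPairing_derivX {T : ℝ} {φ : Torus × ℝ → ℂ} (hφ : IsTestFunction T φ) (k : ℤ) (τ : ℝ) :
    expPairing (derivX φ) (k, τ) = -(Complex.I * k) * expPairing φ (k, τ) := by
  have hs : ∀ t, spaceCoeff (derivX φ) k t = -(Complex.I * k) * spaceCoeff φ k t := by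
    intro t
    have h1 : ∀ x : ℝ, HasDerivAt (fun y : ℝ => φ ((y : Torus), t) * fourier k (y : Torus))
        (derivX φ ((x : Torus), t) * fourier k (x : Torus)
          + Complex.I * k * (φ ((x : Torus), t) * fourier k (x : Torus))) x := by
      intro x
      have h2 := (derivX_coe hφ.differentiable x t).mul (hasDerivAt_fourier (2 * Real.pi) k x)
      convert! h2 using 1
      have := ofReal_two_pi_ne_zero
      push_cast
      field_simp
    have hc1 : Continuous fun x : Torus => derivX φ (x, t) * fourier k x :=
      (hφ.derivX.continuous.comp (by fun_prop)).mul (map_continuous _)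
    have hc2 : Continuous fun x : Torus => φ (x, t) * fourier k x :=
      (hφ.continuous.comp (by fun_prop)).mul (map_continuous _)
    have hc1' : Continuous fun x : ℝ => derivX φ ((x : Torus), t) * fourier k (x : Torus) :=
      hc1.comp (AddCircle.continuous_mk' _)
    have hc2' : Continuous fun x : ℝ => φ ((x : Torus), t) * fourier k (x : Torus) :=
      hc2.comp (AddCircle.continuous_mk' _)
    have hc3 : Continuous fun x : ℝ =>
        Complex.I * k * (φ ((x : Torus), t) * fourier k (x : Torus)) := continuous_const.mul hc2'
    have h3 := intervalIntegral.integral_eq_sub_of_hasDerivAt (a := 0) (b := 0 + 2 * Real.pi)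
      (fun x _ => h1 x)
      ((hc1'.add hc3).intervalIntegrable _ _)
    rw [intervalIntegral.integral_add (hc1'.intervalIntegrable _ _)
      (hc3.intervalIntegrable _ _), intervalIntegral.integral_const_mul,
      AddCircle.intervalIntegral_preimage (2 * Real.pi) 0 (fun x : Torus => derivX φ (x, t) * fourier k x),
      AddCircle.intervalIntegral_preimage (2 * Real.pi) 0 (fun x : Torus => φ (x, t) * fourier k x),
      zero_add, AddCircle.coe_period, AddCircle.coe_zero, sub_self] at h3
    simp only [spaceCoeff, circleCoeff]
    linear_combination h3
  rw [expPairing_eq hφ.derivX.isSlabFunction.integrable, expPairing_eq hφ.isSlabFunction.integrable]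
  unfold timeFourier
  simp_rw [hs, mul_assoc]
  rw [integral_const_mul]

theorem integral_derivT_mul_exp {T : ℝ} {φ : Torus × ℝ → ℂ} (hφ : IsTestFunction T φ) (x : Torus)
    (τ : ℝ) : ∫ t : ℝ, derivT φ (x, t) * Complex.exp (Complex.I * τ * t)
      = -(Complex.I * τ) * ∫ t : ℝ, φ (x, t) * Complex.exp (Complex.I * τ * t) := by
  have hT : ∀ {ψ : Torus × ℝ → ℂ}, IsTestFunction T ψ →
      Integrable fun t : ℝ => ψ (x, t) * Complex.exp (Complex.I * τ * t) := by
    intro ψ hψ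
    have hc : Continuous fun t : ℝ => ψ (x, t) * Complex.exp (Complex.I * τ * t) :=
      (hψ.continuous.comp (by fun_prop)).mul (by fun_prop)
    refine hc.integrable_of_hasCompactSupport (HasCompactSupport.intro (isCompact_Icc (a := 0) (b := T))
      fun t ht => ?_)
    rw [hψ.eq_zero x t fun h => ht (Ioo_subset_Icc_self h), zero_mul]
  have h1 : ∀ t : ℝ, HasDerivAt (fun t : ℝ => φ (x, t) * Complex.exp (Complex.I * τ * t))
      (derivT φ (x, t) * Complex.exp (Complex.I * τ * t)
        + Complex.I * τ * (φ (x, t) * Complex.exp (Complex.I * τ * t))) t := by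
    intro t
    have h2 : HasDerivAt (fun t : ℝ => Complex.exp (Complex.I * τ * t))
        (Complex.exp (Complex.I * τ * t) * (Complex.I * τ)) t := by
      have := ((hasDerivAt_id (t : ℂ)).const_mul (Complex.I * τ)).cexp.comp_ofReal
      simpa using this
    convert! (derivT_coe hφ.differentiable x t).mul h2 using 1
    ring
  have h3 := integral_eq_zero_of_hasDerivAt_of_integrable h1
    ((hT hφ.derivT).add ((hT hφ).const_mul _)) (hT hφ)
  rw [integral_add (hT hφ.derivT) ((hT hφ).const_mul _), integral_const_mul] at h3
  linear_combination h3

theorem expPairing_derivT {T : ℝ} {φ : Torus × ℝ → ℂ} (hφ : IsTestFunction T φ) (k : ℤ) (τ : ℝ) :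
    expPairing (derivT φ) (k, τ) = -(Complex.I * τ) * expPairing φ (k, τ) := by
  have hi : ∀ {ψ : Torus × ℝ → ℂ}, IsTestFunction T ψ → expPairing ψ (k, τ)
      = ∫ x : Torus, fourier k x * ∫ t : ℝ, ψ (x, t) * Complex.exp (Complex.I * τ * t) := by
    intro ψ hψ
    have hi : Integrable fun p : Torus × ℝ =>
        ψ p * fourier k p.1 * Complex.exp (Complex.I * (τ : ℂ) * (p.2 : ℂ)) := by
      refine hψ.isSlabFunction.integrable.mono ?_ (Filter.Eventually.of_forall fun p => ?_)
      · exact (hψ.isSlabFunction.integrable.aestronglyMeasurable.mul (by fun_prop)).mul (by fun_prop)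
      · rw [norm_mul, norm_mul, norm_fourier_apply, norm_exp_I_mul_mul, mul_one, mul_one]
    unfold expPairing
    rw [volume_torus_prod] at hi ⊢
    rw [integral_prod _ hi]
    refine integral_congr_ae (Filter.Eventually.of_forall fun x => ?_)
    simp only
    rw [← integral_const_mul]
    congr 1 with t
    ring
  rw [hi hφ.derivT, hi hφ, ← integral_const_mul]
  congr 1 with x
  rw [integral_derivT_mul_exp hφ]
  ring

theorem exists_norm_expPairing_le (φ : Torus × ℝ → ℂ) :
    ∃ C : ℝ, ∀ y, ‖expPairing φ y‖ ≤ C := by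
  refine ⟨∫ p, ‖φ p‖, fun y => (norm_integral_le_integral_norm _).trans (le_of_eq ?_)⟩
  simp_rw [norm_mul, norm_fourier_apply, norm_exp_I_mul_mul, mul_one]

/-- Two derivatives in each variable give decay like `(1 + k²)⁻¹ (1 + τ²)⁻¹`, which is summable in
`k` and integrable in `τ`. -/
theorem integrable_expPairing {T : ℝ} {φ : Torus × ℝ → ℂ} (hφ : IsTestFunction T φ) :
    Integrable (expPairing φ) freqMeasure := by
  obtain ⟨C₁, h1⟩ := exists_norm_expPairing_le (φ)
  obtain ⟨C₂, h2⟩ := exists_norm_expPairing_le (derivX (derivX φ))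
  obtain ⟨C₃, h3⟩ := exists_norm_expPairing_le (derivT (derivT φ))
  obtain ⟨C₄, h4⟩ := exists_norm_expPairing_le (derivX (derivX (derivT (derivT φ))))
  have hb : ∀ y : ℤ × ℝ, (1 + (y.1 : ℝ) ^ 2) * (1 + y.2 ^ 2) * ‖expPairing φ y‖
      ≤ C₁ + C₂ + C₃ + C₄ := by
    rintro ⟨k, τ⟩
    have e2 := h2 (k, τ)
    have e3 := h3 (k, τ)
    have e4 := h4 (k, τ)
    rw [expPairing_derivX hφ.derivX, expPairing_derivX hφ] at e2
    rw [expPairing_derivT hφ.derivT, expPairing_derivT hφ] at e3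
    rw [expPairing_derivX hφ.derivT.derivT.derivX, expPairing_derivX hφ.derivT.derivT,
      expPairing_derivT hφ.derivT, expPairing_derivT hφ] at e4
    simp only [norm_mul, norm_neg, Complex.norm_I, one_mul, Complex.norm_intCast,
      Complex.norm_real, Real.norm_eq_abs] at e2 e3 e4
    have a1 := sq_abs (k : ℝ)
    have a2 := sq_abs τ
    have := h1 (k, τ)
    calc _ = ‖expPairing φ (k, τ)‖ + |(k : ℝ)| * (|(k : ℝ)| * ‖expPairing φ (k, τ)‖)
          + |τ| * (|τ| * ‖expPairing φ (k, τ)‖)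
          + |(k : ℝ)| * (|(k : ℝ)| * (|τ| * (|τ| * ‖expPairing φ (k, τ)‖))) := by
          simp only
          rw [← a1, ← a2]
          ring
      _ ≤ _ := by linarith
  have hi : Integrable (fun y : ℤ × ℝ => ((1 + (y.1 : ℝ) ^ 2)⁻¹ * (C₁ + C₂ + C₃ + C₄))
      * (1 + y.2 ^ 2)⁻¹) freqMeasure := by
    unfold freqMeasure
    refine Integrable.mul_prod (f := fun k : ℤ => (1 + (k : ℝ) ^ 2)⁻¹ * (C₁ + C₂ + C₃ + C₄))
      (Integrable.mul_const (integrable_count_iff.2 ?_) _) integrable_inv_one_add_sq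
    refine Summable.of_norm_bounded_eventually
      (Real.summable_one_div_int_pow.2 one_lt_two) ?_
    filter_upwards [(Set.finite_singleton (0 : ℤ)).compl_mem_cofinite] with k hk
    have : (0 : ℝ) < (k : ℝ) ^ 2 := by
      have : (k : ℝ) ≠ 0 := by exact_mod_cast hk
      positivity
    rw [norm_norm, norm_inv, Real.norm_of_nonneg (by positivity), one_div]
    exact inv_anti₀ this (by linarith)
  refine hi.mono' hφ.isSlabFunction.measurable_expPairing.aestronglyMeasurable
    (Filter.Eventually.of_forall fun y => ?_)
  have p1 : (0 : ℝ) < 1 + (y.1 : ℝ) ^ 2 := by positivity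
  have p2 : (0 : ℝ) < 1 + y.2 ^ 2 := by positivity
  have := hb y
  rw [inv_mul_eq_div, ← div_eq_mul_inv, div_div, le_div_iff₀ (mul_pos p1 p2)]
  linarith

end Bourgain
end

/-! ### The transform of a product is a convolution -/

noncomputable section

namespace Bourgain

theorem IsSlabFunction.mul_bounded {T : ℝ} {V φ : Torus × ℝ → ℂ} (hV : IsSlabFunction T V)
    (hφ : Measurable φ) {C : ℝ} (hC : ∀ p, ‖φ p‖ ≤ C) : IsSlabFunction T fun p => V p * φ p where
  measurable := hV.measurable.mul hφ
  memLp := by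
    refine hV.memLp.of_le_mul (c := C) (hV.measurable.mul hφ).aestronglyMeasurable
      (Filter.Eventually.of_forall fun p => ?_)
    rw [norm_mul, mul_comm]
    gcongr
    exact hC p
  eq_zero x t ht := by rw [hV.eq_zero x t ht, zero_mul]

/-- The space-time exponential `exp(i k x + i τ t)`. -/
def spaceTimeExp (y : ℤ × ℝ) (p : Torus × ℝ) : ℂ :=
  fourier y.1 p.1 * Complex.exp (Complex.I * (y.2 : ℂ) * (p.2 : ℂ))

theorem norm_spaceTimeExp (y : ℤ × ℝ) (p : Torus × ℝ) : ‖spaceTimeExp y p‖ = 1 := by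
  rw [spaceTimeExp, norm_mul, norm_fourier_apply, norm_exp_I_mul_mul, mul_one]

theorem measurable_spaceTimeExp (y : ℤ × ℝ) : Measurable (spaceTimeExp y) := by
  unfold spaceTimeExp
  fun_prop

theorem spaceTimeExp_add (y z : ℤ × ℝ) (p : Torus × ℝ) :
    spaceTimeExp (y + z) p = spaceTimeExp y p * spaceTimeExp z p := by
  simp only [spaceTimeExp, Prod.fst_add, Prod.snd_add]
  rw [fourier_add, mul_mul_mul_comm, ← Complex.exp_add]
  push_cast
  ring_nf

theorem expPairing_eq_integral (g : Torus × ℝ → ℂ) (y : ℤ × ℝ) :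
    expPairing g y = ∫ p, g p * spaceTimeExp y p := by
  simp only [expPairing, spaceTimeExp, mul_assoc]

theorem expPairing_mul_spaceTimeExp (g : Torus × ℝ → ℂ) (y z : ℤ × ℝ) :
    expPairing (fun p => g p * spaceTimeExp y p) z = expPairing g (y + z) := by
  simp only [expPairing_eq_integral, spaceTimeExp_add, mul_assoc]

/-- The convolution of two functions of space-time frequency. -/
def complexConv (f g : ℤ × ℝ → ℂ) (x : ℤ × ℝ) : ℂ := ∫ y, f y * g (x - y) ∂freqMeasure

theorem measurable_complexConv {f g : ℤ × ℝ → ℂ} (hf : Measurable f) (hg : Measurable g) :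
    Measurable (complexConv f g) := by
  have h : Measurable fun p : (ℤ × ℝ) × (ℤ × ℝ) => f p.2 * g (p.1 - p.2) := by fun_prop
  exact h.stronglyMeasurable.integral_prod_right'.measurable

theorem enorm_complexConv_le (f g : ℤ × ℝ → ℂ) (x : ℤ × ℝ) :
    ‖complexConv f g x‖ₑ ≤ conv (fun y => ‖f y‖ₑ) (fun y => ‖g y‖ₑ) x := by
  refine (enorm_integral_le_lintegral_enorm _).trans (le_of_eq ?_)
  simp only [conv, enorm_mul]

theorem conv_sq_le {f g : ℤ × ℝ → ℝ≥0∞} (hf : Measurable f) (hg : Measurable g) (x : ℤ × ℝ) :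
    conv f g x ^ 2 ≤ (∫⁻ y, f y ^ 2 ∂freqMeasure) * ∫⁻ y, g y ^ 2 ∂freqMeasure := by
  refine (lintegral_mul_sq_le freqMeasure (f := f) (g := fun y => g (x - y)) hf.aemeasurable
    (by fun_prop)).trans
    (le_of_eq ?_)
  rw [lintegral_sub_left_eq_self (fun y => g y ^ 2) x]

/-- By Cauchy–Schwarz the convolution of two `L²` functions is bounded, even with absolute values
inside, so the integrability of `P` suffices for Fubini. -/
theorem integrable_complexConv_kernel {f g P : ℤ × ℝ → ℂ} (hf : Measurable f) (hg : Measurable g)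
    (hP : Measurable P) (hf2 : MemLp f 2 freqMeasure) (hg2 : MemLp g 2 freqMeasure)
    (hP1 : Integrable P freqMeasure) :
    Integrable (fun p : (ℤ × ℝ) × (ℤ × ℝ) => f p.1 * g (p.2 - p.1) * P p.2)
      (freqMeasure.prod freqMeasure) := by
  refine ⟨Measurable.aestronglyMeasurable (by fun_prop), ?_⟩
  have hs : ∀ x, conv (fun y => ‖f y‖ₑ) (fun y => ‖g y‖ₑ) x
      ≤ ((∫⁻ y, ‖f y‖ₑ ^ 2 ∂freqMeasure) * ∫⁻ y, ‖g y‖ₑ ^ 2 ∂freqMeasure) ^ (1 / 2 : ℝ) := by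
    intro x
    rw [one_div, ENNReal.le_rpow_inv_iff (by norm_num)]
    exact_mod_cast conv_sq_le (f := fun y => ‖f y‖ₑ) (g := fun y => ‖g y‖ₑ) (by fun_prop)
      (by fun_prop) x
  have hlt : ((∫⁻ y, ‖f y‖ₑ ^ 2 ∂freqMeasure) * ∫⁻ y, ‖g y‖ₑ ^ 2 ∂freqMeasure) ^ (1 / 2 : ℝ) < ⊤ :=
    ENNReal.rpow_lt_top_of_nonneg (by norm_num) (ENNReal.mul_lt_top
      (lintegral_sq_lt_top_of_memLp_two hf2) (lintegral_sq_lt_top_of_memLp_two hg2)).ne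
  change ∫⁻ p : (ℤ × ℝ) × (ℤ × ℝ), ‖f p.1 * g (p.2 - p.1) * P p.2‖ₑ
    ∂(freqMeasure.prod freqMeasure) < ⊤
  rw [lintegral_prod_symm _ (by fun_prop)]
  calc ∫⁻ x, ∫⁻ y, ‖f y * g (x - y) * P x‖ₑ ∂freqMeasure ∂freqMeasure
      = ∫⁻ x, conv (fun y => ‖f y‖ₑ) (fun y => ‖g y‖ₑ) x * ‖P x‖ₑ ∂freqMeasure := by
        refine lintegral_congr fun x => ?_
        simp only [enorm_mul, conv]
        rw [lintegral_mul_const _ (by fun_prop)]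
    _ ≤ ∫⁻ x, ((∫⁻ y, ‖f y‖ₑ ^ 2 ∂freqMeasure) * ∫⁻ y, ‖g y‖ₑ ^ 2 ∂freqMeasure) ^ (1 / 2 : ℝ)
          * ‖P x‖ₑ ∂freqMeasure := by
        gcongr with x
        exact hs x
    _ < ⊤ := by
        rw [lintegral_const_mul _ (by fun_prop)]
        exact ENNReal.mul_lt_top hlt hP1.2

theorem integral_mul_integral_shift {f g P : ℤ × ℝ → ℂ} (hf : Measurable f) (hg : Measurable g)
    (hP : Measurable P) (hf2 : MemLp f 2 freqMeasure) (hg2 : MemLp g 2 freqMeasure)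
    (hP1 : Integrable P freqMeasure) :
    ∫ y, f y * ∫ z, g z * P (y + z) ∂freqMeasure ∂freqMeasure
      = ∫ x, complexConv f g x * P x ∂freqMeasure := by
  have h1 : ∀ y, ∫ z, g z * P (y + z) ∂freqMeasure = ∫ x, g (x - y) * P x ∂freqMeasure := by
    intro y
    rw [← integral_add_left_eq_self (fun x => g (x - y) * P x) y]
    simp
  simp_rw [h1, ← integral_const_mul, complexConv, ← integral_mul_const, ← mul_assoc]
  exact integral_integral_swap (integrable_complexConv_kernel hf hg hP hf2 hg2 hP1)

theorem integrable_complexConv_mul {f g P : ℤ × ℝ → ℂ} (hf : Measurable f) (hg : Measurable g)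
    (hP : Measurable P) (hf2 : MemLp f 2 freqMeasure) (hg2 : MemLp g 2 freqMeasure)
    (hP1 : Integrable P freqMeasure) :
    Integrable (fun x => complexConv f g x * P x) freqMeasure := by
  have := (integrable_complexConv_kernel hf hg hP hf2 hg2 hP1).integral_prod_right
  simp only [integral_mul_const] at this
  exact this

/-- A family of functions of `τ` represents, frequency by frequency, a function on the slab. -/
structure IsRepresentation (T : ℝ) (U : Torus × ℝ → ℂ) (F : ℤ → ℝ → ℂ) : Prop where
  slab : IsSlabFunction T U
  measurable : ∀ k, Measurable (F k)
  memLp : MemLp (fun y : ℤ × ℝ => F y.1 y.2) 2 freqMeasure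
  represents : ∀ k, Represents T (spaceCoeff U (-k)) (F k)

/-- The space-time Fourier transform of a product is a convolution. -/
theorem integral_mul_mul_eq {T : ℝ} {U V φ : Torus × ℝ → ℂ} {F G : ℤ → ℝ → ℂ}
    (hU : IsRepresentation T U F) (hV : IsRepresentation T V G) (hφ : IsTestFunction T φ) :
    ∫ p, U p * V p * φ p = (2 * Real.pi : ℂ)⁻¹ * ((2 * Real.pi : ℂ)⁻¹ *
      ∫ x, complexConv (fun y => F y.1 y.2) (fun y => G y.1 y.2) x * expPairing φ x
        ∂freqMeasure) := by
  obtain ⟨C, hC⟩ := hφ.exists_norm_le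
  have hVφ := hV.slab.mul_bounded hφ.continuous.measurable hC
  have h1 : ∀ y, expPairing (fun p => V p * φ p) y
      = (2 * Real.pi : ℂ)⁻¹ * ∫ z, G z.1 z.2 * expPairing φ (y + z) ∂freqMeasure := by
    intro y
    -- Multiplying `φ` by an exponential shifts its transform by `y`. Parseval for `V` against this
    -- product gives the transform of `V φ`, against which Parseval is then applied to `U`.
    have hφe := hφ.isSlabFunction.mul_bounded (measurable_spaceTimeExp y)
      fun p => (norm_spaceTimeExp y p).le
    have := integral_mul_eq_of_represents hV.slab hφe hV.measurable hV.memLp hV.represents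
    simp_rw [expPairing_mul_spaceTimeExp] at this
    rw [← this, expPairing_eq_integral]
    simp only [mul_assoc]
  have h2 := integral_mul_eq_of_represents hU.slab hVφ hU.measurable hU.memLp hU.represents
  simp_rw [h1] at h2
  simp_rw [mul_assoc (U _)]
  rw [h2, ← integral_mul_integral_shift (measurable_uncurry_of_forall hU.measurable)
    (measurable_uncurry_of_forall hV.measurable) hφ.isSlabFunction.measurable_expPairing hU.memLp
    hV.memLp (integrable_expPairing hφ)]
  refine congrArg _ ?_
  rw [← integral_const_mul]
  congr 1
  funext y
  ring

/-- The space-time Fourier transform of the derivative of a product. -/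
def derivProductTransform (F G : ℤ → ℝ → ℂ) (k : ℤ) (τ : ℝ) : ℂ :=
  Complex.I * k * ((2 * Real.pi : ℂ)⁻¹ *
    complexConv (fun y => F y.1 y.2) (fun y => G y.1 y.2) (k, τ))

theorem enorm_derivProductTransform_le (F G : ℤ → ℝ → ℂ) (k : ℤ) (τ : ℝ) :
    ‖derivProductTransform F G k τ‖ₑ ≤ ENNReal.ofReal |(k : ℝ)| *
      conv (fun y => ‖F y.1 y.2‖ₑ) (fun y => ‖G y.1 y.2‖ₑ) (k, τ) := by
  unfold derivProductTransform
  have e1 : ‖Complex.I * (k : ℂ)‖ₑ = ENNReal.ofReal |(k : ℝ)| := by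
    rw [← ofReal_norm, norm_mul, Complex.norm_I, one_mul, Complex.norm_intCast]
  have e2 : ‖(2 * Real.pi : ℂ)⁻¹‖ₑ ≤ 1 := by
    rw [← ofReal_norm, ENNReal.ofReal_le_one, norm_inv, norm_mul, Complex.norm_real,
      Complex.norm_ofNat, Real.norm_of_nonneg Real.pi_pos.le]
    exact inv_le_one_of_one_le₀ (by linarith [Real.two_le_pi])
  rw [enorm_mul (Complex.I * (k : ℂ)), e1, enorm_mul]
  gcongr
  calc _ ≤ 1 * ‖complexConv (fun y => F y.1 y.2) (fun y => G y.1 y.2) (k, τ)‖ₑ := by gcongr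
    _ ≤ _ := by
      rw [one_mul]
      exact enorm_complexConv_le _ _ _

theorem isExtension_derivProductTransform {T : ℝ} {U V : Torus × ℝ → ℂ} {F G : ℤ → ℝ → ℂ}
    (hU : IsRepresentation T U F) (hV : IsRepresentation T V G) :
    IsExtension T (distribDerivX (ofFunction T fun p => U p * V p))
      (derivProductTransform F G) := by
  have hFm := measurable_uncurry_of_forall hU.measurable
  have hGm := measurable_uncurry_of_forall hV.measurable
  refine ⟨fun k => ?_, fun φ hφ => ?_⟩
  · have := measurable_complexConv hFm hGm
    unfold derivProductTransform
    exact Measurable.aestronglyMeasurable (by fun_prop)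
  · have e1 : distribDerivX (ofFunction T fun p => U p * V p) φ
        = -∫ p, U p * V p * derivX φ p := by
      unfold distribDerivX
      rw [ofFunction_eq]
      intro x t ht
      rw [hU.slab.eq_zero x t ht, zero_mul]
    have e2 : ∀ x, complexConv (fun y => F y.1 y.2) (fun y => G y.1 y.2) x
          * expPairing (derivX φ) x
        = -(2 * Real.pi : ℂ) * (derivProductTransform F G x.1 x.2 * expPairing φ x) := by
      rintro ⟨k, τ⟩
      rw [expPairing_derivX hφ, derivProductTransform]
      have := ofReal_two_pi_ne_zero
      field_simp
    have hi := integrable_complexConv_mul hFm hGm hφ.derivX.isSlabFunction.measurable_expPairing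
      hU.memLp hV.memLp (integrable_expPairing hφ.derivX)
    simp_rw [e2] at hi
    have hi2 : Integrable (fun x : ℤ × ℝ => derivProductTransform F G x.1 x.2 * expPairing φ x)
        freqMeasure := by
      have := hi.const_mul (-(2 * Real.pi : ℂ))⁻¹
      simp_rw [inv_mul_cancel_left₀ (neg_ne_zero.2 ofReal_two_pi_ne_zero)] at this
      exact this
    rw [e1, integral_mul_mul_eq hU hV hφ.derivX]
    simp_rw [e2]
    rw [integral_const_mul, ofFourier_eq, tsum_mul_left, integral_freqMeasure hi2]
    have := ofReal_two_pi_ne_zero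
    field_simp

end Bourgain
end

/-! ### Assembly in the restriction spaces -/

noncomputable section

namespace Bourgain

theorem lintegral_sq_le_normX_sq {β γ s b : ℝ} (hs : 0 ≤ s) (hb : 0 ≤ b) {F : ℤ → ℝ → ℂ}
    (hF : ∀ k, Measurable (F k)) :
    ∫⁻ y, ‖F y.1 y.2‖ₑ ^ 2 ∂freqMeasure ≤ normX β γ s b F ^ 2 := by
  have hm := measurable_uncurry_of_forall hF
  have e : normX β γ s b F ^ 2 = ∑' k : ℤ, ∫⁻ τ : ℝ,
      (ENNReal.ofReal (bracket k ^ s * bracket (τ - phase β γ k) ^ b) * ‖F k τ‖ₑ) ^ 2 := by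
    unfold normX
    rw [← ENNReal.rpow_natCast, ← ENNReal.rpow_mul]
    norm_num
  rw [e, lintegral_freqMeasure (by fun_prop)]
  refine ENNReal.tsum_le_tsum fun k => lintegral_mono fun τ => pow_le_pow_left' ?_ 2
  refine le_mul_of_one_le_left bot_le ?_
  rw [ENNReal.one_le_ofReal]
  exact one_le_mul_of_one_le_of_one_le (Real.one_le_rpow (one_le_bracket _) hs)
    (Real.one_le_rpow (one_le_bracket _) hb)

theorem memLp_of_normX_lt_top {β γ s b : ℝ} (hs : 0 ≤ s) (hb : 0 ≤ b) {F : ℤ → ℝ → ℂ}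
    (hF : ∀ k, Measurable (F k)) (h : normX β γ s b F < ⊤) :
    MemLp (fun y : ℤ × ℝ => F y.1 y.2) 2 freqMeasure :=
  memLp_two_of_lintegral_lt_top (measurable_uncurry_of_forall hF).aestronglyMeasurable
    ((lintegral_sq_le_normX_sq hs hb hF).trans_lt (ENNReal.pow_lt_top h))

theorem normX_congr {β γ s b : ℝ} {F G : ℤ → ℝ → ℂ} (h : ∀ k, F k =ᵐ[volume] G k) :
    normX β γ s b F = normX β γ s b G := by
  unfold normX
  congr 2 with k
  refine lintegral_congr_ae ?_
  filter_upwards [h k] with τ hτ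
  rw [hτ]

theorem ofFourier_congr {F G : ℤ → ℝ → ℂ} (h : ∀ k, F k =ᵐ[volume] G k) (φ : Torus × ℝ → ℂ) :
    ofFourier F φ = ofFourier G φ := by
  unfold ofFourier
  congr 1 with k
  congr 1
  refine integral_congr_ae ?_
  filter_upwards [h k] with τ hτ
  rw [hτ]

theorem ofFunction_congr {T : ℝ} {f g : Torus × ℝ → ℂ} (h : f =ᵐ[slab T] g)
    (φ : Torus × ℝ → ℂ) : ofFunction T f φ = ofFunction T g φ := by
  unfold ofFunction
  refine integral_congr_ae ?_
  filter_upwards [h] with p hp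
  rw [hp]

theorem exists_isSlabFunction {T : ℝ} {u : Torus × ℝ → ℂ} (hu : MemLp u 2 (slab T)) :
    ∃ U, IsSlabFunction T U ∧ u =ᵐ[slab T] U := by
  have hS : MeasurableSet ((univ : Set Torus) ×ˢ Ioo 0 T) := MeasurableSet.univ.prod measurableSet_Ioo
  set w := hu.1.mk u with hw
  have hwm : Measurable w := hu.1.stronglyMeasurable_mk.measurable
  refine ⟨indicator (univ ×ˢ Ioo 0 T) w, ⟨hwm.indicator hS, ?_, fun x t ht => ?_⟩, ?_⟩
  · rw [memLp_indicator_iff_restrict hS]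
    exact hu.ae_eq hu.1.ae_eq_mk
  · exact indicator_of_notMem (fun h => ht h.2) _
  · filter_upwards [hu.1.ae_eq_mk, ae_restrict_mem hS] with p hp hpS
    rw [indicator_of_mem hpS, hp]

theorem spaceCoeff_zero_eq_zero {T : ℝ} {u U : Torus × ℝ → ℂ} (hm : MeanZero T u)
    (h : u =ᵐ[slab T] U) : ∀ᵐ t, t ∈ Ioo 0 T → spaceCoeff U 0 t = 0 := by
  have h1 : slab T = (volume : Measure Torus).prod (volume.restrict (Ioo 0 T)) := by
    rw [slab, volume_torus_prod, ← Measure.prod_restrict, Measure.restrict_univ]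
  rw [h1] at h
  have h2 : ∀ᵐ q : ℝ × Torus ∂((volume.restrict (Ioo 0 T)).prod volume), u q.swap = U q.swap :=
    Measure.measurePreserving_swap.quasiMeasurePreserving.ae h
  have h3 := Measure.ae_ae_of_ae_prod h2
  rw [ae_restrict_iff' measurableSet_Ioo] at h3
  filter_upwards [h3, hm] with t ht hmt htT
  rw [← hmt htT, spaceCoeff, circleCoeff]
  refine integral_congr_ae ?_
  filter_upwards [ht htT] with x hx
  simp only [Prod.swap_prod_mk] at hx
  rw [fourier_zero, mul_one, hx]

/-- The modified transform represents the function, and its norms gain a power of `T`. -/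
theorem exists_representation {T : ℝ} (hT : 0 < T) (hT1 : T < 1) {Ψ : ℝ → ℂ} {C : ℝ} (hC : 0 < C)
    (hΨc : Continuous Ψ) (hΨ : ∀ σ, ‖Ψ σ‖ ≤ C * bracket σ ^ (-2 : ℝ))
    (hΨ1 : ∀ r ∈ Icc (0 : ℝ) 1, ∫ σ : ℝ, Ψ σ * Complex.exp (Complex.I * (σ : ℂ) * (r : ℂ)) = 1)
    {u U : Torus × ℝ → ℂ} (hU : IsSlabFunction T U) (huU : u =ᵐ[slab T] U) (hm : MeanZero T u)
    {β γ s : ℝ} (hs : 0 ≤ s) {F : ℤ → ℝ → ℂ} (hF : IsExtension T (ofFunction T u) F)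
    (hfin : normX β γ s (1 / 2) F < ⊤) :
    ∃ F' : ℤ → ℝ → ℂ, IsRepresentation T U F' ∧ F' 0 = 0 ∧
      ∀ c : ℝ, 0 ≤ c → c ≤ 1 / 2 → normX β γ s c F' ≤ cutoffConst C ^ (1 / 2 : ℝ) *
        ENNReal.ofReal (T ^ (1 / 2 - c - 1 / 64)) * normX β γ s (1 / 2) F := by
  -- Extensions are only almost everywhere measurable; measurable representatives have the same norm
  -- and define the same distribution.
  set F₁ : ℤ → ℝ → ℂ := fun k => (hF.1 k).mk (F k) with hF₁
  have hF₁m : ∀ k, Measurable (F₁ k) := fun k => (hF.1 k).stronglyMeasurable_mk.measurable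
  have hFF : ∀ k, F k =ᵐ[volume] F₁ k := fun k => (hF.1 k).ae_eq_mk
  have hext : IsExtension T (ofFunction T U) F₁ :=
    ⟨fun k => (hF₁m k).aestronglyMeasurable, fun φ hφ => by
      rw [← ofFunction_congr huU, hF.2 φ hφ, ofFourier_congr hFF]⟩
  rw [normX_congr hFF] at hfin ⊢
  have hle : ∀ c : ℝ, 0 ≤ c → c ≤ 1 / 2 → normX β γ s c (modifiedExtension Ψ β γ T F₁) ≤
      cutoffConst C ^ (1 / 2 : ℝ) *
        ENNReal.ofReal (T ^ (1 / 2 - c - 1 / 64)) * normX β γ s (1 / 2) F₁ :=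
    fun c h0 h1 => normX_modifiedExtension_le hC hΨc hΨ β γ s hT hT1 h0 h1 hF₁m
  refine ⟨modifiedExtension Ψ β γ T F₁, ⟨hU, measurable_modifiedExtension hΨc β γ T hF₁m, ?_, ?_⟩,
    by simp [modifiedExtension], hle⟩
  · refine memLp_of_normX_lt_top hs (by norm_num : (0 : ℝ) ≤ 1 / 2)
      (measurable_modifiedExtension hΨc β γ T hF₁m)
      ((hle (1 / 2) (by norm_num) le_rfl).trans_lt ?_)
    exact ENNReal.mul_lt_top (ENNReal.mul_lt_top (ENNReal.rpow_lt_top_of_nonneg (by norm_num)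
      (cutoffConst_lt_top C).ne) ENNReal.ofReal_lt_top) hfin
  · intro k
    unfold modifiedExtension
    split_ifs with hk
    -- The zero mode of `U` vanishes on `(0, T)`, so the zero function represents it, whatever `F`
    -- was there.
    · rw [hk, neg_zero]
      exact represents_zero (spaceCoeff_zero_eq_zero hm huU)
    · exact (represents_of_isExtension hT hU hext k).cutoffTransform
        (integrable_of_norm_le_bracket hΨc hΨ) hΨ1 hT _
        (memLp_slice hF₁m (memLp_of_normX_lt_top hs (by norm_num) hF₁m hfin) k)

/-- The quotient norms are infima that need not be attained. The estimate is proved for every pair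
of larger values, and one lets these decrease to the infima; finiteness keeps multiplication
continuous. -/
theorem le_mul_mul_of_forall_lt {Z A R₁ R₂ : ℝ≥0∞} (hA : A < ⊤) (h1 : R₁ < ⊤) (h2 : R₂ < ⊤)
    (h : ∀ a b, R₁ < a → R₂ < b → Z ≤ A * a * b) : Z ≤ A * R₁ * R₂ := by
  have hn1 : (nhdsWithin R₁ (Ioi R₁)).NeBot := nhdsGT_neBot_of_exists_gt ⟨⊤, h1⟩
  have hn2 : (nhdsWithin R₂ (Ioi R₂)).NeBot := nhdsGT_neBot_of_exists_gt ⟨⊤, h2⟩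
  have hmul : ∀ {c : ℝ≥0∞} (x : ℝ≥0∞), c < ⊤ →
      Filter.Tendsto (fun a => c * a) (nhdsWithin x (Ioi x)) (nhds (c * x)) := fun x hc =>
    (ENNReal.continuous_const_mul hc.ne).continuousWithinAt
  have h3 : ∀ b, R₂ < b → b < ⊤ → Z ≤ A * R₁ * b := by
    intro b hb hbt
    have := ge_of_tendsto (hmul (c := A * b) R₁ (ENNReal.mul_lt_top hA hbt))
      (Filter.eventually_of_mem self_mem_nhdsWithin fun a ha =>
        (h a b ha hb).trans (le_of_eq (mul_right_comm A a b)))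
    rwa [mul_right_comm] at this
  refine ge_of_tendsto (hmul (c := A * R₁) R₂ (ENNReal.mul_lt_top hA h1)) ?_
  filter_upwards [self_mem_nhdsWithin, mem_nhdsWithin_of_mem_nhds (Iio_mem_nhds h2)] with b hb hbt
  exact h3 b hb hbt

/-- The bilinear estimate in the restriction spaces, for any nonresonant triple of phases. -/
theorem exists_restrictedNormZ_le (c : ℝ) {K : ℝ≥0∞} (hK : K < ⊤) :
    ∃ C : ℝ, 0 < C ∧ ∀ (β₀ γ₀ β₁ γ₁ β₂ γ₂ : ℝ),
      Nonresonant (phase β₀ γ₀) (phase β₁ γ₁) (phase β₂ γ₂) c K →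
      ∀ s : ℝ, 0 ≤ s → ∀ T : ℝ, 0 < T → T < 1 → ∀ u v : Torus × ℝ → ℂ,
      MemLp u 2 (slab T) → MemLp v 2 (slab T) → MeanZero T u → MeanZero T v →
      restrictedNormX β₁ γ₁ s (1 / 2) T (ofFunction T u) < ⊤ →
      restrictedNormX β₂ γ₂ s (1 / 2) T (ofFunction T v) < ⊤ →
      restrictedNormZ β₀ γ₀ s (-1 / 2) T (distribDerivX (ofFunction T fun p => u p * v p)) ≤
        ENNReal.ofReal (C * T ^ (1 / 32 : ℝ)) *
          restrictedNormX β₁ γ₁ s (1 / 2) T (ofFunction T u) *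
          restrictedNormX β₂ γ₂ s (1 / 2) T (ofFunction T v) := by
  obtain ⟨D, hD, hmain⟩ := Nonresonant.exists_normZ_le c hK
  obtain ⟨Ψ, C, hC, hΨc, hΨ, hΨ1⟩ := exists_cutoff_kernel
  set M : ℝ≥0∞ := cutoffConst C ^ (1 / 2 : ℝ) with hM
  have hMt : M < ⊤ := ENNReal.rpow_lt_top_of_nonneg (by norm_num) (cutoffConst_lt_top C).ne
  have hE : D * (2 * (M * M)) < ⊤ := ENNReal.mul_lt_top hD
    (ENNReal.mul_lt_top (by simp) (ENNReal.mul_lt_top hMt hMt))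
  -- One `M` per modified extension and `2` for the two terms of the bilinear bound; adding `1`
  -- makes the constant positive.
  refine ⟨(D * (2 * (M * M))).toReal + 1, by positivity, ?_⟩
  intro β₀ γ₀ β₁ γ₁ β₂ γ₂ hnr s hs T hT hT1 u v hu hv hmu hmv hru hrv
  obtain ⟨U, hU, huU⟩ := exists_isSlabFunction hu
  obtain ⟨V, hV, hvV⟩ := exists_isSlabFunction hv
  refine le_mul_mul_of_forall_lt ENNReal.ofReal_lt_top hru hrv fun a b ha hb => ?_
  obtain ⟨F, hF⟩ := iInf_lt_iff.1 ha
  obtain ⟨hFe, hFa⟩ := iInf_lt_iff.1 hF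
  obtain ⟨G, hG⟩ := iInf_lt_iff.1 hb
  obtain ⟨hGe, hGb⟩ := iInf_lt_iff.1 hG
  obtain ⟨F', hF', hF0, hFn⟩ := exists_representation hT hT1 hC hΨc hΨ hΨ1 hU huU hmu hs hFe
    (hFa.trans_le le_top)
  obtain ⟨G', hG', hG0, hGn⟩ := exists_representation hT hT1 hC hΨc hΨ hΨ1 hV hvV hmv hs hGe
    (hGb.trans_le le_top)
  have hext : IsExtension T (distribDerivX (ofFunction T fun p => u p * v p))
      (derivProductTransform F' G') := by
    have := isExtension_derivProductTransform hF' hG'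
    refine ⟨this.1, fun φ hφ => ?_⟩
    rw [← this.2 φ hφ]
    unfold distribDerivX
    exact congrArg _ (ofFunction_congr (huU.mul hvV) _)
  -- The strong norm costs `T^(-1/64)` and the weak one gains `T^(3/64)`.
  have hpow : ENNReal.ofReal (T ^ (1 / 2 - 1 / 2 - 1 / 64 : ℝ)) *
      ENNReal.ofReal (T ^ (1 / 2 - 7 / 16 - 1 / 64 : ℝ)) = ENNReal.ofReal (T ^ (1 / 32 : ℝ)) := by
    rw [← ENNReal.ofReal_mul (by positivity), ← Real.rpow_add hT]
    norm_num
  set p := ENNReal.ofReal (T ^ (1 / 2 - 1 / 2 - 1 / 64 : ℝ))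
  set q := ENNReal.ofReal (T ^ (1 / 2 - 7 / 16 - 1 / 64 : ℝ))
  calc restrictedNormZ β₀ γ₀ s (-1 / 2) T (distribDerivX (ofFunction T fun p => u p * v p))
      ≤ normZ β₀ γ₀ s (-1 / 2) (derivProductTransform F' G') := iInf₂_le _ hext
    _ ≤ D * (normX β₁ γ₁ s (1 / 2) F' * normX β₂ γ₂ s (7 / 16) G' +
          normX β₁ γ₁ s (7 / 16) F' * normX β₂ γ₂ s (1 / 2) G') :=
        hmain β₀ γ₀ β₁ γ₁ β₂ γ₂ hnr s hs F' G' _ hF'.measurable hG'.measurable hF0 hG0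
          (enorm_derivProductTransform_le F' G')
    _ ≤ D * ((M * p * a) * (M * q * b) + (M * q * a) * (M * p * b)) := by
        have x1 := (hFn (1 / 2) (by norm_num) le_rfl).trans (mul_le_mul_right hFa.le _)
        have x2 := (hGn (7 / 16) (by norm_num) (by norm_num)).trans (mul_le_mul_right hGb.le _)
        have x3 := (hFn (7 / 16) (by norm_num) (by norm_num)).trans (mul_le_mul_right hFa.le _)
        have x4 := (hGn (1 / 2) (by norm_num) le_rfl).trans (mul_le_mul_right hGb.le _)
        gcongr
    _ = D * (2 * (M * M)) * (p * q) * a * b := by ring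
    _ ≤ ENNReal.ofReal (((D * (2 * (M * M))).toReal + 1) * T ^ (1 / 32 : ℝ)) * a * b := by
        rw [hpow, ENNReal.ofReal_mul (by positivity)]
        gcongr
        rw [← ENNReal.ofReal_toReal hE.ne]
        exact ENNReal.ofReal_le_ofReal (by rw [ENNReal.toReal_ofReal (by positivity)]; linarith)

end Bourgain
end

open Bourgain in
theorem lemma3p3 :
    ∃ θ : ℝ, 0 < θ ∧
      ∀ β₁ β₂ : ℝ, β₁ ≠ 0 → β₂ ≠ 0 → β₁ ≠ β₂ → β₁ / β₂ < 1 / 4 →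
        ∃ ε : ℝ, 0 < ε ∧ ∃ C : ℝ, 0 < C ∧
          ∀ γ₁ γ₂ : ℝ, |γ₁| + |γ₂| < ε →
          ∀ s : ℝ, 0 ≤ s → ∀ T : ℝ, 0 < T → T < 1 →
          ∀ u v : Torus × ℝ → ℂ,
            MeasureTheory.MemLp u 2 (slab T) → MeasureTheory.MemLp v 2 (slab T) →
            MeanZero T u → MeanZero T v →
            (restrictedNormX β₁ γ₁ s (1 / 2) T (ofFunction T u) < ⊤ →
              restrictedNormX β₂ γ₂ s (1 / 2) T (ofFunction T v) < ⊤ →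
                restrictedNormZ β₂ γ₂ s (-1 / 2) T
                    (distribDerivX (ofFunction T (fun p => u p * v p))) ≤
                  ENNReal.ofReal (C * T ^ θ) *
                    restrictedNormX β₁ γ₁ s (1 / 2) T (ofFunction T u) *
                    restrictedNormX β₂ γ₂ s (1 / 2) T (ofFunction T v)) ∧
            (restrictedNormX β₂ γ₂ s (1 / 2) T (ofFunction T u) < ⊤ →
              restrictedNormX β₂ γ₂ s (1 / 2) T (ofFunction T v) < ⊤ →
                restrictedNormZ β₁ γ₁ s (-1 / 2) T
                    (distribDerivX (ofFunction T (fun p => u p * v p))) ≤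
                  ENNReal.ofReal (C * T ^ θ) *
                    restrictedNormX β₂ γ₂ s (1 / 2) T (ofFunction T u) *
                    restrictedNormX β₂ γ₂ s (1 / 2) T (ofFunction T v)) := by
  refine ⟨1 / 32, by norm_num, fun β₁ β₂ _ h2 h12 h => ?_⟩
  obtain ⟨c, K, hnr⟩ := exists_nonresonant_mixed h2 h12 h
  obtain ⟨c', K', hnr'⟩ := exists_nonresonant_diagonal h2 h12 h
  -- This is `ε`: half of the gap, the share of the definite form reserved for `γ₁ - γ₂`.
  have hε : 0 < (|β₂ - β₁| - |β₂ + 2 * β₁| / 2) / 2 := half_pos (gap_pos h2 h)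
  -- The finiteness of `K` and `K'` is stored in `Nonresonant`; it is read off at `γ₁ = γ₂ = 0` so
  -- that the constants are fixed before `γ₁` and `γ₂`.
  have hzero : |(0 : ℝ)| + |(0 : ℝ)| < (|β₂ - β₁| - |β₂ + 2 * β₁| / 2) / 2 := by simpa using hε
  obtain ⟨C, hC, hmain⟩ := exists_restrictedNormZ_le c (hnr 0 0 hzero).lt_top
  obtain ⟨C', hC', hmain'⟩ := exists_restrictedNormZ_le c' (hnr' 0 0 hzero).lt_top
  refine ⟨_, hε, max C C', lt_max_of_lt_left hC,
    fun γ₁ γ₂ hγ s hs T hT hT1 u v hu hv hmu hmv => ⟨fun hru hrv => ?_, fun hru hrv => ?_⟩⟩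
  · refine (hmain β₂ γ₂ β₁ γ₁ β₂ γ₂ (hnr γ₁ γ₂ hγ) s hs T hT hT1 u v hu hv hmu hmv hru hrv).trans ?_
    gcongr
    exact le_max_left _ _
  · refine (hmain' β₁ γ₁ β₂ γ₂ β₂ γ₂ (hnr' γ₁ γ₂ hγ) s hs T hT hT1 u v hu hv hmu hmv hru hrv).trans ?_
    gcongr
    exact le_max_right _ _
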